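/- Let $K$ be an arbitrary field, let $n\ge 2$, let $q\in K$ be a primitive $n$-th root of unity, and let $A_1=K\langle x,y\mid xy-qyx=1\rangle$ be the quantum Weyl algebra. Put $h=yx+\frac{1}{q-1}$, $r=y^n$, $t=x^n$, $s=h^n$. The elements $r,t,s$ are central, and the centre of $A_1$ is the polynomial algebra $Z(A_1)=K[r,t]$. Here $\mathrm{Spec}(R)$ is the set of prime two-sided ideals of a ring $R$ ($P\ne R$ is prime if $IJ\subseteq P$ implies $I\subseteq P$ or $J\subseteq P$ for all two-sided ideals $I,J$); $\mathrm{Spec}_{c}(R)$ is the set of primes that do not contain $c$, and $\mathrm{Spec}_{trs}(A_1)$ is the set of primes of $A_1$ that contain none of $t,r,s$; primes of a factor ring $A_1/I$ are identified with their preimages in $A_1$; $(a)$ and $(a,b)$ are the two-sided ideals generated by the indicated elements; and $\mathrm{Irr}_m(K[z])$ is the set of monic irreducible polynomials in $K[z]$. Then $$\mathrm{Spec}(A_1)=\mathrm{Spec}_{trs}(A_1)\sqcup \mathrm{Spec}_t(A_1/(r))\sqcup \mathrm{Spec}_r(A_1/(t))\sqcup \mathrm{Spec}(A_1/(t,r))\sqcup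 \mathrm{Spec}(A_1/(h)),$$ where $$\begin{aligned} \mathrm{Spec}_{trs}(A_1)&=\{A_1\mathfrak p\mid \mathfrak p\in \mathrm{Spec}(Z(A_1)),\ t,r,s\notin\mathfrak p\}=\{0\}\sqcup\mathcal N''\sqcup\mathbb M'',\\ \mathrm{Spec}_t(A_1/(r))&=\{(r)\}\sqcup\mathbb R,\qquad \mathrm{Spec}_r(A_1/(t))=\{(t)\}\sqcup\mathbb T,\\ \mathrm{Spec}(A_1/(t,r))&=\{(t,r)\},\qquad \mathrm{Spec}(A_1/(h))=\{(h)\}\sqcup\mathbb H'',\\ \mathcal N''&=\{A_1\mathfrak n\mid \mathfrak n\in\mathrm{Spec}(Z(A_1)),\ \mathrm{ht}(\mathfrak n)=1,\ \mathfrak n\ne (t),(r),(s)\},\\ \mathbb M''&=\{A_1\mathfrak m\mid \mathfrak m\in\mathrm{Max}(Z(A_1)),\ t,r,s\notin\mathfrak m\},\\ \mathbb R&=\{(r,f)\mid f\in\mathrm{Irr}_m(K[t])\setminus\{t\}\},\qquad \mathbb T=\{(t,g)\mid g\in\mathrm{Irr}_m(K[r])\setminus\{r\}\},\\ \mathbb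 H''&=\{(h,f)\mid f\in\mathrm{Irr}_m(K[x])\setminus\{x\}\}. \end{aligned}$$ The containments between these primes are given by the following diagram. * Solid lines, along which every prime at the lower end is strictly contained in every prime at the upper end: from $\{0\}$ to $(t)$, $(r)$, $(h)$ and $\mathcal N''$; from $(t)$ to $\mathbb T$ and $(t,r)$; from $(r)$ to $\mathbb R$ and $(t,r)$; from $(h)$ to $\mathbb H''$. * Dotted lines (possible containments): from $\mathcal N''$ to each of $\mathbb T$, $\{(t,r)\}$, $\mathbb R$, $\mathbb M''$, $\mathbb H''$. On each of these five lines there is at least one pair of primes $P\in\mathcal N''$ and $Q$ in the upper set with $P\subsetneq Q$. * There are no other containments: for $P,Q\in\mathrm{Spec}(A_1)$ one has $P\subsetneq Q$ if and only if $Q$ is reached from $P$ by a finite nonempty ascending chain each step of which goes along a solid line, or along a dotted line between two primes of which the lower one is contained in the upper one. -/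

import Mathlib

open Polynomial

noncomputable section

/-! ## Prime ideals of noncommutative rings -/

/-- A two-sided ideal `P` of a ring is prime if it is proper and, for all two-sided ideals `I`, `J`,
`I J ⊆ P` implies `I ⊆ P` or `J ⊆ P`. -/
def TwoSidedIdeal.IsPrimeIdeal {R : Type*} [Ring R] (P : TwoSidedIdeal R) : Prop :=
  P ≠ ⊤ ∧ ∀ I J : TwoSidedIdeal R, (∀ a ∈ I, ∀ b ∈ J, a * b ∈ P) → I ≤ P ∨ J ≤ P

/-- The prime spectrum of a ring, as a set of two-sided ideals. -/
def primeSpec (R : Type*) [Ring R] : Set (TwoSidedIdeal R) :=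
  {P | P.IsPrimeIdeal}

/-- The primes of `R` that contain no element of `C`. -/
def primeSpecAvoid {R : Type*} [Ring R] (C : Set R) : Set (TwoSidedIdeal R) :=
  {P | P ∈ primeSpec R ∧ ∀ c ∈ C, c ∉ P}

/-- The prime ideals of the factor ring `R / I` that contain the image of no element of `C`,
each identified as usual with its preimage in `R`. -/
def primeSpecQuot {R : Type*} [Ring R] (I : TwoSidedIdeal R) (C : Set R) :
    Set (TwoSidedIdeal R) :=
  {P | ∃ Q ∈ primeSpec I.ringCon.Quotient,
    (∀ c ∈ C, I.ringCon.mk' c ∉ Q) ∧ P = Q.comap I.ringCon.mk'}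

/-- `S` is the disjoint union of the sets `X 0, …, X (m - 1)`. -/
def IsDisjUnion {α : Type*} {m : ℕ} (S : Set α) (X : Fin m → Set α) : Prop :=
  S = ⋃ i, X i ∧ ∀ i j, i ≠ j → Disjoint (X i) (X j)

/-! ## The quantum Weyl algebra -/

/-- The defining relation `x y = q y x + 1`, where `x`, `y` are the free generators `0`, `1`. -/
inductive QuantumWeyl.Rel (K : Type*) [Field K] (q : K) :
    FreeAlgebra K (Fin 2) → FreeAlgebra K (Fin 2) → Prop
  | xy : QuantumWeyl.Rel K q (FreeAlgebra.ι K 0 * FreeAlgebra.ι K 1)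
      (q • (FreeAlgebra.ι K 1 * FreeAlgebra.ι K 0) + 1)

/-- The quantum Weyl algebra `A₁(q) = K⟨x, y | x y - q y x = 1⟩`. -/
def QuantumWeyl (K : Type*) [Field K] (q : K) : Type _ :=
  RingQuot (QuantumWeyl.Rel K q)

namespace QuantumWeyl

instance (K : Type*) [Field K] (q : K) : Ring (QuantumWeyl K q) :=
  inferInstanceAs (Ring (RingQuot (QuantumWeyl.Rel K q)))

instance (K : Type*) [Field K] (q : K) : Algebra K (QuantumWeyl K q) :=
  inferInstanceAs (Algebra K (RingQuot (QuantumWeyl.Rel K q)))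

/-- The canonical projection from the free algebra. -/
def proj (K : Type*) [Field K] (q : K) : FreeAlgebra K (Fin 2) →ₐ[K] QuantumWeyl K q :=
  RingQuot.mkAlgHom K (QuantumWeyl.Rel K q)

section Elements

variable {K : Type*} [Field K] (q : K)

/-- The generator `x`. -/
def x : QuantumWeyl K q := proj K q (FreeAlgebra.ι K 0)

/-- The generator `y`. -/
def y : QuantumWeyl K q := proj K q (FreeAlgebra.ι K 1)

/-- The element `h = y x + 1 / (q - 1)`. -/
def h : QuantumWeyl K q := y q * x q + algebraMap K (QuantumWeyl K q) (1 / (q - 1))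

/-- The element `r = y ^ n`. -/
def r (n : ℕ) : QuantumWeyl K q := y q ^ n

/-- The element `t = x ^ n`. -/
def t (n : ℕ) : QuantumWeyl K q := x q ^ n

/-- The element `s = h ^ n`. -/
def s (n : ℕ) : QuantumWeyl K q := h q ^ n

theorem x_mul_y : x q * y q = q • (y q * x q) + 1 := by
  have hxy : proj K q (FreeAlgebra.ι K 0 * FreeAlgebra.ι K 1) =
      proj K q (q • (FreeAlgebra.ι K 1 * FreeAlgebra.ι K 0) + 1) :=
    RingQuot.mkAlgHom_rel K (Rel.xy (K := K) (q := q))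
  simpa [x, y] using hxy

theorem proj_surjective : Function.Surjective (proj K q) :=
  RingQuot.mkAlgHom_surjective K (QuantumWeyl.Rel K q)

/-- An element that commutes with `x` and `y` is central. -/
theorem mem_center_of_commute {a : QuantumWeyl K q} (hx : x q * a = a * x q)
    (hy : y q * a = a * y q) : a ∈ Subalgebra.center K (QuantumWeyl K q) := by
  rw [Subalgebra.mem_center_iff]
  intro b
  obtain ⟨b, rfl⟩ := proj_surjective q b
  induction b using FreeAlgebra.induction with
  | grade0 c => rw [AlgHom.commutes]; exact Algebra.commutes c a
  | grade1 i => fin_cases i; exacts [hx, hy]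
  | mul u v hu hv => rw [map_mul, mul_assoc, hv, ← mul_assoc, hu, mul_assoc]
  | add u v hu hv => rw [map_add, add_mul, mul_add, hu, hv]

theorem x_pow_mul_y (k : ℕ) : x q ^ (k + 1) * y q =
    q ^ (k + 1) • (y q * x q ^ (k + 1)) + (∑ i ∈ Finset.range (k + 1), q ^ i) • x q ^ k := by
  induction k with
  | zero => simp [x_mul_y]
  | succ k ih =>
    rw [pow_succ' (x q) (k + 1), mul_assoc, ih, mul_add, mul_smul_comm, ← mul_assoc, x_mul_y,
      Finset.sum_range_succ _ (k + 1), mul_smul_comm, ← pow_succ', add_mul, smul_add, one_mul,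
      smul_mul_assoc, smul_smul, ← pow_succ, add_smul, mul_assoc, ← pow_succ']
    abel

theorem x_mul_y_pow (k : ℕ) : x q * y q ^ (k + 1) =
    q ^ (k + 1) • (y q ^ (k + 1) * x q) + (∑ i ∈ Finset.range (k + 1), q ^ i) • y q ^ k := by
  induction k with
  | zero => simp [x_mul_y]
  | succ k ih =>
    rw [pow_succ (y q) (k + 1), ← mul_assoc, ih, add_mul, smul_mul_assoc, mul_assoc, x_mul_y,
      Finset.sum_range_succ _ (k + 1), smul_mul_assoc, ← pow_succ, mul_add, smul_add, mul_one,
      mul_smul_comm, smul_smul, ← pow_succ, add_smul, ← mul_assoc]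
    abel

variable {q} {n : ℕ}

theorem sum_pow_eq_zero (hn : 2 ≤ n) (hq : IsPrimitiveRoot q n) :
    ∑ i ∈ Finset.range n, q ^ i = 0 := hq.geom_sum_eq_zero (by omega)

theorem x_mul_h (hn : 2 ≤ n) (hq : IsPrimitiveRoot q n) : x q * h q = q • (h q * x q) := by
  have h1 : q - 1 ≠ 0 := sub_ne_zero.2 (hq.ne_one (by omega))
  have h2 : (1 / (q - 1) : K) + 1 = q * (1 / (q - 1)) := by field_simp; ring
  rw [h, mul_add, ← mul_assoc, x_mul_y, add_mul, add_mul, smul_add, smul_mul_assoc, one_mul,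
    ← Algebra.commutes, ← Algebra.smul_def, smul_smul, ← h2, add_smul, one_smul]
  abel

theorem h_mul_y (hn : 2 ≤ n) (hq : IsPrimitiveRoot q n) : h q * y q = q • (y q * h q) := by
  have h1 : q - 1 ≠ 0 := sub_ne_zero.2 (hq.ne_one (by omega))
  have h2 : (1 / (q - 1) : K) + 1 = q * (1 / (q - 1)) := by field_simp; ring
  rw [h, add_mul, mul_assoc, x_mul_y, mul_add, mul_add, smul_add, mul_smul_comm, mul_one,
    ← Algebra.commutes, ← Algebra.smul_def, smul_smul, ← h2, add_smul, one_smul]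
  abel

theorem t_mem_center (hn : 2 ≤ n) (hq : IsPrimitiveRoot q n) :
    t q n ∈ Subalgebra.center K (QuantumWeyl K q) := by
  obtain ⟨k, rfl⟩ : ∃ k, n = k + 1 := ⟨n - 1, by omega⟩
  refine mem_center_of_commute q (by rw [t, ← pow_succ, ← pow_succ']) ?_
  rw [t, x_pow_mul_y, sum_pow_eq_zero hn hq, hq.pow_eq_one, one_smul, zero_smul, add_zero]

theorem r_mem_center (hn : 2 ≤ n) (hq : IsPrimitiveRoot q n) :
    r q n ∈ Subalgebra.center K (QuantumWeyl K q) := by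
  obtain ⟨k, rfl⟩ : ∃ k, n = k + 1 := ⟨n - 1, by omega⟩
  refine mem_center_of_commute q ?_ (by rw [r, ← pow_succ, ← pow_succ'])
  rw [r, x_mul_y_pow, sum_pow_eq_zero hn hq, hq.pow_eq_one, one_smul, zero_smul, add_zero]

theorem s_mem_center (hn : 2 ≤ n) (hq : IsPrimitiveRoot q n) :
    s q n ∈ Subalgebra.center K (QuantumWeyl K q) := by
  have hx : ∀ k : ℕ, x q * h q ^ k = q ^ k • (h q ^ k * x q) := by
    intro k
    induction k with
    | zero => simp
    | succ k ih =>
      rw [pow_succ, ← mul_assoc, ih, smul_mul_assoc, mul_assoc, x_mul_h hn hq, mul_smul_comm,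
        smul_smul, ← pow_succ, mul_assoc]
  have hy : ∀ k : ℕ, h q ^ k * y q = q ^ k • (y q * h q ^ k) := by
    intro k
    induction k with
    | zero => simp
    | succ k ih =>
      rw [pow_succ', mul_assoc, ih, mul_smul_comm, ← mul_assoc, h_mul_y hn hq, smul_mul_assoc,
        smul_smul, ← pow_succ, mul_assoc]
  refine mem_center_of_commute q ?_ ?_
  · rw [s, hx, hq.pow_eq_one, one_smul]
  · rw [s, hy, hq.pow_eq_one, one_smul]

/-- `t` as an element of the centre. -/
def tZ (hn : 2 ≤ n) (hq : IsPrimitiveRoot q n) : Subalgebra.center K (QuantumWeyl K q) :=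
  ⟨t q n, t_mem_center hn hq⟩

/-- `r` as an element of the centre. -/
def rZ (hn : 2 ≤ n) (hq : IsPrimitiveRoot q n) : Subalgebra.center K (QuantumWeyl K q) :=
  ⟨r q n, r_mem_center hn hq⟩

/-- `s` as an element of the centre. -/
def sZ (hn : 2 ≤ n) (hq : IsPrimitiveRoot q n) : Subalgebra.center K (QuantumWeyl K q) :=
  ⟨s q n, s_mem_center hn hq⟩

/-- The ideal `A₁ 𝔭` generated by an ideal `𝔭` of the centre. -/
def extend (p : Ideal (Subalgebra.center K (QuantumWeyl K q))) :
    TwoSidedIdeal (QuantumWeyl K q) :=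
  TwoSidedIdeal.span (Subtype.val '' (p : Set (Subalgebra.center K (QuantumWeyl K q))))

/-- The ideal `(a)`. -/
def ideal₁ (a : QuantumWeyl K q) : TwoSidedIdeal (QuantumWeyl K q) := TwoSidedIdeal.span {a}

/-- The ideal `(a, b)`. -/
def ideal₂ (a b : QuantumWeyl K q) : TwoSidedIdeal (QuantumWeyl K q) :=
  TwoSidedIdeal.span {a, b}

variable (K) in
/-- The monic irreducible polynomials over `K` in one variable other than the variable itself. -/
def irrM : Set K[X] := {f | f.Monic ∧ Irreducible f ∧ f ≠ X}

/-- `{A₁ 𝔭 | 𝔭 ∈ Spec Z(A₁), t, r, s ∉ 𝔭}`. -/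
def primesTRS (hn : 2 ≤ n) (hq : IsPrimitiveRoot q n) : Set (TwoSidedIdeal (QuantumWeyl K q)) :=
  {P | ∃ p : Ideal (Subalgebra.center K (QuantumWeyl K q)), p.IsPrime ∧
    tZ hn hq ∉ p ∧ rZ hn hq ∉ p ∧ sZ hn hq ∉ p ∧ P = extend p}

/-- `𝒩'' = {A₁ 𝔫 | 𝔫 ∈ Spec Z(A₁), ht 𝔫 = 1, 𝔫 ≠ (t), (r), (s)}`. -/
def setN (hn : 2 ≤ n) (hq : IsPrimitiveRoot q n) : Set (TwoSidedIdeal (QuantumWeyl K q)) :=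
  {P | ∃ p : Ideal (Subalgebra.center K (QuantumWeyl K q)), p.IsPrime ∧ p.height = 1 ∧
    p ≠ Ideal.span {tZ hn hq} ∧ p ≠ Ideal.span {rZ hn hq} ∧ p ≠ Ideal.span {sZ hn hq} ∧
    P = extend p}

/-- `𝕄'' = {A₁ 𝔪 | 𝔪 ∈ Max Z(A₁), t, r, s ∉ 𝔪}`. -/
def setM (hn : 2 ≤ n) (hq : IsPrimitiveRoot q n) : Set (TwoSidedIdeal (QuantumWeyl K q)) :=
  {P | ∃ p : Ideal (Subalgebra.center K (QuantumWeyl K q)), p.IsMaximal ∧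
    tZ hn hq ∉ p ∧ rZ hn hq ∉ p ∧ sZ hn hq ∉ p ∧ P = extend p}

variable (q n) in
/-- `ℝ = {(r, f) | f ∈ Irr_m(K[t]) \ {t}}`. -/
def setR : Set (TwoSidedIdeal (QuantumWeyl K q)) :=
  {P | ∃ f ∈ irrM K, P = ideal₂ (r q n) (aeval (t q n) f)}

variable (q n) in
/-- `𝕋 = {(t, g) | g ∈ Irr_m(K[r]) \ {r}}`. -/
def setT : Set (TwoSidedIdeal (QuantumWeyl K q)) :=
  {P | ∃ g ∈ irrM K, P = ideal₂ (t q n) (aeval (r q n) g)}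

variable (q) in
/-- `ℍ'' = {(h, f) | f ∈ Irr_m(K[x]) \ {x}}`. -/
def setH : Set (TwoSidedIdeal (QuantumWeyl K q)) :=
  {P | ∃ f ∈ irrM K, P = ideal₂ (h q) (aeval (x q) f)}

/-- The solid lines of the diagram, from the lower to the upper end. -/
inductive SolidLine (hn : 2 ≤ n) (hq : IsPrimitiveRoot q n) :
    TwoSidedIdeal (QuantumWeyl K q) → TwoSidedIdeal (QuantumWeyl K q) → Prop
  | zero_t : SolidLine hn hq ⊥ (ideal₁ (t q n))
  | zero_r : SolidLine hn hq ⊥ (ideal₁ (r q n))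
  | zero_h : SolidLine hn hq ⊥ (ideal₁ (h q))
  | zero_N (P) (hP : P ∈ setN hn hq) : SolidLine hn hq ⊥ P
  | t_T (P) (hP : P ∈ setT q n) : SolidLine hn hq (ideal₁ (t q n)) P
  | t_tr : SolidLine hn hq (ideal₁ (t q n)) (ideal₂ (t q n) (r q n))
  | r_tr : SolidLine hn hq (ideal₁ (r q n)) (ideal₂ (t q n) (r q n))
  | r_R (P) (hP : P ∈ setR q n) : SolidLine hn hq (ideal₁ (r q n)) P
  | h_H (P) (hP : P ∈ setH q) : SolidLine hn hq (ideal₁ (h q)) P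

/-- The five sets that are joined to `𝒩''` by a dotted line, `𝒩''` being the lower end. -/
def dottedTops (hn : 2 ≤ n) (hq : IsPrimitiveRoot q n) :
    Fin 5 → Set (TwoSidedIdeal (QuantumWeyl K q)) :=
  ![setT q n, {ideal₂ (t q n) (r q n)}, setR q n, setM hn hq, setH q]

/-- `P` lies directly below `Q` in the diagram: along a solid line, or along a dotted line
which for this pair is a containment. -/
def Link (hn : 2 ≤ n) (hq : IsPrimitiveRoot q n) (P Q : TwoSidedIdeal (QuantumWeyl K q)) : Prop :=
  SolidLine hn hq P Q ∨ (P ∈ setN hn hq ∧ (∃ i, Q ∈ dottedTops hn hq i) ∧ P ≤ Q)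

end Elements

end QuantumWeyl

end

/-!
Write `A` for the quantum Weyl algebra, `Z` for its centre and `c = 1 / (q - 1)`, so that
`h = y x + c`, `x h = q h x` and `h y = q y h`.

The monomials `y ^ i * x ^ j` form a basis of `A` over `K` (`QuantumWeyl.pbw`, from the left regular
representation). Comparing coefficients in `x z = z x` and `z y = y z` shows that a central `z`
involves only monomials whose exponents are divisible by `n`, so `Z = K[r, t]`, and `A` is free over
`Z` with basis `y ^ i * x ^ j`, `i, j < n` (`QuantumWeyl.centerBasis`). Hence `A p ∩ Z = p` for
every ideal `p` of `Z`, and `A / A p` is torsion-free over `Z / p` for `p` prime.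

Away from `s` the algebra is Azumaya. In elementary terms: if `J` is a two-sided ideal and `a ∈ J`,
then `s ^ 2 * a` lies in the ideal generated by `J ∩ Z` (`QuantumWeyl.s_sq_mul_mem`). Conjugation
by `h` grades `A` by the residues modulo `n`, and Fourier inversion puts the components of `a`,
times `s`, into `J`. The component of degree zero is `Z[h]`; on it `J` is stable under `h ↦ q h`,
and a second Fourier inversion isolates each term `z_i * h ^ i`. To come down from degree `k + 1` to `k`
one multiplies by `x` and by `y ^ (n - 1)`; nothing is lost, because these two elements generate the
unit ideal in the sense of `QuantumWeyl.mem_of_mul_x_mem`. So the primes of `A` without `s` are the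
ideals `A p` with `p` a prime of `Z` without `s`.

As `h` is normal, the remaining primes are those that contain `h`. The factor algebra `A / (h)` is
the algebra of Laurent polynomials in `x`, whose primes are `0` and those given by monic irreducible
polynomials other than `x` (`QuantumWeyl.eq_ideal_of_h_mem`).

For the primes of `Z = K[r, t]` one uses that maximal ideals have height two, that a prime with `r`
is `(r)` or `(r, f(t))`, and that `s = ε r t + d` with `ε, d ≠ 0` generates a prime ideal, so that
no prime contains both `s` and one of `r`, `t`.

Finally, the height of `P ∩ Z` is strictly monotone in the prime `P`
(`QuantumWeyl.height_contract_lt`). It is one for `(t)`, `(r)`, `(h)` and `𝒩''`, and two for the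
primes in the upper row of the diagram, so a strict containment goes up in this grading, and the
diagram is checked row by row.
-/

noncomputable section

namespace QuantumWeyl

variable {K : Type*} [Field K] {q : K}

/-! ### Homomorphisms out of the quantum Weyl algebra and the monomial basis -/

/-- The algebra homomorphism out of the quantum Weyl algebra given by two elements that satisfy
the defining relation. -/
def lift {L : Type*} [Ring L] [Algebra K L] (a b : L) (hab : a * b = q • (b * a) + 1) :
    QuantumWeyl K q →ₐ[K] L :=
  RingQuot.liftAlgHom K ⟨FreeAlgebra.lift K ![a, b], by
    rintro _ _ ⟨⟩
    simpa using hab⟩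

theorem lift_x {L : Type*} [Ring L] [Algebra K L] (a b : L) (hab : a * b = q • (b * a) + 1) :
    lift a b hab (x q) = a := by
  change RingQuot.liftAlgHom K _ (RingQuot.mkAlgHom K _ (FreeAlgebra.ι K 0)) = _
  rw [RingQuot.liftAlgHom_mkAlgHom_apply]
  simp

theorem lift_y {L : Type*} [Ring L] [Algebra K L] (a b : L) (hab : a * b = q • (b * a) + 1) :
    lift a b hab (y q) = b := by
  change RingQuot.liftAlgHom K _ (RingQuot.mkAlgHom K _ (FreeAlgebra.ι K 1)) = _
  rw [RingQuot.liftAlgHom_mkAlgHom_apply]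
  simp

/-- A subspace that is stable under left multiplication by `x` and by `y` is a left ideal. -/
theorem mul_mem_of_generators (S : Submodule K (QuantumWeyl K q))
    (hx : ∀ a ∈ S, x q * a ∈ S) (hy : ∀ a ∈ S, y q * a ∈ S) (b : QuantumWeyl K q)
    {a : QuantumWeyl K q} (ha : a ∈ S) : b * a ∈ S := by
  obtain ⟨b, rfl⟩ := proj_surjective q b
  induction b using FreeAlgebra.induction generalizing a with
  | grade0 c => rw [AlgHom.commutes, ← Algebra.smul_def]; exact S.smul_mem c ha
  | grade1 i => fin_cases i; exacts [hx a ha, hy a ha]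
  | mul u v hu hv => rw [map_mul, mul_assoc]; exact hu (hv ha)
  | add u v hu hv => rw [map_add, add_mul]; exact S.add_mem (hu ha) (hv ha)

variable (q) in
/-- The action of `x` on the vector space with basis `y ^ i * x ^ j`. -/
def xOp : Module.End K (ℕ × ℕ →₀ K) :=
  Finsupp.linearCombination K fun p ↦ q ^ p.1 • Finsupp.single (p.1, p.2 + 1) (1 : K) +
    (∑ i ∈ Finset.range p.1, q ^ i) • Finsupp.single (p.1 - 1, p.2) (1 : K)

variable (K) in
/-- The action of `y` on the vector space with basis `y ^ i * x ^ j`. -/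
def yOp : Module.End K (ℕ × ℕ →₀ K) :=
  Finsupp.linearCombination K fun p ↦ Finsupp.single (p.1 + 1, p.2) (1 : K)

theorem xOp_mul_yOp : xOp q * yOp K = q • (yOp K * xOp q) + 1 := by
  refine Finsupp.lhom_ext' fun p ↦ LinearMap.ext_ring ?_
  obtain ⟨i, j⟩ := p
  rcases i with _ | i
  · simp [xOp, yOp]
  · simp only [xOp, yOp, Module.End.mul_eq_comp, LinearMap.comp_apply, Finsupp.lsingle_apply,
      Finsupp.linearCombination_single, one_smul, map_add, map_smul, LinearMap.add_apply,
      LinearMap.smul_apply, Module.End.one_apply, Nat.add_sub_cancel, smul_add, smul_smul]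
    rw [geom_sum_succ (n := i + 1)]
    module

variable (q) in
/-- The left regular representation in terms of the monomials `y ^ i * x ^ j`. -/
def rep : QuantumWeyl K q →ₐ[K] Module.End K (ℕ × ℕ →₀ K) :=
  lift (xOp q) (yOp K) xOp_mul_yOp

theorem rep_monomial (i j : ℕ) :
    rep q (y q ^ i * x q ^ j) (Finsupp.single (0, 0) 1) = Finsupp.single (i, j) 1 := by
  have h1 : ∀ j : ℕ, (xOp q ^ j) (Finsupp.single (0, 0) 1) = Finsupp.single (0, j) 1 := by
    intro j
    induction j with
    | zero => rfl
    | succ j ih => rw [pow_succ', Module.End.mul_apply, ih]; simp [xOp]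
  have h2 : ∀ i : ℕ, (yOp K ^ i) (Finsupp.single (0, j) 1) = Finsupp.single (i, j) 1 := by
    intro i
    induction i with
    | zero => rfl
    | succ i ih => rw [pow_succ', Module.End.mul_apply, ih]; simp [yOp]
  rw [map_mul, map_pow, map_pow, rep, lift_x, lift_y, Module.End.mul_apply, h1, h2]

theorem x_mul_y_pow' (i : ℕ) : x q * y q ^ i =
    q ^ i • (y q ^ i * x q) + (∑ k ∈ Finset.range i, q ^ k) • y q ^ (i - 1) := by
  rcases i with _ | i
  · simp
  · exact x_mul_y_pow q i

theorem x_pow_mul_y' (j : ℕ) : x q ^ j * y q =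
    q ^ j • (y q * x q ^ j) + (∑ k ∈ Finset.range j, q ^ k) • x q ^ (j - 1) := by
  rcases j with _ | j
  · simp
  · exact x_pow_mul_y q j

theorem linearIndependent_monomial :
    LinearIndependent K fun p : ℕ × ℕ ↦ y q ^ p.1 * x q ^ p.2 := by
  refine LinearIndependent.of_comp
    ((LinearMap.applyₗ (Finsupp.single (0, 0) (1 : K))).comp (rep q).toLinearMap) ?_
  convert (Finsupp.basisSingleOne (R := K) (ι := ℕ × ℕ)).linearIndependent using 1
  funext p
  exact rep_monomial p.1 p.2

theorem span_monomial :
    Submodule.span K (Set.range fun p : ℕ × ℕ ↦ y q ^ p.1 * x q ^ p.2) = ⊤ := by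
  set S := Submodule.span K (Set.range fun p : ℕ × ℕ ↦ y q ^ p.1 * x q ^ p.2)
  have hS : ∀ i j, y q ^ i * x q ^ j ∈ S := fun i j ↦ Submodule.subset_span ⟨(i, j), rfl⟩
  have h1 : (1 : QuantumWeyl K q) ∈ S := by simpa using hS 0 0
  refine eq_top_iff.2 fun a _ ↦ ?_
  rw [← mul_one a]
  refine mul_mem_of_generators S (fun a ha ↦ ?_) (fun a ha ↦ ?_) a h1
  · have : S ≤ S.comap (LinearMap.mulLeft K (x q)) := by
      refine Submodule.span_le.2 ?_
      rintro _ ⟨⟨i, j⟩, rfl⟩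
      simp only [Submodule.comap_coe, Set.mem_preimage, LinearMap.mulLeft_apply, SetLike.mem_coe]
      rw [← mul_assoc, x_mul_y_pow', add_mul, smul_mul_assoc, smul_mul_assoc, mul_assoc,
        ← pow_succ']
      exact S.add_mem (S.smul_mem _ (hS _ _)) (S.smul_mem _ (hS _ _))
    exact this ha
  · have : S ≤ S.comap (LinearMap.mulLeft K (y q)) := by
      refine Submodule.span_le.2 ?_
      rintro _ ⟨⟨i, j⟩, rfl⟩
      simp only [Submodule.comap_coe, Set.mem_preimage, LinearMap.mulLeft_apply, SetLike.mem_coe]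
      rw [← mul_assoc, ← pow_succ']
      exact hS _ _
    exact this ha

variable (q) in
/-- The basis of monomials `y ^ i * x ^ j` over the ground field. -/
def pbw : Module.Basis (ℕ × ℕ) K (QuantumWeyl K q) :=
  Module.Basis.mk linearIndependent_monomial span_monomial.ge

theorem pbw_apply (p : ℕ × ℕ) : pbw q p = y q ^ p.1 * x q ^ p.2 := by
  simp [pbw]

instance : Nontrivial (QuantumWeyl K q) := (pbw q).repr.toEquiv.nontrivial

/-! ### The centre -/

theorem pbw_repr_x_mul (a : QuantumWeyl K q) (i j : ℕ) :
    (pbw q).repr (x q * a) (i, j + 1) = q ^ i * (pbw q).repr a (i, j) +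
      (∑ k ∈ Finset.range (i + 1), q ^ k) * (pbw q).repr a (i + 1, j + 1) := by
  let f : QuantumWeyl K q →ₗ[K] K := (pbw q).coord (i, j + 1) ∘ₗ LinearMap.mulLeft K (x q)
  let g : QuantumWeyl K q →ₗ[K] K := q ^ i • (pbw q).coord (i, j) +
    (∑ k ∈ Finset.range (i + 1), q ^ k) • (pbw q).coord (i + 1, j + 1)
  suffices hfg : f = g from congrArg (fun l ↦ l a) hfg
  refine (pbw q).ext fun ⟨u, v⟩ ↦ ?_
  have h1 : x q * pbw q (u, v) = q ^ u • pbw q (u, v + 1) +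
      (∑ k ∈ Finset.range u, q ^ k) • pbw q (u - 1, v) := by
    simp only [pbw_apply]
    rw [← mul_assoc, x_mul_y_pow', add_mul, smul_mul_assoc, smul_mul_assoc, mul_assoc, ← pow_succ']
  simp only [f, g, LinearMap.comp_apply, LinearMap.mulLeft_apply, h1, map_add, map_smul,
    Module.Basis.coord_apply, Module.Basis.repr_self, LinearMap.add_apply, LinearMap.smul_apply,
    Finsupp.single_apply, Prod.mk.injEq, smul_eq_mul]
  rcases u with _ | u <;> rcases i with _ | i <;> split_ifs <;> first | omega | simp_all

theorem pbw_repr_mul_x (a : QuantumWeyl K q) (i j : ℕ) :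
    (pbw q).repr (a * x q) (i, j + 1) = (pbw q).repr a (i, j) := by
  let f : QuantumWeyl K q →ₗ[K] K := (pbw q).coord (i, j + 1) ∘ₗ LinearMap.mulRight K (x q)
  suffices hfg : f = (pbw q).coord (i, j) from congrArg (fun l ↦ l a) hfg
  refine (pbw q).ext fun ⟨u, v⟩ ↦ ?_
  have h1 : pbw q (u, v) * x q = pbw q (u, v + 1) := by
    simp only [pbw_apply]
    rw [mul_assoc, ← pow_succ]
  simp only [f, LinearMap.comp_apply, LinearMap.mulRight_apply, h1,
    Module.Basis.coord_apply, Module.Basis.repr_self, Finsupp.single_apply, Prod.mk.injEq,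
    add_left_inj]

theorem pbw_repr_mul_y (a : QuantumWeyl K q) (i j : ℕ) :
    (pbw q).repr (a * y q) (i + 1, j) = q ^ j * (pbw q).repr a (i, j) +
      (∑ k ∈ Finset.range (j + 1), q ^ k) * (pbw q).repr a (i + 1, j + 1) := by
  let f : QuantumWeyl K q →ₗ[K] K := (pbw q).coord (i + 1, j) ∘ₗ LinearMap.mulRight K (y q)
  let g : QuantumWeyl K q →ₗ[K] K := q ^ j • (pbw q).coord (i, j) +
    (∑ k ∈ Finset.range (j + 1), q ^ k) • (pbw q).coord (i + 1, j + 1)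
  suffices hfg : f = g from congrArg (fun l ↦ l a) hfg
  refine (pbw q).ext fun ⟨u, v⟩ ↦ ?_
  have h1 : pbw q (u, v) * y q = q ^ v • pbw q (u + 1, v) +
      (∑ k ∈ Finset.range v, q ^ k) • pbw q (u, v - 1) := by
    simp only [pbw_apply]
    rw [mul_assoc, x_pow_mul_y', mul_add, mul_smul_comm, mul_smul_comm, ← mul_assoc, ← pow_succ]
  simp only [f, g, LinearMap.comp_apply, LinearMap.mulRight_apply, h1, map_add, map_smul,
    Module.Basis.coord_apply, Module.Basis.repr_self, LinearMap.add_apply, LinearMap.smul_apply,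
    Finsupp.single_apply, Prod.mk.injEq, smul_eq_mul]
  rcases v with _ | v <;> rcases j with _ | j <;> split_ifs <;> first | omega | simp_all

theorem pbw_repr_y_mul (a : QuantumWeyl K q) (i j : ℕ) :
    (pbw q).repr (y q * a) (i + 1, j) = (pbw q).repr a (i, j) := by
  let f : QuantumWeyl K q →ₗ[K] K := (pbw q).coord (i + 1, j) ∘ₗ LinearMap.mulLeft K (y q)
  suffices hfg : f = (pbw q).coord (i, j) from congrArg (fun l ↦ l a) hfg
  refine (pbw q).ext fun ⟨u, v⟩ ↦ ?_
  have h1 : y q * pbw q (u, v) = pbw q (u + 1, v) := by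
    simp only [pbw_apply]
    rw [← mul_assoc, ← pow_succ']
  simp only [f, LinearMap.comp_apply, LinearMap.mulLeft_apply, h1,
    Module.Basis.coord_apply, Module.Basis.repr_self, Finsupp.single_apply, Prod.mk.injEq,
    add_left_inj]

variable {n : ℕ}

theorem sum_pow_eq_zero_iff (hn : 2 ≤ n) (hq : IsPrimitiveRoot q n) (m : ℕ) :
    ∑ k ∈ Finset.range m, q ^ k = 0 ↔ n ∣ m := by
  have h1 : q - 1 ≠ 0 := sub_ne_zero.2 (hq.ne_one (by omega))
  rw [← hq.pow_eq_one_iff_dvd, ← sub_eq_zero (a := q ^ m), ← geom_sum_mul, mul_eq_zero,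
    or_iff_left h1]

/-- A two-parameter family that satisfies the recursion for the coefficients of a central element
is supported where the first index is divisible by `n`. -/
theorem eq_zero_of_recursion (hn : 2 ≤ n) (hq : IsPrimitiveRoot q n) {c : ℕ → ℕ → K}
    (hc : ∀ i j, (q ^ i - 1) * c i j + (∑ k ∈ Finset.range (i + 1), q ^ k) * c (i + 1) (j + 1) = 0)
    {i : ℕ} (hi : ¬ n ∣ i) (j : ℕ) : c i j = 0 := by
  -- descend from the next multiple `i + d` of `n`
  obtain ⟨d, hd⟩ : ∃ d, n ∣ i + d :=
    ⟨n * i - i, by rw [Nat.add_sub_cancel' (Nat.le_mul_of_pos_left i (by omega))]; simp⟩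
  induction d generalizing i j with
  | zero => exact absurd hd hi
  | succ d ih =>
    have h1 : q ^ i - 1 ≠ 0 := sub_ne_zero.2 fun h ↦ hi ((hq.pow_eq_one_iff_dvd i).1 h)
    have h2 : (∑ k ∈ Finset.range (i + 1), q ^ k) * c (i + 1) (j + 1) = 0 := by
      by_cases h : n ∣ i + 1
      · rw [(sum_pow_eq_zero_iff hn hq _).2 h, zero_mul]
      · rw [ih h _ (by rwa [add_assoc, add_comm 1 d]), mul_zero]
    have := hc i j
    rw [h2, add_zero] at this
    exact (mul_eq_zero.1 this).resolve_left h1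

theorem dvd_of_pbw_repr_ne_zero (hn : 2 ≤ n) (hq : IsPrimitiveRoot q n) {a : QuantumWeyl K q}
    (ha : a ∈ Subalgebra.center K (QuantumWeyl K q)) {p : ℕ × ℕ}
    (hp : (pbw q).repr a p ≠ 0) : n ∣ p.1 ∧ n ∣ p.2 := by
  rw [Subalgebra.mem_center_iff] at ha
  obtain ⟨i, j⟩ := p
  constructor
  · by_contra hi
    refine hp (eq_zero_of_recursion hn hq (c := fun i j ↦ (pbw q).repr a (i, j)) ?_ hi j)
    intro i j
    have h1 := pbw_repr_x_mul a i j
    rw [ha, pbw_repr_mul_x] at h1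
    linear_combination -h1
  · by_contra hj
    refine hp (eq_zero_of_recursion hn hq (c := fun j i ↦ (pbw q).repr a (i, j)) ?_ hj i)
    intro j i
    have h1 := pbw_repr_mul_y a i j
    rw [← ha, pbw_repr_y_mul] at h1
    linear_combination -h1

theorem r_pow_mul_t_pow (k l : ℕ) : r q n ^ k * t q n ^ l = pbw q (n * k, n * l) := by
  rw [pbw_apply, r, t, ← pow_mul, ← pow_mul]

theorem adjoin_rZ_tZ (hn : 2 ≤ n) (hq : IsPrimitiveRoot q n) :
    Algebra.adjoin K {rZ hn hq, tZ hn hq} = ⊤ := by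
  refine eq_top_iff.2 fun z _ ↦ ?_
  set S := Algebra.adjoin K {rZ hn hq, tZ hn hq}
  have hr : rZ hn hq ∈ S := Algebra.subset_adjoin (by simp)
  have ht : tZ hn hq ∈ S := Algebra.subset_adjoin (by simp)
  suffices (z : QuantumWeyl K q) ∈ S.map (Subalgebra.center K (QuantumWeyl K q)).val by
    obtain ⟨w, hw, hwz⟩ := this
    rwa [← Subtype.ext hwz]
  rw [← (pbw q).linearCombination_repr (z : QuantumWeyl K q), Finsupp.linearCombination_apply]
  refine Subalgebra.sum_mem _ fun p hp ↦ Subalgebra.smul_mem _ ?_ _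
  obtain ⟨⟨k, hk⟩, ⟨l, hl⟩⟩ := dvd_of_pbw_repr_ne_zero hn hq z.2 (Finsupp.mem_support_iff.1 hp)
  refine ⟨rZ hn hq ^ k * tZ hn hq ^ l, mul_mem (pow_mem hr k) (pow_mem ht l), ?_⟩
  obtain ⟨i, j⟩ := p
  obtain rfl : i = n * k := hk
  obtain rfl : j = n * l := hl
  exact r_pow_mul_t_pow k l

theorem algebraicIndependent_rZ_tZ (hn : 2 ≤ n) (hq : IsPrimitiveRoot q n) :
    AlgebraicIndependent K ![rZ hn hq, tZ hn hq] := by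
  let f : MvPolynomial (Fin 2) K →ₗ[K] QuantumWeyl K q :=
    (Subalgebra.center K (QuantumWeyl K q)).val.toLinearMap ∘ₗ
      (MvPolynomial.aeval ![rZ hn hq, tZ hn hq]).toLinearMap
  have hf : Function.Injective f := by
    have h1 : (f ∘ MvPolynomial.basisMonomials (Fin 2) K) =
        pbw q ∘ fun m : Fin 2 →₀ ℕ ↦ (n * m 0, n * m 1) := by
      funext m
      rw [Function.comp_apply, Function.comp_apply, ← r_pow_mul_t_pow]
      simp [f, MvPolynomial.aeval_monomial, Finsupp.prod_fintype, rZ, tZ]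
    have h2 : LinearIndependent K (f ∘ MvPolynomial.basisMonomials (Fin 2) K) := by
      rw [h1]
      refine (pbw q).linearIndependent.comp _ fun m m' hm ↦ ?_
      have hn0 : n ≠ 0 := by omega
      ext i
      fin_cases i <;> simp_all
    have h3 : f = Finsupp.linearCombination K (f ∘ MvPolynomial.basisMonomials (Fin 2) K) ∘ₗ
        (MvPolynomial.basisMonomials (Fin 2) K).repr.toLinearMap :=
      (MvPolynomial.basisMonomials (Fin 2) K).ext fun m ↦ by
        simp only [LinearMap.comp_apply, LinearEquiv.coe_coe, Module.Basis.repr_self,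
          Finsupp.linearCombination_single, one_smul, Function.comp_apply]
    rw [h3, LinearMap.coe_comp]
    exact Function.Injective.comp h2 (MvPolynomial.basisMonomials (Fin 2) K).repr.injective
  rw [algebraicIndependent_iff_injective_aeval]
  exact Function.Injective.of_comp (f := Subtype.val) hf
/-! ### The algebra as a free module over its centre -/

theorem commute_of_mem_center {z : QuantumWeyl K q} (hz : z ∈ Subalgebra.center K (QuantumWeyl K q))
    (a : QuantumWeyl K q) : a * z = z * a :=
  Subalgebra.mem_center_iff.1 hz a

theorem mul_center_smul (z : Subalgebra.center K (QuantumWeyl K q)) (a b : QuantumWeyl K q) :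
    a * z • b = z • (a * b) := by
  rw [Subalgebra.smul_def, Subalgebra.smul_def, smul_eq_mul, smul_eq_mul, ← mul_assoc,
    commute_of_mem_center z.2, mul_assoc]

/-- The coordinates with respect to the monomials `y ^ i * x ^ j` with `i, j < n`, as a linear map
over the ground field. -/
def centerCoord (hn : 2 ≤ n) (hq : IsPrimitiveRoot q n) : QuantumWeyl K q →ₗ[K]
    (Fin n × Fin n → Subalgebra.center K (QuantumWeyl K q)) :=
  (pbw q).constr K fun p ↦ Pi.single
    (⟨p.1 % n, Nat.mod_lt _ (by omega)⟩, ⟨p.2 % n, Nat.mod_lt _ (by omega)⟩)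
    (rZ hn hq ^ (p.1 / n) * tZ hn hq ^ (p.2 / n))

theorem centerCoord_pbw (hn : 2 ≤ n) (hq : IsPrimitiveRoot q n) (i j : ℕ) :
    centerCoord hn hq (pbw q (i, j)) = Pi.single
      (⟨i % n, Nat.mod_lt _ (by omega)⟩, ⟨j % n, Nat.mod_lt _ (by omega)⟩)
      (rZ hn hq ^ (i / n) * tZ hn hq ^ (j / n)) := by
  rw [centerCoord, Module.Basis.constr_basis]

/-- Multiplication by `r` or `t` shifts one exponent by `n`, so the coordinates are linear over the
centre, which `r` and `t` generate. -/
theorem centerCoord_smul (hn : 2 ≤ n) (hq : IsPrimitiveRoot q n)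
    (z : Subalgebra.center K (QuantumWeyl K q)) (a : QuantumWeyl K q) :
    centerCoord hn hq (z • a) = z • centerCoord hn hq a := by
  have hz : z ∈ Algebra.adjoin K {rZ hn hq, tZ hn hq} := by rw [adjoin_rZ_tZ]; trivial
  have hn0 : 0 < n := by omega
  induction hz using Algebra.adjoin_induction generalizing a with
  | mem z hz =>
    rcases hz with rfl | rfl
    · let f := centerCoord hn hq ∘ₗ LinearMap.mulLeft K (r q n)
      let g := LinearMap.mulLeft K (algebraMap _ (Fin n × Fin n → _) (rZ hn hq)) ∘ₗ
        centerCoord hn hq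
      have hfg : f = g := by
        refine (pbw q).ext fun ⟨i, j⟩ ↦ ?_
        have h1 : r q n * pbw q (i, j) = pbw q (i + n, j) := by
          rw [pbw_apply, pbw_apply, r, ← mul_assoc, ← pow_add, add_comm]
        simp only [f, g, LinearMap.comp_apply, LinearMap.mulLeft_apply, h1, centerCoord_pbw,
          ← Algebra.smul_def, ← Pi.single_smul', Nat.add_mod_right, Nat.add_div_right _ hn0,
          smul_eq_mul, pow_succ', mul_assoc]
      have := congrArg (fun l ↦ l a) hfg
      simpa [f, g, ← Algebra.smul_def] using! this
    · let f := centerCoord hn hq ∘ₗ LinearMap.mulLeft K (t q n)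
      let g := LinearMap.mulLeft K (algebraMap _ (Fin n × Fin n → _) (tZ hn hq)) ∘ₗ
        centerCoord hn hq
      have hfg : f = g := by
        refine (pbw q).ext fun ⟨i, j⟩ ↦ ?_
        have h1 : t q n * pbw q (i, j) = pbw q (i, j + n) := by
          rw [pbw_apply, pbw_apply, ← mul_assoc, ← commute_of_mem_center (t_mem_center hn hq), t,
            mul_assoc, ← pow_add, add_comm]
        simp only [f, g, LinearMap.comp_apply, LinearMap.mulLeft_apply, h1, centerCoord_pbw,
          ← Algebra.smul_def, ← Pi.single_smul', Nat.add_mod_right, Nat.add_div_right _ hn0,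
          smul_eq_mul, pow_succ', mul_left_comm]
      have := congrArg (fun l ↦ l a) hfg
      simpa [f, g, ← Algebra.smul_def] using! this
  | algebraMap c => simp [algebraMap_smul]
  | add u v _ _ hu hv => rw [add_smul, map_add, hu, hv, add_smul]
  | mul u v _ _ hu hv => rw [mul_smul, hu, hv, mul_smul]

/-- The monomials `y ^ i * x ^ j` with `i, j < n` form a basis over the centre. -/
def centerBasis (hn : 2 ≤ n) (hq : IsPrimitiveRoot q n) :
    Module.Basis (Fin n × Fin n) (Subalgebra.center K (QuantumWeyl K q)) (QuantumWeyl K q) :=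
  Module.Basis.ofEquivFun <| LinearEquiv.ofLinearMap
    { toFun := centerCoord hn hq
      map_add' := map_add _
      map_smul' := centerCoord_smul hn hq }
    (Fintype.linearCombination _ fun p : Fin n × Fin n ↦ pbw q (p.1.1, p.2.1))
    (by
      refine LinearMap.pi_ext' fun p ↦ LinearMap.ext_ring ?_
      simp only [LinearMap.comp_apply, LinearMap.single_apply,
        Fintype.linearCombination_apply_single, one_smul, LinearMap.id_apply,
        LinearMap.coe_mk, AddHom.coe_mk, centerCoord_pbw,
        Nat.mod_eq_of_lt (Fin.is_lt _), Nat.div_eq_of_lt (Fin.is_lt _), pow_zero, mul_one])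
    (by
      refine LinearMap.restrictScalars_injective K ((pbw q).ext fun ⟨i, j⟩ ↦ ?_)
      simp only [LinearMap.restrictScalars_apply, LinearMap.comp_apply, LinearMap.coe_mk,
        AddHom.coe_mk, centerCoord_pbw, Fintype.linearCombination_apply_single, LinearMap.id_apply,
        Subalgebra.smul_def]
      change r q n ^ (i / n) * t q n ^ (j / n) * _ = _
      rw [pbw_apply, pbw_apply, mul_assoc, ← mul_assoc (t q n ^ (j / n)),
        ← commute_of_mem_center (pow_mem (t_mem_center hn hq) _), r, t, mul_assoc, ← pow_mul,
        ← pow_mul, ← pow_add, ← mul_assoc, ← pow_add, Nat.div_add_mod, Nat.div_add_mod])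

theorem centerBasis_zero (hn : 2 ≤ n) (hq : IsPrimitiveRoot q n) :
    centerBasis hn hq (⟨0, by omega⟩, ⟨0, by omega⟩) = 1 := by
  simp [centerBasis, pbw_apply]

/-- The ideal generated by an ideal `p` of the centre consists of the elements all of whose
coordinates over the centre lie in `p`. -/
theorem mem_extend (hn : 2 ≤ n) (hq : IsPrimitiveRoot q n)
    {p : Ideal (Subalgebra.center K (QuantumWeyl K q))} {a : QuantumWeyl K q} :
    a ∈ extend p ↔ ∀ i, (centerBasis hn hq).repr a i ∈ p := by
  set b := centerBasis hn hq
  constructor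
  · intro ha
    have hmul : ∀ c d : QuantumWeyl K q, (∀ i, b.repr c i ∈ p) → ∀ i, b.repr (d * c) i ∈ p := by
      intro c d hc i
      rw [← b.sum_repr c, Finset.mul_sum, map_sum, Finsupp.finsetSum_apply]
      refine Ideal.sum_mem _ fun k _ ↦ ?_
      rw [mul_center_smul, map_smul]
      exact Ideal.mul_mem_right _ _ (hc k)
    have hmul' : ∀ c d : QuantumWeyl K q, (∀ i, b.repr c i ∈ p) → ∀ i, b.repr (c * d) i ∈ p := by
      intro c d hc i
      rw [← b.sum_repr c, Finset.sum_mul, map_sum, Finsupp.finsetSum_apply]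
      refine Ideal.sum_mem _ fun k _ ↦ ?_
      rw [smul_mul_assoc, map_smul]
      exact Ideal.mul_mem_right _ _ (hc k)
    let J : TwoSidedIdeal (QuantumWeyl K q) := TwoSidedIdeal.mk' {c | ∀ i, b.repr c i ∈ p}
      (by simp) (fun hc hd i ↦ by rw [map_add]; exact p.add_mem (hc i) (hd i))
      (fun hc i ↦ by rw [map_neg]; exact p.neg_mem (hc i))
      (fun {c d} hd ↦ hmul d c hd) (fun {c d} hc ↦ hmul' c d hc)
    have hJ : extend p ≤ J := by
      refine TwoSidedIdeal.span_le.2 ?_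
      rintro _ ⟨z, hz, rfl⟩
      change _ ∈ J
      rw [TwoSidedIdeal.mem_mk']
      intro i
      have h1 : (z : QuantumWeyl K q) = z • b (⟨0, by omega⟩, ⟨0, by omega⟩) := by
        rw [centerBasis_zero, Subalgebra.smul_def, smul_eq_mul, mul_one]
      rw [h1, map_smul]
      exact Ideal.mul_mem_right _ _ hz
    simpa only [J, TwoSidedIdeal.mem_mk'] using! hJ ha
  · intro ha
    rw [← b.sum_repr a]
    refine TwoSidedIdeal.finsetSum_mem _ _ _ fun k _ ↦ ?_
    rw [Subalgebra.smul_def, smul_eq_mul]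
    exact TwoSidedIdeal.mul_mem_right _ _ _ (TwoSidedIdeal.subset_span ⟨_, ha k, rfl⟩)

theorem coe_mem_extend (hn : 2 ≤ n) (hq : IsPrimitiveRoot q n)
    {p : Ideal (Subalgebra.center K (QuantumWeyl K q))}
    {z : Subalgebra.center K (QuantumWeyl K q)} : (z : QuantumWeyl K q) ∈ extend p ↔ z ∈ p := by
  refine ⟨fun h ↦ ?_, fun h ↦ TwoSidedIdeal.subset_span ⟨z, h, rfl⟩⟩
  have h1 := (mem_extend hn hq).1 h (⟨0, by omega⟩, ⟨0, by omega⟩)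
  have h2 : (z : QuantumWeyl K q) = z • centerBasis hn hq (⟨0, by omega⟩, ⟨0, by omega⟩) := by
    rw [centerBasis_zero, Subalgebra.smul_def, smul_eq_mul, mul_one]
  rw [h2, map_smul, Module.Basis.repr_self] at h1
  simpa using h1

/-- The factor algebra by the extension of a prime ideal `p` of the centre has no `p`-torsion. -/
theorem mem_extend_of_mul_mem (hn : 2 ≤ n) (hq : IsPrimitiveRoot q n)
    {p : Ideal (Subalgebra.center K (QuantumWeyl K q))} (hp : p.IsPrime)
    {z : Subalgebra.center K (QuantumWeyl K q)} (hz : z ∉ p) {a : QuantumWeyl K q}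
    (ha : z * a ∈ extend p) : a ∈ extend p := by
  rw [mem_extend hn hq] at ha ⊢
  intro i
  have h1 := ha i
  rw [← smul_eq_mul, ← Subalgebra.smul_def, map_smul] at h1
  exact (hp.mem_or_mem h1).resolve_left hz

theorem extend_le_extend_iff (hn : 2 ≤ n) (hq : IsPrimitiveRoot q n)
    {p p' : Ideal (Subalgebra.center K (QuantumWeyl K q))} : extend p ≤ extend p' ↔ p ≤ p' :=
  ⟨fun h _ hz ↦ (coe_mem_extend hn hq).1 (h ((coe_mem_extend hn hq).2 hz)),
    fun h ↦ TwoSidedIdeal.span_mono (Set.image_mono h)⟩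

theorem extend_span (S : Set (Subalgebra.center K (QuantumWeyl K q))) :
    extend (Ideal.span S) = TwoSidedIdeal.span (Subtype.val '' S) := by
  refine le_antisymm (TwoSidedIdeal.span_le.2 ?_)
    (TwoSidedIdeal.span_mono (Set.image_mono Ideal.subset_span))
  rintro _ ⟨z, hz, rfl⟩
  replace hz : z ∈ Submodule.span _ S := hz
  induction hz using Submodule.span_induction with
  | mem z hz => exact TwoSidedIdeal.subset_span ⟨z, hz, rfl⟩
  | zero => exact TwoSidedIdeal.zero_mem _
  | add u v _ _ hu hv => exact TwoSidedIdeal.add_mem _ hu hv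
  | smul w z _ h => exact TwoSidedIdeal.mul_mem_left _ _ _ h

theorem extend_bot : extend (⊥ : Ideal (Subalgebra.center K (QuantumWeyl K q))) = ⊥ := by
  rw [← Ideal.span_empty, extend_span, Set.image_empty]
  exact le_bot_iff.1 (TwoSidedIdeal.span_le.2 (Set.empty_subset _))

end QuantumWeyl

/-! ### Prime ideals of noncommutative rings -/

namespace TwoSidedIdeal

variable {R : Type*} [Ring R]

theorem algebraMap_smul_mem {K : Type*} [CommRing K] [Algebra K R] (J : TwoSidedIdeal R) (c : K)
    {a : R} (ha : a ∈ J) : c • a ∈ J := by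
  rw [Algebra.smul_def]
  exact J.mul_mem_left _ _ ha

theorem smul_mem_iff_of_ne_zero {K : Type*} [Field K] [Algebra K R] (J : TwoSidedIdeal R) {c : K}
    (hc : c ≠ 0) {a : R} : c • a ∈ J ↔ a ∈ J :=
  ⟨fun h ↦ by simpa [smul_smul, hc] using J.algebraMap_smul_mem c⁻¹ h, J.algebraMap_smul_mem c⟩

theorem IsPrimeIdeal.one_notMem {P : TwoSidedIdeal R} (hP : P.IsPrimeIdeal) : (1 : R) ∉ P :=
  fun h ↦ hP.1 (P.one_mem_iff.1 h)

/-- The elementwise form of primeness. -/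
theorem IsPrimeIdeal.mem_or_mem {P : TwoSidedIdeal R} (hP : P.IsPrimeIdeal) {a b : R}
    (h : ∀ c, a * c * b ∈ P) : a ∈ P ∨ b ∈ P := by
  let J : TwoSidedIdeal R := .mk' {d | ∀ c, a * c * d ∈ P}
    (fun c ↦ by rw [mul_zero]; exact P.zero_mem)
    (fun hu hv c ↦ by rw [mul_add]; exact P.add_mem (hu c) (hv c))
    (fun hu c ↦ by rw [mul_neg]; exact P.neg_mem (hu c))
    (fun {e d} hd c ↦ by rw [← mul_assoc, mul_assoc a c]; exact hd (c * e))
    (fun {d e} hd c ↦ by rw [← mul_assoc]; exact P.mul_mem_right _ _ (hd c))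
  let I : TwoSidedIdeal R := .mk' {u | ∀ d ∈ J, ∀ c, u * c * d ∈ P}
    (fun d _ c ↦ by rw [zero_mul, zero_mul]; exact P.zero_mem)
    (fun hu hv d hd c ↦ by rw [add_mul, add_mul]; exact P.add_mem (hu d hd c) (hv d hd c))
    (fun hu d hd c ↦ by rw [neg_mul, neg_mul]; exact P.neg_mem (hu d hd c))
    (fun {e u} hu d hd c ↦ by
      rw [mul_assoc, mul_assoc, ← mul_assoc u]; exact P.mul_mem_left _ _ (hu d hd c))
    (fun {u e} hu d hd c ↦ by rw [mul_assoc u]; exact hu d hd (e * c))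
  have hJ : ∀ d, d ∈ J ↔ ∀ c, a * c * d ∈ P := fun d ↦ by simp only [J, mem_mk', Set.mem_ofPred_eq]
  have hI : ∀ u, u ∈ I ↔ ∀ d ∈ J, ∀ c, u * c * d ∈ P := fun u ↦ by
    simp only [I, mem_mk', Set.mem_ofPred_eq]
  refine (hP.2 I J fun u hu d hd ↦ by simpa using (hI u).1 hu d hd 1).imp (fun hIP ↦ hIP ?_)
    (fun hJP ↦ hJP ?_)
  · exact (hI a).2 fun d hd ↦ (hJ d).1 hd
  · exact (hJ b).2 h

theorem isPrimeIdeal_ker {L : Type*} [Ring L] [IsDomain L] (f : R →+* L) :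
    (ker f).IsPrimeIdeal := by
  refine ⟨fun h ↦ ?_, fun I J hIJ ↦ ?_⟩
  · have h1 : (1 : R) ∈ ker f := by rw [h]; trivial
    rw [mem_ker, map_one] at h1
    exact one_ne_zero h1
  · by_contra! hcon
    obtain ⟨a, haI, ha⟩ := SetLike.not_le_iff_exists.1 hcon.1
    obtain ⟨b, hbJ, hb⟩ := SetLike.not_le_iff_exists.1 hcon.2
    have h1 := hIJ a haI b hbJ
    rw [mem_ker, map_mul] at h1
    rw [mem_ker] at ha hb
    exact (mul_eq_zero.1 h1).elim ha hb

end TwoSidedIdeal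

/-- The primes of a factor ring correspond to the primes above the ideal. -/
theorem mem_primeSpecQuot_iff {R : Type*} [Ring R] {I : TwoSidedIdeal R} {C : Set R}
    {P : TwoSidedIdeal R} :
    P ∈ primeSpecQuot I C ↔ P ∈ primeSpec R ∧ I ≤ P ∧ ∀ c ∈ C, c ∉ P := by
  have hsurj : Function.Surjective I.ringCon.mk' := I.ringCon.mk'_surjective
  have hker : ∀ a, I.ringCon.mk' a = 0 ↔ a ∈ I := fun a ↦ by
    rw [← TwoSidedIdeal.mem_ker, TwoSidedIdeal.ker_ringCon_mk']
  constructor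
  · rintro ⟨Q, hQ, hC, rfl⟩
    refine ⟨⟨fun h ↦ hQ.1 ?_, fun J₁ J₂ h ↦ ?_⟩, fun a ha ↦ ?_, fun c hc h ↦ hC c hc ?_⟩
    · rw [← Q.one_mem_iff, ← map_one I.ringCon.mk', ← TwoSidedIdeal.mem_comap, h]
      trivial
    · by_contra! hcon
      obtain ⟨a, ha, haQ⟩ := SetLike.not_le_iff_exists.1 hcon.1
      obtain ⟨b, hb, hbQ⟩ := SetLike.not_le_iff_exists.1 hcon.2
      rw [TwoSidedIdeal.mem_comap] at haQ hbQ
      refine (TwoSidedIdeal.IsPrimeIdeal.mem_or_mem hQ fun c ↦ ?_).elim haQ hbQ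
      obtain ⟨c, rfl⟩ := hsurj c
      rw [← map_mul, ← map_mul, ← TwoSidedIdeal.mem_comap]
      exact h _ (J₁.mul_mem_right _ _ ha) _ hb
    · rw [TwoSidedIdeal.mem_comap, (hker a).2 ha]
      exact Q.zero_mem
    · exact (TwoSidedIdeal.mem_comap _).1 h
  · rintro ⟨hP, hIP, hC⟩
    have hmem : ∀ a, I.ringCon.mk' a ∈ I.ringCon.mk' '' (P : Set R) → a ∈ P := by
      rintro a ⟨b, hb, hab⟩
      have h1 : b - a ∈ I := by rw [← hker, map_sub, hab, sub_self]
      have h2 := P.sub_mem hb (hIP h1)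
      rwa [sub_sub_cancel] at h2
    let Q : TwoSidedIdeal I.ringCon.Quotient := .mk' (I.ringCon.mk' '' (P : Set R))
      ⟨0, P.zero_mem, map_zero _⟩
      (by rintro _ _ ⟨a, ha, rfl⟩ ⟨b, hb, rfl⟩; exact ⟨a + b, P.add_mem ha hb, map_add _ _ _⟩)
      (by rintro _ ⟨a, ha, rfl⟩; exact ⟨-a, P.neg_mem ha, map_neg _ _⟩)
      (by
        rintro c _ ⟨a, ha, rfl⟩
        obtain ⟨c, rfl⟩ := hsurj c
        exact ⟨c * a, P.mul_mem_left _ _ ha, map_mul _ _ _⟩)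
      (by
        rintro _ c ⟨a, ha, rfl⟩
        obtain ⟨c, rfl⟩ := hsurj c
        exact ⟨a * c, P.mul_mem_right _ _ ha, map_mul _ _ _⟩)
    have hQ : ∀ a, I.ringCon.mk' a ∈ Q ↔ a ∈ P := fun a ↦
      (TwoSidedIdeal.mem_mk' _ _ _ _ _ _ _).trans ⟨hmem a, fun ha ↦ ⟨a, ha, rfl⟩⟩
    refine ⟨Q, ⟨fun h ↦ hP.one_notMem ?_, fun J₁ J₂ h ↦ ?_⟩, fun c hc h ↦ hC c hc ((hQ c).1 h),
      TwoSidedIdeal.ext fun a ↦ by rw [TwoSidedIdeal.mem_comap, hQ]⟩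
    · rw [← hQ, h]
      trivial
    · by_contra! hcon
      obtain ⟨a, ha, haQ⟩ := SetLike.not_le_iff_exists.1 hcon.1
      obtain ⟨b, hb, hbQ⟩ := SetLike.not_le_iff_exists.1 hcon.2
      obtain ⟨a, rfl⟩ := hsurj a
      obtain ⟨b, rfl⟩ := hsurj b
      rw [hQ] at haQ hbQ
      refine (hP.mem_or_mem fun c ↦ ?_).elim haQ hbQ
      rw [← hQ, map_mul, map_mul]
      exact h _ (J₁.mul_mem_right _ _ ha) _ hb

namespace QuantumWeyl

variable {K : Type*} [Field K] {q : K} {n : ℕ}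

/-! ### The normal element `h` -/

theorem x_mul_h_pow (hn : 2 ≤ n) (hq : IsPrimitiveRoot q n) (i : ℕ) :
    x q * h q ^ i = q ^ i • (h q ^ i * x q) := by
  induction i with
  | zero => simp
  | succ i ih =>
    rw [pow_succ, ← mul_assoc, ih, smul_mul_assoc, mul_assoc, x_mul_h hn hq, mul_smul_comm,
      smul_smul, ← pow_succ, mul_assoc]

theorem x_pow_mul_h (hn : 2 ≤ n) (hq : IsPrimitiveRoot q n) (j : ℕ) :
    x q ^ j * h q = q ^ j • (h q * x q ^ j) := by
  induction j with
  | zero => simp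
  | succ j ih =>
    rw [pow_succ', mul_assoc, ih, mul_smul_comm, ← mul_assoc, x_mul_h hn hq, smul_mul_assoc,
      smul_smul, ← pow_succ, mul_assoc, ← pow_succ']

theorem h_mul_y_pow (hn : 2 ≤ n) (hq : IsPrimitiveRoot q n) (j : ℕ) :
    h q * y q ^ j = q ^ j • (y q ^ j * h q) := by
  induction j with
  | zero => simp
  | succ j ih =>
    rw [pow_succ, ← mul_assoc, ih, smul_mul_assoc, mul_assoc, h_mul_y hn hq, mul_smul_comm,
      smul_smul, ← pow_succ, mul_assoc]

theorem h_pow_mul_y_pow (hn : 2 ≤ n) (hq : IsPrimitiveRoot q n) (i j : ℕ) :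
    h q ^ i * y q ^ j = (q ^ i) ^ j • (y q ^ j * h q ^ i) := by
  induction i with
  | zero => simp
  | succ i ih =>
    rw [pow_succ', mul_assoc, ih, mul_smul_comm, ← mul_assoc, h_mul_y_pow hn hq, smul_mul_assoc,
      smul_smul, mul_assoc, ← mul_pow, ← pow_succ, ← pow_succ']

/-- `y ^ j * x ^ j` is a polynomial in `h`, split into linear factors. -/
theorem y_pow_mul_x_pow (hn : 2 ≤ n) (hq : IsPrimitiveRoot q n) (j : ℕ) :
    y q ^ j * x q ^ j = aeval (h q) (∏ i ∈ Finset.range j,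
      (C (q ^ i)⁻¹ * X - C (1 / (q - 1)))) := by
  have hq0 : q ≠ 0 := hq.ne_zero (by omega)
  induction j with
  | zero => simp
  | succ j ih =>
    have h1 : y q * x q = h q - algebraMap K _ (1 / (q - 1)) := by rw [h, add_sub_cancel_right]
    have h2 : y q ^ j * h q = (q ^ j)⁻¹ • (h q * y q ^ j) := by
      rw [h_mul_y_pow hn hq, smul_smul, inv_mul_cancel₀ (pow_ne_zero _ hq0), one_smul]
    rw [Finset.prod_range_succ, mul_comm, map_mul, ← ih, pow_succ, pow_succ', mul_assoc,
      ← mul_assoc (y q), h1, ← mul_assoc, mul_sub, h2, ← Algebra.commutes]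
    simp [sub_mul, Algebra.smul_def, mul_assoc]

theorem exists_sZ_eq (hn : 2 ≤ n) (hq : IsPrimitiveRoot q n) :
    ∃ ε d : K, ε ≠ 0 ∧ d ≠ 0 ∧
      sZ hn hq = ε • (rZ hn hq * tZ hn hq) + algebraMap K _ d := by
  have hq0 : q ≠ 0 := hq.ne_zero (by omega)
  have hq1 : q - 1 ≠ 0 := sub_ne_zero.2 (hq.ne_one (by omega))
  set c : K := 1 / (q - 1) with hc
  set ε : K := ∏ i ∈ Finset.range n, q ^ i
  have hε : ε ≠ 0 := Finset.prod_ne_zero_iff.2 fun i _ ↦ pow_ne_zero _ hq0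
  refine ⟨ε, c ^ n, hε, pow_ne_zero _ (one_div_ne_zero hq1), Subtype.ext ?_⟩
  have h1 : C ε * ∏ i ∈ Finset.range n, (C (q ^ i)⁻¹ * X - C c) = X ^ n - C (c ^ n) := by
    rw [X_pow_sub_C_eq_prod hq (by omega) rfl, map_prod, ← Finset.prod_mul_distrib]
    refine Finset.prod_congr rfl fun i _ ↦ ?_
    rw [mul_sub, ← mul_assoc, ← C_mul, ← C_mul, mul_inv_cancel₀ (pow_ne_zero _ hq0), C_1, one_mul]
  have h2 := congrArg (aeval (h q)) h1
  rw [map_mul, ← y_pow_mul_x_pow hn hq] at h2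
  simp only [aeval_C, map_sub, map_pow, aeval_X, ← Algebra.smul_def] at h2
  change h q ^ n = ε • (y q ^ n * x q ^ n) + algebraMap K _ (c ^ n)
  rw [h2, map_pow, sub_add_cancel]

/-! ### The grading by conjugation with `h` -/

variable (q n) in
/-- The span of the monomials `y ^ i * x ^ j` with `i - j` congruent to `k` modulo `n`. Its
elements `a` satisfy `h a = q ^ k a h`. -/
def grade (k : ℕ) : Submodule K (QuantumWeyl K q) :=
  Submodule.span K (pbw q '' {p | p.1 ≡ p.2 + k [MOD n]})

theorem h_mul_of_mem_grade (hn : 2 ≤ n) (hq : IsPrimitiveRoot q n) {k : ℕ} {a : QuantumWeyl K q}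
    (ha : a ∈ grade q n k) : h q * a = q ^ k • (a * h q) := by
  induction ha using Submodule.span_induction with
  | mem a ha =>
    obtain ⟨⟨i, j⟩, hij, rfl⟩ := ha
    have h1 : q ^ i = q ^ (j + k) := pow_eq_pow_of_modEq hij hq.pow_eq_one
    rw [pbw_apply, ← mul_assoc, h_mul_y_pow hn hq, h1, mul_assoc, x_pow_mul_h hn hq,
      mul_smul_comm, smul_smul, smul_mul_assoc, mul_assoc, pow_add, mul_comm]
  | zero => simp
  | add u v _ _ hu hv => rw [mul_add, hu, hv, add_mul, smul_add]
  | smul c u _ hu => rw [mul_smul_comm, hu, smul_mul_assoc, smul_comm]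

theorem h_pow_mul_of_mem_grade (hn : 2 ≤ n) (hq : IsPrimitiveRoot q n) {k : ℕ}
    {a : QuantumWeyl K q} (ha : a ∈ grade q n k) (m : ℕ) :
    h q ^ m * a = (q ^ k) ^ m • (a * h q ^ m) := by
  induction m with
  | zero => simp
  | succ m ih =>
    rw [pow_succ', mul_assoc, ih, mul_smul_comm, ← mul_assoc, h_mul_of_mem_grade hn hq ha,
      smul_mul_assoc, smul_smul, ← pow_succ, mul_assoc, ← pow_succ']

theorem exists_sum_grade (hn : 2 ≤ n) (a : QuantumWeyl K q) :
    ∃ b : ℕ → QuantumWeyl K q, (∀ k, b k ∈ grade q n k) ∧ a = ∑ k ∈ Finset.range n, b k := by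
  induction (pbw q).mem_span a using Submodule.span_induction with
  | mem a ha =>
    obtain ⟨⟨i, j⟩, rfl⟩ := ha
    have hk : (i + (n - 1) * j) % n < n := Nat.mod_lt _ (by omega)
    refine ⟨Pi.single ((i + (n - 1) * j) % n) (pbw q (i, j)), fun k ↦ ?_, ?_⟩
    · by_cases h : k = (i + (n - 1) * j) % n
      · subst h
        rw [Pi.single_eq_same]
        refine Submodule.subset_span ⟨(i, j), ?_, rfl⟩
        have h1 : j + (i + (n - 1) * j) = i + n * j := by
          obtain ⟨m, rfl⟩ : ∃ m, n = m + 1 := ⟨n - 1, by omega⟩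
          rw [Nat.add_sub_cancel]; ring
        have h2 : j + (i + (n - 1) * j) % n ≡ j + (i + (n - 1) * j) [MOD n] :=
          (Nat.mod_modEq _ _).add_left j
        rw [h1] at h2
        exact (h2.trans (by simp [Nat.ModEq])).symm
      · rw [Pi.single_eq_of_ne h]
        exact Submodule.zero_mem _
    · rw [Finset.sum_pi_single', if_pos (Finset.mem_range.2 hk)]
  | zero => exact ⟨0, fun k ↦ Submodule.zero_mem _, by simp⟩
  | add u v _ _ hu hv =>
    obtain ⟨b, hb, rfl⟩ := hu
    obtain ⟨b', hb', rfl⟩ := hv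
    exact ⟨b + b', fun k ↦ Submodule.add_mem _ (hb k) (hb' k), by simp [Finset.sum_add_distrib]⟩
  | smul c u _ hu =>
    obtain ⟨b, hb, rfl⟩ := hu
    exact ⟨c • b, fun k ↦ Submodule.smul_mem _ _ (hb k), by simp [Finset.smul_sum]⟩

theorem mul_x_mem_grade {k : ℕ} {a : QuantumWeyl K q} (ha : a ∈ grade q n (k + 1)) :
    a * x q ∈ grade q n k := by
  have : grade q n (k + 1) ≤ (grade q n k).comap (LinearMap.mulRight K (x q)) := by
    refine Submodule.span_le.2 ?_
    rintro _ ⟨⟨i, j⟩, hij, rfl⟩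
    refine Submodule.subset_span ⟨(i, j + 1), ?_, ?_⟩
    · simpa [add_assoc, add_comm 1] using hij
    · rw [LinearMap.mulRight_apply, pbw_apply, pbw_apply, mul_assoc, ← pow_succ]
  exact this ha

theorem mul_y_mem_grade {k : ℕ} {a : QuantumWeyl K q} (ha : a ∈ grade q n k) :
    a * y q ∈ grade q n (k + 1) := by
  have : grade q n k ≤ (grade q n (k + 1)).comap (LinearMap.mulRight K (y q)) := by
    refine Submodule.span_le.2 ?_
    rintro _ ⟨⟨i, j⟩, hij, rfl⟩
    replace hij : i ≡ j + k [MOD n] := hij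
    have h1 : pbw q (i, j) * y q = q ^ j • pbw q (i + 1, j) +
        (∑ k ∈ Finset.range j, q ^ k) • pbw q (i, j - 1) := by
      simp only [pbw_apply]
      rw [mul_assoc, x_pow_mul_y', mul_add, mul_smul_comm, mul_smul_comm, ← mul_assoc, ← pow_succ]
    rw [SetLike.mem_coe, Submodule.mem_comap, LinearMap.mulRight_apply, h1]
    refine Submodule.add_mem _ (Submodule.smul_mem _ _ (Submodule.subset_span ⟨_, ?_, rfl⟩)) ?_
    · exact hij.add_right 1
    · rcases j with _ | j
      · simp
      · refine Submodule.smul_mem _ _ (Submodule.subset_span ⟨_, ?_, rfl⟩)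
        change i ≡ j + (k + 1) [MOD n]
        rwa [add_comm k, ← add_assoc]
  exact this ha

theorem mul_y_pow_mem_grade {k : ℕ} {a : QuantumWeyl K q} (ha : a ∈ grade q n k) (m : ℕ) :
    a * y q ^ m ∈ grade q n (k + m) := by
  induction m with
  | zero => simpa using ha
  | succ m ih => rw [pow_succ, ← mul_assoc]; exact mul_y_mem_grade ih

theorem grade_add_self (k : ℕ) : grade q n (k + n) = grade q n k := by
  have : ∀ p : ℕ × ℕ, p.1 ≡ p.2 + (k + n) [MOD n] ↔ p.1 ≡ p.2 + k [MOD n] := fun p ↦ by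
    rw [← add_assoc, Nat.ModEq, Nat.add_mod_right]; rfl
  simp only [grade, this]

/-- The component of degree zero is generated by the powers of `h` over the centre. -/
theorem exists_sum_smul_h_pow (hn : 2 ≤ n) (hq : IsPrimitiveRoot q n) {a : QuantumWeyl K q}
    (ha : a ∈ grade q n 0) : ∃ z : Fin n → Subalgebra.center K (QuantumWeyl K q),
      ∑ i, z i • h q ^ (i : ℕ) = a := by
  have hn0 : 0 < n := by omega
  rw [← Submodule.mem_span_range_iff_exists_fun]
  set W := Submodule.span (Subalgebra.center K (QuantumWeyl K q))
    (Set.range fun i : Fin n ↦ h q ^ (i : ℕ))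
  have hpow : ∀ i, h q ^ i ∈ W := by
    intro i
    have h1 : h q ^ i = sZ hn hq ^ (i / n) • h q ^ (i % n) := by
      change _ = (h q ^ n) ^ (i / n) * h q ^ (i % n)
      rw [← pow_mul, ← pow_add, Nat.div_add_mod]
    rw [h1]
    exact W.smul_mem _ (Submodule.subset_span ⟨⟨i % n, Nat.mod_lt _ hn0⟩, rfl⟩)
  have hpoly : ∀ f : K[X], aeval (h q) f ∈ W := by
    intro f
    rw [aeval_eq_sum_range]
    exact W.sum_mem fun i _ ↦ W.smul_of_tower_mem _ (hpow i)
  have hmon : ∀ i, y q ^ i * x q ^ i ∈ W := fun i ↦ by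
    rw [y_pow_mul_x_pow hn hq]
    exact hpoly _
  induction ha using Submodule.span_induction with
  | mem a ha =>
    obtain ⟨⟨i, j⟩, hij, rfl⟩ := ha
    replace hij : i ≡ j [MOD n] := hij
    rw [pbw_apply]
    rcases le_total i j with hle | hle
    · obtain ⟨m, hm⟩ := (Nat.modEq_iff_dvd' hle).1 hij
      have h1 : y q ^ i * x q ^ j = tZ hn hq ^ m • (y q ^ i * x q ^ i) := by
        change _ = t q n ^ m * (y q ^ i * x q ^ i)
        rw [← commute_of_mem_center (pow_mem (t_mem_center hn hq) m), mul_assoc, t, ← pow_mul,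
          ← pow_add, ← hm, Nat.add_sub_cancel' hle]
      rw [h1]
      exact W.smul_mem _ (hmon i)
    · obtain ⟨m, hm⟩ := (Nat.modEq_iff_dvd' hle).1 hij.symm
      have h1 : y q ^ i * x q ^ j = rZ hn hq ^ m • (y q ^ j * x q ^ j) := by
        change _ = (y q ^ n) ^ m * (y q ^ j * x q ^ j)
        rw [← mul_assoc, ← pow_mul, ← pow_add, ← hm, Nat.sub_add_cancel hle]
      rw [h1]
      exact W.smul_mem _ (hmon j)
  | zero => exact W.zero_mem
  | add u v _ _ hu hv => exact W.add_mem hu hv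
  | smul c u _ hu => exact W.smul_of_tower_mem c hu

/-! ### Two-sided ideals away from `s` -/

/-- The components of degree `1` and `-1` generate the unit ideal: an element that `x` and
`y ^ (n - 1)` multiply into an ideal lies in the ideal. -/
theorem mem_of_mul_x_mem (hn : 2 ≤ n) (hq : IsPrimitiveRoot q n)
    (J : TwoSidedIdeal (QuantumWeyl K q)) {a : QuantumWeyl K q} (hx : a * x q ∈ J)
    (hy : a * y q ^ (n - 1) ∈ J) : a ∈ J := by
  -- descend from `a y ^ (e + 1)` to `a y ^ e` by commuting `y ^ (e + 1)` with `x`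
  suffices ∀ d e, d + e = n - 1 → a * y q ^ e ∈ J by simpa using this (n - 1) 0 rfl
  intro d
  induction d with
  | zero => rintro e he; rw [zero_add] at he; rwa [he]
  | succ d ih =>
    intro e he
    have h1 : a * y q ^ (e + 1) ∈ J := ih (e + 1) (by omega)
    have h2 : a * x q * y q ^ (e + 1) = q ^ (e + 1) • (a * y q ^ (e + 1) * x q) +
        (∑ i ∈ Finset.range (e + 1), q ^ i) • (a * y q ^ e) := by
      rw [mul_assoc, x_mul_y_pow, mul_add, mul_smul_comm, mul_smul_comm, ← mul_assoc]
    have h3 : (∑ i ∈ Finset.range (e + 1), q ^ i) ≠ 0 := fun h0 ↦ by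
      have := Nat.le_of_dvd (by omega) ((sum_pow_eq_zero_iff hn hq _).1 h0)
      omega
    rw [← J.smul_mem_iff_of_ne_zero h3, ← add_sub_cancel_left (q ^ (e + 1) • _) (_ • (a * _)), ← h2]
    exact J.sub_mem (J.mul_mem_right _ _ hx) (J.algebraMap_smul_mem _ (J.mul_mem_right _ _ h1))

/-- Orthogonality of the characters of the group of `n`-th roots of unity. -/
theorem sum_div_pow (hn : 2 ≤ n) (hq : IsPrimitiveRoot q n) {i j : ℕ} (hi : i < n) (hj : j < n) :
    ∑ m ∈ Finset.range n, (q ^ i / q ^ j) ^ m = if i = j then (n : K) else 0 := by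
  have hq0 : q ≠ 0 := hq.ne_zero (by omega)
  split_ifs with hij
  · subst hij
    simp [div_self (pow_ne_zero _ hq0)]
  · have h1 : q ^ i / q ^ j - 1 ≠ 0 := by
      rw [sub_ne_zero, Ne, div_eq_one_iff_eq (pow_ne_zero _ hq0)]
      exact fun h ↦ hij (hq.pow_inj hi hj h)
    have h2 := geom_sum_mul (q ^ i / q ^ j) n
    rw [div_pow, ← pow_mul, ← pow_mul, mul_comm i, mul_comm j, pow_mul, pow_mul, hq.pow_eq_one,
      one_pow, one_pow, div_one, sub_self] at h2
    exact (mul_eq_zero.1 h2).resolve_right h1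

theorem natCast_ne_zero (hn : 2 ≤ n) (hq : IsPrimitiveRoot q n) : (n : K) ≠ 0 := by
  have : NeZero n := ⟨by omega⟩
  exact (hq.neZero').out

/-- An ideal is stable under the automorphism of the component of degree zero which is, in the
localization, conjugation by `x`. -/
theorem twist_mem (hn : 2 ≤ n) (hq : IsPrimitiveRoot q n) (J : TwoSidedIdeal (QuantumWeyl K q))
    {z : Fin n → Subalgebra.center K (QuantumWeyl K q)} (hz : ∑ i, z i • h q ^ (i : ℕ) ∈ J)
    (m : ℕ) : ∑ i, z i • ((q ^ (i : ℕ)) ^ m • h q ^ (i : ℕ)) ∈ J := by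
  induction m with
  | zero => simpa using hz
  | succ m ih =>
    refine mem_of_mul_x_mem hn hq J ?_ ?_
    · have h1 : (∑ i, z i • ((q ^ (i : ℕ)) ^ (m + 1) • h q ^ (i : ℕ))) * x q =
          x q * ∑ i, z i • ((q ^ (i : ℕ)) ^ m • h q ^ (i : ℕ)) := by
        rw [Finset.sum_mul, Finset.mul_sum]
        refine Finset.sum_congr rfl fun i _ ↦ ?_
        rw [mul_center_smul, mul_smul_comm, x_mul_h_pow hn hq, smul_smul, smul_mul_assoc,
          smul_mul_assoc, pow_succ]
      rw [h1]
      exact J.mul_mem_left _ _ ih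
    · have h1 : (∑ i, z i • ((q ^ (i : ℕ)) ^ (m + 1) • h q ^ (i : ℕ))) * y q ^ (n - 1) =
          y q ^ (n - 1) * ∑ i, z i • ((q ^ (i : ℕ)) ^ m • h q ^ (i : ℕ)) := by
        rw [Finset.sum_mul, Finset.mul_sum]
        refine Finset.sum_congr rfl fun i _ ↦ ?_
        have h2 : (q ^ (i : ℕ)) ^ (m + 1) * (q ^ (i : ℕ)) ^ (n - 1) = (q ^ (i : ℕ)) ^ m := by
          rw [← pow_add, show m + 1 + (n - 1) = n + m by omega, pow_add, ← pow_mul, mul_comm _ n,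
            pow_mul, hq.pow_eq_one, one_pow, one_mul]
        rw [mul_center_smul, mul_smul_comm, smul_mul_assoc, smul_mul_assoc, h_pow_mul_y_pow hn hq,
          smul_smul, h2]
      rw [h1]
      exact J.mul_mem_left _ _ ih

/-- Fourier inversion over the powers of the twist isolates the terms of an element of degree zero
of the ideal. -/
theorem smul_h_pow_mem (hn : 2 ≤ n) (hq : IsPrimitiveRoot q n) (J : TwoSidedIdeal (QuantumWeyl K q))
    {z : Fin n → Subalgebra.center K (QuantumWeyl K q)} (hz : ∑ i, z i • h q ^ (i : ℕ) ∈ J)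
    (j : Fin n) : z j • h q ^ (j : ℕ) ∈ J := by
  have h1 : (n : K) • (z j • h q ^ (j : ℕ)) = ∑ m ∈ Finset.range n, ((q ^ (j : ℕ))⁻¹) ^ m •
      ∑ i, z i • ((q ^ (i : ℕ)) ^ m • h q ^ (i : ℕ)) := by
    simp only [Finset.smul_sum]
    rw [Finset.sum_comm]
    have h2 : ∀ i : Fin n, ∑ m ∈ Finset.range n, ((q ^ (j : ℕ))⁻¹) ^ m •
        (z i • ((q ^ (i : ℕ)) ^ m • h q ^ (i : ℕ))) =
          (if (i : ℕ) = j then (n : K) else 0) • (z i • h q ^ (i : ℕ)) := by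
      intro i
      rw [← sum_div_pow hn hq i.2 j.2, Finset.sum_smul]
      refine Finset.sum_congr rfl fun m _ ↦ ?_
      rw [smul_comm (z i), smul_smul, ← mul_pow, div_eq_inv_mul]
    simp only [h2, Fin.val_inj, ite_smul, zero_smul, Finset.sum_ite_eq', Finset.mem_univ, if_true]
  rw [← J.smul_mem_iff_of_ne_zero (natCast_ne_zero hn hq), h1]
  exact J.finsetSum_mem _ _ fun m _ ↦ J.algebraMap_smul_mem _ (twist_mem hn hq J hz m)

/-- The components of an element of an ideal lie in the ideal after multiplication by `s`. -/
theorem s_mul_mem_of_sum_mem (hn : 2 ≤ n) (hq : IsPrimitiveRoot q n)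
    (J : TwoSidedIdeal (QuantumWeyl K q)) {b : ℕ → QuantumWeyl K q}
    (hb : ∀ k, b k ∈ grade q n k) (hJ : ∑ k ∈ Finset.range n, b k ∈ J) {j : ℕ} (hj : j < n) :
    s q n * b j ∈ J := by
  have h1 : (n : K) • (s q n * b j) = ∑ m ∈ Finset.range n, ((q ^ j)⁻¹) ^ m •
      (h q ^ m * (∑ k ∈ Finset.range n, b k) * h q ^ (n - m)) := by
    simp only [Finset.mul_sum, Finset.sum_mul, Finset.smul_sum]
    rw [Finset.sum_comm]
    have h2 : ∀ k ∈ Finset.range n, ∑ m ∈ Finset.range n, ((q ^ j)⁻¹) ^ m •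
        (h q ^ m * b k * h q ^ (n - m)) = (if k = j then (n : K) else 0) • (s q n * b k) := by
      intro k hk
      rw [← sum_div_pow hn hq (Finset.mem_range.1 hk) hj, Finset.sum_smul]
      refine Finset.sum_congr rfl fun m hm ↦ ?_
      rw [h_pow_mul_of_mem_grade hn hq (hb k), smul_mul_assoc, mul_assoc, ← pow_add,
        Nat.add_sub_cancel' (Finset.mem_range.1 hm).le, smul_smul, ← mul_pow, ← div_eq_inv_mul,
        ← commute_of_mem_center (s_mem_center hn hq), s]
    rw [Finset.sum_congr rfl h2]
    simp only [ite_smul, zero_smul, Finset.sum_ite_eq', Finset.mem_range, hj, if_true]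
  rw [← J.smul_mem_iff_of_ne_zero (natCast_ne_zero hn hq), h1]
  exact J.finsetSum_mem _ _ fun m _ ↦ J.algebraMap_smul_mem _
    (J.mul_mem_right _ _ (J.mul_mem_left _ _ hJ))

/-- The contraction of a two-sided ideal to the centre. -/
def contract (P : TwoSidedIdeal (QuantumWeyl K q)) :
    Ideal (Subalgebra.center K (QuantumWeyl K q)) where
  carrier := {z | (z : QuantumWeyl K q) ∈ P}
  add_mem' := P.add_mem
  zero_mem' := P.zero_mem
  smul_mem' z _ hw := P.mul_mem_left z _ hw

theorem mem_contract {P : TwoSidedIdeal (QuantumWeyl K q)}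
    {z : Subalgebra.center K (QuantumWeyl K q)} : z ∈ contract P ↔ (z : QuantumWeyl K q) ∈ P :=
  Iff.rfl

theorem extend_contract_le (P : TwoSidedIdeal (QuantumWeyl K q)) : extend (contract P) ≤ P := by
  refine TwoSidedIdeal.span_le.2 ?_
  rintro _ ⟨z, hz, rfl⟩
  exact hz

theorem contract_mono {P Q : TwoSidedIdeal (QuantumWeyl K q)} (hPQ : P ≤ Q) :
    contract P ≤ contract Q := fun _ hz ↦ hPQ hz

theorem contract_extend (hn : 2 ≤ n) (hq : IsPrimitiveRoot q n)
    (p : Ideal (Subalgebra.center K (QuantumWeyl K q))) : contract (extend p) = p :=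
  Ideal.ext fun _ ↦ coe_mem_extend hn hq

/-- The homogeneous case of `s_sq_mul_mem`, by induction on the degree. -/
theorem s_sq_mul_mem_of_mem_grade (hn : 2 ≤ n) (hq : IsPrimitiveRoot q n)
    (J : TwoSidedIdeal (QuantumWeyl K q)) {k : ℕ} {a : QuantumWeyl K q} (ha : a ∈ grade q n k)
    (haJ : s q n * a ∈ J) : s q n ^ 2 * a ∈ extend (contract J) := by
  induction k generalizing a with
  | zero =>
    obtain ⟨z, rfl⟩ := exists_sum_smul_h_pow hn hq ha
    have h1 : ∀ z : Subalgebra.center K (QuantumWeyl K q), ∀ b,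
        s q n * z • b = (sZ hn hq * z) • b :=
      fun z b ↦ by rw [mul_smul]; rfl
    have h2 : ∑ i, (sZ hn hq * z i) • h q ^ (i : ℕ) ∈ J := by
      rw [Finset.mul_sum] at haJ
      simpa only [h1] using haJ
    rw [Finset.mul_sum]
    refine TwoSidedIdeal.finsetSum_mem _ _ _ fun i _ ↦ ?_
    rw [sq, mul_assoc, h1, h1, Subalgebra.smul_def, smul_eq_mul]
    refine TwoSidedIdeal.mul_mem_right _ _ _ ((coe_mem_extend hn hq).2 (mem_contract.2 ?_))
    have h3 := J.mul_mem_right _ (h q ^ (n - i)) (smul_h_pow_mem hn hq J h2 i)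
    rw [smul_mul_assoc, ← pow_add, Nat.add_sub_cancel' i.2.le, Subalgebra.smul_def, smul_eq_mul,
      ← commute_of_mem_center (sZ hn hq * z i).2] at h3
    exact h3
  | succ k ih =>
    refine mem_of_mul_x_mem hn hq _ ?_ ?_
    · rw [mul_assoc]
      exact ih (mul_x_mem_grade ha) (by rw [← mul_assoc]; exact J.mul_mem_right _ _ haJ)
    · rw [mul_assoc]
      refine ih ?_ (by rw [← mul_assoc]; exact J.mul_mem_right _ _ haJ)
      have h1 := mul_y_pow_mem_grade ha (n - 1)
      rwa [show k + 1 + (n - 1) = k + n by omega, grade_add_self] at h1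

/-- Away from `s`, every two-sided ideal is generated by its contraction to the centre. -/
theorem s_sq_mul_mem (hn : 2 ≤ n) (hq : IsPrimitiveRoot q n)
    (J : TwoSidedIdeal (QuantumWeyl K q)) {a : QuantumWeyl K q} (ha : a ∈ J) :
    s q n ^ 2 * a ∈ extend (contract J) := by
  obtain ⟨b, hb, rfl⟩ := exists_sum_grade hn a
  rw [Finset.mul_sum]
  exact TwoSidedIdeal.finsetSum_mem _ _ _ fun k hk ↦
    s_sq_mul_mem_of_mem_grade hn hq J (hb k)
      (s_mul_mem_of_sum_mem hn hq J hb ha (Finset.mem_range.1 hk))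

theorem mem_extend_of_mem (hn : 2 ≤ n) (hq : IsPrimitiveRoot q n)
    {p : Ideal (Subalgebra.center K (QuantumWeyl K q))} (hp : p.IsPrime) (hs : sZ hn hq ∉ p)
    {J : TwoSidedIdeal (QuantumWeyl K q)} (hJ : contract J ≤ p) : J ≤ extend p := by
  intro a ha
  have h1 : ((sZ hn hq ^ 2 : Subalgebra.center K (QuantumWeyl K q)) : QuantumWeyl K q) * a ∈
      extend p := (extend_le_extend_iff hn hq).2 hJ (s_sq_mul_mem hn hq J ha)
  exact mem_extend_of_mul_mem hn hq hp (fun h ↦ hs (hp.mem_of_pow_mem _ h)) h1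

theorem isPrimeIdeal_extend (hn : 2 ≤ n) (hq : IsPrimitiveRoot q n)
    {p : Ideal (Subalgebra.center K (QuantumWeyl K q))} (hp : p.IsPrime) (hs : sZ hn hq ∉ p) :
    (extend p).IsPrimeIdeal := by
  refine ⟨fun h ↦ hp.one_notMem ((coe_mem_extend hn hq).1 (by rw [h]; trivial)), fun I J hIJ ↦ ?_⟩
  by_contra! hcon
  obtain ⟨z, hzI, hz⟩ := SetLike.not_le_iff_exists.1
    fun hI : contract I ≤ p ↦ hcon.1 (mem_extend_of_mem hn hq hp hs hI)
  obtain ⟨w, hwJ, hw⟩ := SetLike.not_le_iff_exists.1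
    fun hJ : contract J ≤ p ↦ hcon.2 (mem_extend_of_mem hn hq hp hs hJ)
  have h1 : z * w ∈ p := (coe_mem_extend hn hq).1 (hIJ z hzI w hwJ)
  exact (hp.mem_or_mem h1).elim hz hw

theorem isPrime_contract {P : TwoSidedIdeal (QuantumWeyl K q)} (hP : P.IsPrimeIdeal) :
    (contract P).IsPrime := by
  refine ⟨fun h ↦ hP.one_notMem ?_, fun {z w} hzw ↦ ?_⟩
  · have h1 : (1 : Subalgebra.center K (QuantumWeyl K q)) ∈ contract P := by rw [h]; trivial
    exact h1
  · refine hP.mem_or_mem fun c ↦ ?_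
    rw [← commute_of_mem_center z.2, mul_assoc]
    exact P.mul_mem_left _ _ hzw

theorem eq_extend_contract (hn : 2 ≤ n) (hq : IsPrimitiveRoot q n)
    {P : TwoSidedIdeal (QuantumWeyl K q)} (hP : P.IsPrimeIdeal) (hs : s q n ∉ P) :
    P = extend (contract P) :=
  le_antisymm (mem_extend_of_mem hn hq (isPrime_contract hP) hs le_rfl) (extend_contract_le P)

end QuantumWeyl

/-! ### Prime ideals of a polynomial algebra in two variables -/

theorem Polynomial.eq_bot_or_eq_span_of_isPrime {K : Type*} [Field K] {I : Ideal K[X]}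
    (hI : I.IsPrime) : I = ⊥ ∨ ∃ f : K[X], f.Monic ∧ Irreducible f ∧ I = Ideal.span {f} := by
  refine or_iff_not_imp_left.2 fun h0 ↦ ?_
  obtain ⟨g, hg⟩ := IsPrincipalIdealRing.principal I
  replace hg : I = Ideal.span {g} := hg
  have hg0 : g ≠ 0 := by
    rintro rfl
    exact h0 (by rw [hg, Ideal.span_singleton_eq_bot])
  have hgi : Irreducible g := ((Ideal.span_singleton_prime hg0).1 (hg ▸ hI)).irreducible
  classical
  have hassoc : Associated g (normalize g) := associated_normalize g
  refine ⟨normalize g, monic_normalize hg0, hassoc.irreducible hgi, ?_⟩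
  rw [hg, Ideal.span_singleton_eq_span_singleton]
  exact hassoc

theorem MvPolynomial.height_eq_of_isMaximal {K : Type*} [Field K] (n : ℕ)
    (m : Ideal (MvPolynomial (Fin n) K)) (hm : m.IsMaximal) : m.height = n := by
  induction n with
  | zero =>
    have hF : IsField (MvPolynomial (Fin 0) K) :=
      (MvPolynomial.isEmptyRingEquiv K (Fin 0)).toMulEquiv.isField (Field.toIsField K)
    let := hF.toField
    rw [Ideal.eq_bot_of_prime m, Ideal.height_bot, Nat.cast_zero]
  | succ n ih =>
    let e := (MvPolynomial.finSuccEquiv K n).toRingEquiv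
    have h1 : (m.map e).IsMaximal := Ideal.map_isMaximal_of_equiv e
    have h2 : ((m.map e).comap (Polynomial.C)).IsMaximal :=
      Polynomial.isMaximal_comap_C_of_isJacobsonRing _
    have h3 : (m.map e).LiesOver ((m.map e).comap (Polynomial.C)) := ⟨rfl⟩
    rw [← e.height_map m, Polynomial.height_eq_height_add_one ((m.map e).comap (Polynomial.C)),
      ih _ h2]
    rfl

/-- `u` and `v` are algebraically independent and generate the algebra. -/
def IsPolynomialPair (K : Type*) [Field K] {Z : Type*} [CommRing Z] [Algebra K Z] (u v : Z) :
    Prop :=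
  AlgebraicIndependent K ![u, v] ∧ Algebra.adjoin K {u, v} = ⊤

namespace IsPolynomialPair

variable {K : Type*} [Field K] {Z : Type*} [CommRing Z] [Algebra K Z] {u v : Z}

theorem symm (h : IsPolynomialPair K u v) : IsPolynomialPair K v u := by
  refine ⟨?_, by rw [Set.pair_comm]; exact h.2⟩
  have h1 := h.1.comp (Equiv.swap (0 : Fin 2) 1) (Equiv.injective _)
  convert h1 using 1
  funext i
  fin_cases i <;> simp

/-- The algebra with a polynomial pair of generators as a polynomial algebra. -/
def equiv (h : IsPolynomialPair K u v) : MvPolynomial (Fin 2) K ≃ₐ[K] Z :=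
  AlgEquiv.ofBijective (MvPolynomial.aeval ![u, v])
    ⟨h.1, by
      rw [← AlgHom.range_eq_top, ← Algebra.adjoin_range_eq_range_aeval, ← h.2]
      congr 1
      ext
      simp [eq_comm, or_comm]⟩

theorem exists_algHom (h : IsPolynomialPair K u v) {L : Type*} [CommRing L] [Algebra K L]
    (a b : L) : ∃ φ : Z →ₐ[K] L, φ u = a ∧ φ v = b := by
  have hu : h.equiv (MvPolynomial.X 0) = u :=
    (MvPolynomial.aeval_X ![u, v] 0).trans rfl
  have hv : h.equiv (MvPolynomial.X 1) = v :=
    (MvPolynomial.aeval_X ![u, v] 1).trans rfl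
  refine ⟨(MvPolynomial.aeval ![a, b]).comp h.equiv.symm.toAlgHom, ?_, ?_⟩
  · have : h.equiv.symm u = MvPolynomial.X 0 := h.equiv.symm_apply_eq.2 hu.symm
    simp [this]
  · have : h.equiv.symm v = MvPolynomial.X 1 := h.equiv.symm_apply_eq.2 hv.symm
    simp [this]

theorem isDomain (h : IsPolynomialPair K u v) : IsDomain Z := h.equiv.symm.toMulEquiv.isDomain _

theorem isNoetherianRing (h : IsPolynomialPair K u v) : IsNoetherianRing Z :=
  isNoetherianRing_of_ringEquiv _ h.equiv.toRingEquiv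

theorem ringKrullDim_eq (h : IsPolynomialPair K u v) : ringKrullDim Z = 2 := by
  rw [← ringKrullDim_eq_of_ringEquiv h.equiv.toRingEquiv,
    MvPolynomial.ringKrullDim_of_isNoetherianRing, ringKrullDim_eq_zero_of_field]
  simp

theorem height_eq_two (h : IsPolynomialPair K u v) {m : Ideal Z} (hm : m.IsMaximal) :
    m.height = 2 := by
  let e := h.equiv.symm.toRingEquiv
  rw [← e.height_map m]
  exact MvPolynomial.height_eq_of_isMaximal 2 _ (Ideal.map_isMaximal_of_equiv e)

theorem height_cases (h : IsPolynomialPair K u v) {p : Ideal Z} (hp : p.IsPrime) :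
    p = ⊥ ∨ p.height = 1 ∨ p.IsMaximal := by
  have := h.isDomain
  have := h.isNoetherianRing
  have h1 : (p.height : WithBot ℕ∞) ≤ 2 :=
    h.ringKrullDim_eq ▸ Ideal.height_le_ringKrullDim_of_isPrime
  have h2 : p.height ≤ 2 := WithBot.coe_le_coe.1 h1
  have h3 : p.height = 0 ∨ p.height = 1 ∨ p.height = 2 := by
    generalize p.height = k at h2
    induction k using ENat.recTopCoe with
    | top => simp at h2
    | coe k => norm_cast at h2 ⊢; omega
  rcases h3 with h3 | h3 | h3
  · exact Or.inl (Ideal.height_eq_zero_iff_eq_bot.1 h3)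
  · exact Or.inr (Or.inl h3)
  · refine Or.inr (Or.inr ?_)
    have : FiniteRingKrullDim Z := finiteRingKrullDim_iff_ne_bot_and_top.2
      ⟨by rw [h.ringKrullDim_eq]; decide, by rw [h.ringKrullDim_eq]; decide⟩
    exact Ideal.isMaximal_of_height_eq_ringKrullDim (by rw [h3, h.ringKrullDim_eq]; rfl)

theorem height_lt_height (h : IsPolynomialPair K u v) {p p' : Ideal Z} (hp : p.IsPrime)
    (hp' : p'.IsPrime) (hlt : p < p') : p.height < p'.height := by
  have := h.isNoetherianRing
  exact Ideal.height_strict_mono_of_isPrime_of_isPrime hlt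

/-- If `w` lies in the maximal ideal `m`, then a minimal prime over `w` inside `m` has height
one. -/
theorem exists_height_eq_one_mem (h : IsPolynomialPair K u v) {m : Ideal Z} (hm : m.IsMaximal)
    {w : Z} (hw : w ∈ m) (hw0 : w ≠ 0) :
    ∃ p : Ideal Z, p.IsPrime ∧ p.height = 1 ∧ w ∈ p ∧ p < m := by
  have := h.isDomain
  have := h.isNoetherianRing
  obtain ⟨p, hp, hpm⟩ := Ideal.exists_minimalPrimes_le ((Ideal.span_singleton_le_iff_mem m).2 hw)
  have hpp : p.IsPrime := hp.1.1
  have hwp : w ∈ p := hp.1.2 (Ideal.mem_span_singleton_self w)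
  have h1 : p.height ≤ 1 := Ideal.height_le_one_of_isPrincipal_of_mem_minimalPrimes _ _ hp
  have h2 : p.height = 1 := by
    rcases h.height_cases hpp with h0 | h0 | h0
    · rw [h0, Ideal.mem_bot] at hwp
      exact absurd hwp hw0
    · exact h0
    · rw [h.height_eq_two h0] at h1
      exact absurd h1 (by decide)
  refine ⟨p, hpp, h2, hwp, lt_of_le_of_ne hpm fun heq ↦ ?_⟩
  rw [heq, h.height_eq_two hm] at h2
  exact absurd h2 (by decide)

theorem exists_sub_aeval_mem (h : IsPolynomialPair K u v) (z : Z) :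
    ∃ f : K[X], z - aeval v f ∈ Ideal.span {u} := by
  have hz : z ∈ Algebra.adjoin K {u, v} := by rw [h.2]; trivial
  induction hz using Algebra.adjoin_induction with
  | mem z hz =>
    rcases hz with rfl | rfl
    · exact ⟨0, by simp⟩
    · exact ⟨X, by simp⟩
  | algebraMap c => exact ⟨C c, by simp⟩
  | add z w _ _ hz hw =>
    obtain ⟨f, hf⟩ := hz
    obtain ⟨g, hg⟩ := hw
    exact ⟨f + g, by rw [map_add, add_sub_add_comm]; exact Ideal.add_mem _ hf hg⟩
  | mul z w _ _ hz hw =>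
    obtain ⟨f, hf⟩ := hz
    obtain ⟨g, hg⟩ := hw
    refine ⟨f * g, ?_⟩
    rw [map_mul, show z * w - aeval v f * aeval v g =
      w * (z - aeval v f) + aeval v f * (w - aeval v g) by ring]
    exact Ideal.add_mem _ (Ideal.mul_mem_left _ _ hf) (Ideal.mul_mem_left _ _ hg)

/-- A homomorphism that kills `u` has as its kernel any ideal that contains `u` and has the same
polynomials in `v`. -/
theorem ker_eq (h : IsPolynomialPair K u v) {L : Type*} [CommRing L] [Algebra K L]
    (φ : Z →ₐ[K] L) (hu : φ u = 0) {I : Ideal Z} (huI : u ∈ I)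
    (hI : ∀ f : K[X], aeval v f ∈ I ↔ aeval (φ v) f = 0) : I = RingHom.ker φ := by
  have hle : Ideal.span {u} ≤ RingHom.ker φ := (Ideal.span_singleton_le_iff_mem _).2 hu
  have hle' : Ideal.span {u} ≤ I := (Ideal.span_singleton_le_iff_mem _).2 huI
  ext z
  obtain ⟨f, hf⟩ := h.exists_sub_aeval_mem z
  have h1 : z ∈ I ↔ aeval v f ∈ I := by
    constructor
    · intro hz
      simpa using I.sub_mem hz (hle' hf)
    · intro hz
      simpa using I.add_mem hz (hle' hf)
  have h2 : φ z = aeval (φ v) f := by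
    have := hle hf
    rw [RingHom.mem_ker, map_sub, sub_eq_zero] at this
    rw [this, ← aeval_algHom_apply]
  rw [h1, hI, RingHom.mem_ker, h2]

/-- The ideal `(u)` is the kernel of the evaluation `u = 0`. -/
theorem isPrime_span_singleton (h : IsPolynomialPair K u v) : (Ideal.span {u}).IsPrime := by
  obtain ⟨φ, hu, hv⟩ := h.exists_algHom (0 : K[X]) X
  have hle : Ideal.span {u} ≤ RingHom.ker φ := (Ideal.span_singleton_le_iff_mem _).2 hu
  rw [h.ker_eq φ hu (Ideal.mem_span_singleton_self u) fun f ↦ ⟨fun hf ↦ ?_, fun hf ↦ ?_⟩]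
  · exact RingHom.ker_isPrime φ
  · rw [aeval_algHom_apply]
    exact hle hf
  · rw [hv, aeval_X_left_apply] at hf
    rw [hf, map_zero]
    exact Ideal.zero_mem _

/-- The ideal `(u, f(v))` is the kernel of a surjection onto the field `K[X] / (f)`. -/
theorem isMaximal_span_pair (h : IsPolynomialPair K u v) {f : K[X]} (hf : Irreducible f) :
    (Ideal.span {u, aeval v f}).IsMaximal := by
  have : Fact (Irreducible f) := ⟨hf⟩
  obtain ⟨φ, hu, hv⟩ := h.exists_algHom (0 : AdjoinRoot f) (AdjoinRoot.root f)
  have hroot : ∀ g : K[X], aeval (φ v) g = AdjoinRoot.mk f g := fun g ↦ by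
    rw [hv, AdjoinRoot.aeval_eq]
  have hle : Ideal.span {u, aeval v f} ≤ RingHom.ker φ := by
    refine Ideal.span_le.2 ?_
    rintro _ (rfl | rfl)
    · exact hu
    · change φ _ = 0
      rw [← aeval_algHom_apply, hroot, AdjoinRoot.mk_self]
  rw [h.ker_eq φ hu (Ideal.subset_span (by simp)) fun g ↦ ⟨fun hg ↦ ?_, fun hg ↦ ?_⟩]
  · refine RingHom.ker_isMaximal_of_surjective φ fun a ↦ ?_
    obtain ⟨g, rfl⟩ := AdjoinRoot.mk_surjective a
    exact ⟨aeval v g, by rw [← aeval_algHom_apply, hroot]⟩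
  · rw [aeval_algHom_apply]
    exact hle hg
  · rw [hroot, AdjoinRoot.mk_eq_zero] at hg
    obtain ⟨g, rfl⟩ := hg
    rw [map_mul]
    exact Ideal.mul_mem_right _ _ (Ideal.subset_span (by simp))

theorem eq_span_of_mem (h : IsPolynomialPair K u v) {p : Ideal Z} (hp : p.IsPrime) (hu : u ∈ p) :
    p = Ideal.span {u} ∨
      ∃ f : K[X], f.Monic ∧ Irreducible f ∧ p = Ideal.span {u, aeval v f} := by
  have hle : Ideal.span {u} ≤ p := (Ideal.span_singleton_le_iff_mem _).2 hu
  rcases Polynomial.eq_bot_or_eq_span_of_isPrime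
    (hp.comap (aeval v : K[X] →ₐ[K] Z)) with h0 | ⟨f, hf, hfi, hpf⟩
  · refine Or.inl (le_antisymm (fun z hz ↦ ?_) hle)
    obtain ⟨g, hg⟩ := h.exists_sub_aeval_mem z
    have h1 : g ∈ p.comap (aeval v : K[X] →ₐ[K] Z) := by
      simpa using p.sub_mem hz (hle hg)
    rw [h0, Ideal.mem_bot] at h1
    simpa [h1] using hg
  · refine Or.inr ⟨f, hf, hfi, ?_⟩
    have h1 : f ∈ p.comap (aeval v : K[X] →ₐ[K] Z) := by
      rw [hpf]
      exact Ideal.mem_span_singleton_self f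
    refine ((h.isMaximal_span_pair hfi).eq_of_le hp.ne_top (Ideal.span_le.2 ?_)).symm
    rintro _ (rfl | rfl)
    exacts [hu, h1]

theorem height_span_singleton (h : IsPolynomialPair K u v) : (Ideal.span {u}).height = 1 := by
  have hX : (X - C 1 : K[X]) ≠ 0 := X_sub_C_ne_zero 1
  rcases h.height_cases h.isPrime_span_singleton with h0 | h0 | h0
  · exact absurd (Ideal.span_singleton_eq_bot.1 h0)
      (by have := h.isDomain; simpa using h.1.ne_zero 0)
  · exact h0
  · have h1 := h.isMaximal_span_pair (irreducible_X_sub_C (0 : K))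
    have h2 := h.isMaximal_span_pair (irreducible_X_sub_C (1 : K))
    rw [← h0.eq_of_le h1.ne_top (Ideal.span_mono (by simp))] at h1
    have h3 : aeval v (X - C 0 : K[X]) ∈ Ideal.span {u} := by
      rw [h0.eq_of_le (h.isMaximal_span_pair (irreducible_X_sub_C (0 : K))).ne_top
        (Ideal.span_mono (by simp))]
      exact Ideal.subset_span (by simp)
    have h4 : aeval v (X - C 1 : K[X]) ∈ Ideal.span {u} := by
      rw [h0.eq_of_le h2.ne_top (Ideal.span_mono (by simp))]
      exact Ideal.subset_span (by simp)
    refine absurd ((Ideal.eq_top_iff_one _).2 ?_) h0.ne_top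
    simpa using Ideal.sub_mem _ h3 h4

/-- A prime ideal of height one that contains another nonzero prime ideal is equal to it. -/
theorem eq_of_le_of_height_eq_one (h : IsPolynomialPair K u v) {p p' : Ideal Z} (hp : p.IsPrime)
    (h0 : p ≠ ⊥) (hp' : p'.IsPrime) (h1 : p'.height = 1) (hle : p ≤ p') : p = p' := by
  have := h.isDomain
  by_contra hne
  have h2 := h.height_lt_height hp hp' (lt_of_le_of_ne hle hne)
  rw [h1, Order.lt_one_iff] at h2
  exact h0 (Ideal.height_eq_zero_iff_eq_bot.1 h2)

theorem eq_span_singleton_of_height_eq_one (h : IsPolynomialPair K u v) {p : Ideal Z}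
    (hp : p.IsPrime) (h1 : p.height = 1) (hu : u ∈ p) : p = Ideal.span {u} :=
  (h.eq_of_le_of_height_eq_one h.isPrime_span_singleton
    (by rw [Ne, Ideal.span_singleton_eq_bot]; have := h.isDomain; simpa using h.1.ne_zero 0)
    hp h1 ((Ideal.span_singleton_le_iff_mem _).2 hu)).symm

/-- Modulo `ε u v + d` with `ε, d ≠ 0` the generator `v` becomes a unit with inverse a multiple
of `u`, and the factor ring embeds into the field of rational functions in `v`. -/
theorem isPrime_span_mul_add (h : IsPolynomialPair K u v) {ε d : K} (hε : ε ≠ 0) (hd : d ≠ 0) :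
    (Ideal.span {ε • (u * v) + algebraMap K Z d}).IsPrime := by
  set w := ε • (u * v) + algebraMap K Z d with hw
  let β : RatFunc K := algebraMap K[X] (RatFunc K) X
  have hβ : β ≠ 0 := RatFunc.X_ne_zero
  obtain ⟨φ, hu, hv⟩ := h.exists_algHom (algebraMap K (RatFunc K) (-d / ε) / β) β
  have hφw : φ w = 0 := by
    rw [hw, map_add, map_smul, map_mul, hu, hv, div_mul_cancel₀ _ hβ, AlgHom.commutes,
      Algebra.smul_def, ← map_mul, ← map_add, mul_div_cancel₀ _ hε, neg_add_cancel, map_zero]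
  have hle : Ideal.span {w} ≤ RingHom.ker φ := (Ideal.span_singleton_le_iff_mem _).2 hφw
  -- in the factor ring `u v` is the nonzero constant `-d / ε`
  have huv : u * v - algebraMap K Z (-d / ε) ∈ Ideal.span {w} := by
    refine Ideal.mem_span_singleton.2 ⟨algebraMap K Z ε⁻¹, ?_⟩
    rw [hw, add_mul, Algebra.smul_def, mul_right_comm, ← map_mul, ← map_mul, mul_inv_cancel₀ hε,
      map_one, one_mul, neg_div, map_neg, sub_neg_eq_add, div_eq_mul_inv]
  have huvN : ∀ N, (u * v) ^ N - algebraMap K Z ((-d / ε) ^ N) ∈ Ideal.span {w} := fun N ↦ by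
    rw [map_pow]
    exact Ideal.mem_of_dvd _ (sub_dvd_pow_sub_pow _ _ N) huv
  have hred : ∀ z, ∃ (N : ℕ) (f : K[X]), v ^ N * z - aeval v f ∈ Ideal.span {w} := by
    intro z
    have hz : z ∈ Algebra.adjoin K {u, v} := by rw [h.2]; trivial
    induction hz using Algebra.adjoin_induction with
    | mem z hz =>
      rcases hz with rfl | rfl
      · exact ⟨1, C (-d / ε), by rw [pow_one, mul_comm, aeval_C]; exact huv⟩
      · exact ⟨0, X, by simp⟩
    | algebraMap c => exact ⟨0, C c, by simp⟩
    | add z z' _ _ hz hz' =>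
      obtain ⟨N, f, hf⟩ := hz
      obtain ⟨N', g, hg⟩ := hz'
      refine ⟨N + N', X ^ N' * f + X ^ N * g, ?_⟩
      have h1 : v ^ (N + N') * (z + z') - aeval v (X ^ N' * f + X ^ N * g) =
          v ^ N' * (v ^ N * z - aeval v f) + v ^ N * (v ^ N' * z' - aeval v g) := by
        simp only [map_add, map_mul, map_pow, aeval_X]
        ring
      rw [h1]
      exact Ideal.add_mem _ (Ideal.mul_mem_left _ _ hf) (Ideal.mul_mem_left _ _ hg)
    | mul z z' _ _ hz hz' =>
      obtain ⟨N, f, hf⟩ := hz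
      obtain ⟨N', g, hg⟩ := hz'
      refine ⟨N + N', f * g, ?_⟩
      have h1 : v ^ (N + N') * (z * z') - aeval v (f * g) =
          v ^ N' * z' * (v ^ N * z - aeval v f) + aeval v f * (v ^ N' * z' - aeval v g) := by
        rw [map_mul]
        ring
      rw [h1]
      exact Ideal.add_mem _ (Ideal.mul_mem_left _ _ hf) (Ideal.mul_mem_left _ _ hg)
  suffices Ideal.span {w} = RingHom.ker φ by rw [this]; exact RingHom.ker_isPrime φ
  refine le_antisymm hle fun z hz ↦ ?_
  obtain ⟨N, f, hf⟩ := hred z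
  have hf0 : f = 0 := by
    have h1 := hle hf
    rw [RingHom.mem_ker, map_sub, map_mul, RingHom.mem_ker.1 hz, mul_zero, zero_sub, neg_eq_zero,
      ← aeval_algHom_apply, hv, aeval_algebraMap_apply, aeval_X_left_apply] at h1
    exact (map_eq_zero_iff _ (RatFunc.algebraMap_injective K)).1 h1
  rw [hf0, map_zero, sub_zero] at hf
  have h1 : algebraMap K Z ((-d / ε) ^ N) * z ∈ Ideal.span {w} := by
    have h2 := Ideal.sub_mem _ (Ideal.mul_mem_left _ (u ^ N) hf) (Ideal.mul_mem_left _ z (huvN N))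
    rwa [show u ^ N * (v ^ N * z) - z * ((u * v) ^ N - algebraMap K Z ((-d / ε) ^ N)) =
      algebraMap K Z ((-d / ε) ^ N) * z by ring] at h2
  have h3 : (-d / ε) ^ N ≠ 0 := pow_ne_zero _ (div_ne_zero (neg_ne_zero.2 hd) hε)
  have h4 := Ideal.mul_mem_left _ (algebraMap K Z ((-d / ε) ^ N)⁻¹) h1
  rwa [← mul_assoc, ← map_mul, inv_mul_cancel₀ h3, map_one, one_mul] at h4

end IsPolynomialPair

namespace QuantumWeyl

variable {K : Type*} [Field K] {q : K} {n : ℕ}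

/-! ### Primes that contain `h` -/

theorem ideal₁_le_iff {P : TwoSidedIdeal (QuantumWeyl K q)} {a : QuantumWeyl K q} :
    ideal₁ a ≤ P ↔ a ∈ P :=
  TwoSidedIdeal.span_le.trans Set.singleton_subset_iff

theorem ideal₂_le_iff {P : TwoSidedIdeal (QuantumWeyl K q)} {a b : QuantumWeyl K q} :
    ideal₂ a b ≤ P ↔ a ∈ P ∧ b ∈ P :=
  TwoSidedIdeal.span_le.trans Set.pair_subset_iff

theorem mem_ideal₁_self (a : QuantumWeyl K q) : a ∈ ideal₁ a := ideal₁_le_iff.1 le_rfl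

theorem left_mem_ideal₂ (a b : QuantumWeyl K q) : a ∈ ideal₂ a b := (ideal₂_le_iff.1 le_rfl).1

theorem right_mem_ideal₂ (a b : QuantumWeyl K q) : b ∈ ideal₂ a b := (ideal₂_le_iff.1 le_rfl).2

theorem ideal₂_comm (a b : QuantumWeyl K q) : ideal₂ a b = ideal₂ b a := by
  rw [ideal₂, ideal₂, Set.pair_comm]

theorem x_mul_y_eq (hn : 2 ≤ n) (hq : IsPrimitiveRoot q n) :
    x q * y q = q • h q - algebraMap K _ (1 / (q - 1)) := by
  have h1 : q - 1 ≠ 0 := sub_ne_zero.2 (hq.ne_one (by omega))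
  have h2 : q * (1 / (q - 1)) = (1 / (q - 1) : K) + 1 := by field_simp; ring
  rw [x_mul_y, h, smul_add, Algebra.smul_def q (algebraMap K _ _), ← map_mul, h2, map_add, map_one]
  abel

theorem pow_mul_pow_sub_mem {J : TwoSidedIdeal (QuantumWeyl K q)} {a b : QuantumWeyl K q} {c : K}
    (hab : a * b - algebraMap K _ c ∈ J) (i : ℕ) :
    a ^ i * b ^ i - algebraMap K _ (c ^ i) ∈ J := by
  induction i with
  | zero => simp
  | succ i ih =>
    have h1 : a ^ (i + 1) * b ^ (i + 1) - algebraMap K _ (c ^ (i + 1)) =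
        a ^ i * (a * b - algebraMap K _ c) * b ^ i +
          c • (a ^ i * b ^ i - algebraMap K _ (c ^ i)) := by
      rw [mul_sub, sub_mul, ← Algebra.commutes c (a ^ i), mul_assoc (algebraMap K _ c),
        ← Algebra.smul_def, smul_sub, Algebra.smul_def c (algebraMap K _ _), ← map_mul, ← pow_succ',
        sub_add_sub_cancel, pow_succ a, pow_succ' b]
      simp only [mul_assoc]
    rw [h1]
    exact J.add_mem (J.mul_mem_right _ _ (J.mul_mem_left _ _ hab)) (J.algebraMap_smul_mem _ ih)

/-- Modulo `h` the generators `x` and `y` are inverse to each other up to a scalar. -/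
theorem x_pow_mul_y_pow_sub_mem (hn : 2 ≤ n) (hq : IsPrimitiveRoot q n) (i : ℕ) :
    x q ^ i * y q ^ i - algebraMap K _ ((-(1 / (q - 1))) ^ i) ∈ ideal₁ (h q) := by
  refine pow_mul_pow_sub_mem ?_ i
  rw [x_mul_y_eq hn hq, map_neg, sub_neg_eq_add, sub_add_cancel]
  exact TwoSidedIdeal.algebraMap_smul_mem _ _ (mem_ideal₁_self _)

theorem y_pow_mul_x_pow_sub_mem (i : ℕ) :
    y q ^ i * x q ^ i - algebraMap K _ ((-(1 / (q - 1))) ^ i) ∈ ideal₁ (h q) := by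
  refine pow_mul_pow_sub_mem ?_ i
  rw [map_neg, sub_neg_eq_add, ← h]
  exact mem_ideal₁_self _

/-- Modulo `h` every element is a polynomial in `x` up to a power of `x`. -/
theorem exists_x_pow_mul_sub_mem (hn : 2 ≤ n) (hq : IsPrimitiveRoot q n) (a : QuantumWeyl K q) :
    ∃ (N : ℕ) (f : K[X]), x q ^ N * a - aeval (x q) f ∈ ideal₁ (h q) := by
  induction (pbw q).mem_span a using Submodule.span_induction with
  | mem a ha =>
    obtain ⟨⟨i, j⟩, rfl⟩ := ha
    refine ⟨i, C ((-(1 / (q - 1))) ^ i) * X ^ j, ?_⟩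
    rw [pbw_apply, map_mul, aeval_C, map_pow (aeval (x q)), aeval_X, ← mul_assoc, ← sub_mul]
    exact TwoSidedIdeal.mul_mem_right _ _ _ (x_pow_mul_y_pow_sub_mem hn hq i)
  | zero => exact ⟨0, 0, by simp⟩
  | add u v _ _ hu hv =>
    obtain ⟨N, f, hf⟩ := hu
    obtain ⟨M, g, hg⟩ := hv
    refine ⟨M + N, X ^ M * f + X ^ N * g, ?_⟩
    have h1 : x q ^ (M + N) * (u + v) - aeval (x q) (X ^ M * f + X ^ N * g) =
        x q ^ M * (x q ^ N * u - aeval (x q) f) + x q ^ N * (x q ^ M * v - aeval (x q) g) := by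
      simp only [map_add, map_mul, map_pow, aeval_X, mul_sub, mul_add]
      rw [← mul_assoc, ← mul_assoc, ← pow_add, ← pow_add, add_comm N M]
      abel
    rw [h1]
    exact TwoSidedIdeal.add_mem _ (TwoSidedIdeal.mul_mem_left _ _ _ hf)
      (TwoSidedIdeal.mul_mem_left _ _ _ hg)
  | smul c u _ hu =>
    obtain ⟨N, f, hf⟩ := hu
    refine ⟨N, c • f, ?_⟩
    rw [mul_smul_comm, map_smul, ← smul_sub]
    exact TwoSidedIdeal.algebraMap_smul_mem _ _ hf

theorem mem_of_x_pow_mul_mem (hn : 2 ≤ n) (hq : IsPrimitiveRoot q n)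
    {J : TwoSidedIdeal (QuantumWeyl K q)} (hJ : h q ∈ J) {N : ℕ} {a : QuantumWeyl K q}
    (ha : x q ^ N * a ∈ J) : a ∈ J := by
  have hc : (-(1 / (q - 1))) ^ N ≠ 0 :=
    pow_ne_zero _ (neg_ne_zero.2 (one_div_ne_zero (sub_ne_zero.2 (hq.ne_one (by omega)))))
  have h1 := J.sub_mem (J.mul_mem_left (y q ^ N) _ ha)
    (J.mul_mem_right _ a (ideal₁_le_iff.2 hJ (y_pow_mul_x_pow_sub_mem N)))
  rwa [sub_mul, ← mul_assoc, sub_sub_cancel, ← Algebra.smul_def,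
    J.smul_mem_iff_of_ne_zero hc] at h1

/-- The homomorphism to a field that kills `h` and sends `x` to a given nonzero element. -/
def pointHom (hn : 2 ≤ n) (hq : IsPrimitiveRoot q n) {L : Type*} [Field L] [Algebra K L] {α : L}
    (hα : α ≠ 0) : QuantumWeyl K q →ₐ[K] L :=
  lift α (algebraMap K L (-(1 / (q - 1))) / α) (by
    have h1 : q - 1 ≠ 0 := sub_ne_zero.2 (hq.ne_one (by omega))
    have h2 : -(1 / (q - 1)) = q * (-(1 / (q - 1))) + 1 := by field_simp; ring
    rw [mul_div_cancel₀ _ hα, div_mul_cancel₀ _ hα, Algebra.smul_def, ← map_mul,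
      ← map_one (algebraMap K L), ← map_add, ← h2])

section pointHom

variable (hn : 2 ≤ n) (hq : IsPrimitiveRoot q n) {L : Type*} [Field L] [Algebra K L] {α : L}
  (hα : α ≠ 0)

theorem pointHom_x : pointHom hn hq hα (x q) = α := lift_x _ _ _

theorem pointHom_h : pointHom hn hq hα (h q) = 0 := by
  rw [h, map_add, map_mul, pointHom_x, pointHom, lift_y, AlgHom.commutes, div_mul_cancel₀ _ hα,
    ← map_add, neg_add_cancel, map_zero]

theorem pointHom_aeval (f : K[X]) : pointHom hn hq hα (aeval (x q) f) = aeval α f := by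
  rw [← aeval_algHom_apply, pointHom_x]

/-- The kernel of a homomorphism that kills `h` is determined by the polynomials in `x` that it
contains. -/
theorem ker_pointHom_le {J : TwoSidedIdeal (QuantumWeyl K q)} (hJ : h q ∈ J)
    (hf : ∀ f : K[X], aeval α f = 0 → aeval (x q) f ∈ J) :
    TwoSidedIdeal.ker (pointHom hn hq hα) ≤ J := by
  intro a ha
  obtain ⟨N, f, hNf⟩ := exists_x_pow_mul_sub_mem hn hq a
  have h1 : aeval α f = 0 := by
    have h2 : ideal₁ (h q) ≤ TwoSidedIdeal.ker (pointHom hn hq hα) :=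
      ideal₁_le_iff.2 ((TwoSidedIdeal.mem_ker _).2 (pointHom_h hn hq hα))
    have h3 := (TwoSidedIdeal.mem_ker _).1 (h2 hNf)
    rwa [map_sub, map_mul, (TwoSidedIdeal.mem_ker _).1 ha, mul_zero, zero_sub, neg_eq_zero,
      pointHom_aeval] at h3
  refine mem_of_x_pow_mul_mem hn hq hJ (N := N) ?_
  simpa using J.add_mem (ideal₁_le_iff.2 hJ hNf) (hf f h1)

end pointHom

/-- The ideal `(h)` is the kernel at the generic point `x = X` of the curve `h = 0`. -/
theorem ker_pointHom_X (hn : 2 ≤ n) (hq : IsPrimitiveRoot q n) :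
    TwoSidedIdeal.ker (pointHom hn hq (RatFunc.X_ne_zero (K := K))) = ideal₁ (h q) := by
  refine le_antisymm (ker_pointHom_le hn hq _ (mem_ideal₁_self _) fun f hf ↦ ?_)
    (ideal₁_le_iff.2 ((TwoSidedIdeal.mem_ker _).2 (pointHom_h hn hq _)))
  rw [← RatFunc.algebraMap_X, aeval_algebraMap_apply, aeval_X_left_apply] at hf
  rw [(map_eq_zero_iff _ (RatFunc.algebraMap_injective K)).1 hf, map_zero]
  exact TwoSidedIdeal.zero_mem _

theorem isPrimeIdeal_h (hn : 2 ≤ n) (hq : IsPrimitiveRoot q n) :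
    (ideal₁ (h q)).IsPrimeIdeal := by
  rw [← ker_pointHom_X hn hq]
  exact TwoSidedIdeal.isPrimeIdeal_ker (pointHom hn hq RatFunc.X_ne_zero).toRingHom

theorem aeval_x_mem_ideal₁_h_iff (hn : 2 ≤ n) (hq : IsPrimitiveRoot q n) {f : K[X]} :
    aeval (x q) f ∈ ideal₁ (h q) ↔ f = 0 := by
  rw [← ker_pointHom_X hn hq, TwoSidedIdeal.mem_ker, pointHom_aeval, ← RatFunc.algebraMap_X,
    aeval_algebraMap_apply, aeval_X_left_apply, map_eq_zero_iff _ (RatFunc.algebraMap_injective K)]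

theorem root_ne_zero {f : K[X]} (hf : f ∈ irrM K) [Fact (Irreducible f)] :
    AdjoinRoot.root f ≠ 0 := by
  intro h0
  rw [← AdjoinRoot.mk_X, AdjoinRoot.mk_eq_zero] at h0
  obtain ⟨hm, hi, hX⟩ := hf
  exact hX (eq_of_monic_of_associated hm monic_X
    (hi.associated_of_dvd irreducible_X h0))

theorem ker_pointHom_root (hn : 2 ≤ n) (hq : IsPrimitiveRoot q n) {f : K[X]} (hf : f ∈ irrM K)
    [Fact (Irreducible f)] : TwoSidedIdeal.ker (pointHom hn hq (root_ne_zero hf)) =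
      ideal₂ (h q) (aeval (x q) f) := by
  refine le_antisymm (ker_pointHom_le hn hq _ (left_mem_ideal₂ _ _) fun g hg ↦ ?_)
    (ideal₂_le_iff.2 ⟨(TwoSidedIdeal.mem_ker _).2 (pointHom_h hn hq _),
      (TwoSidedIdeal.mem_ker _).2 ?_⟩)
  · rw [AdjoinRoot.aeval_eq, AdjoinRoot.mk_eq_zero] at hg
    obtain ⟨g, rfl⟩ := hg
    rw [map_mul]
    exact TwoSidedIdeal.mul_mem_right _ _ _ (right_mem_ideal₂ _ _)
  · rw [pointHom_aeval, AdjoinRoot.aeval_eq, AdjoinRoot.mk_self]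

theorem isPrimeIdeal_of_mem_setH (hn : 2 ≤ n) (hq : IsPrimitiveRoot q n)
    {P : TwoSidedIdeal (QuantumWeyl K q)} (hP : P ∈ setH q) : P.IsPrimeIdeal := by
  obtain ⟨f, hf, rfl⟩ := hP
  have : Fact (Irreducible f) := ⟨hf.2.1⟩
  rw [← ker_pointHom_root hn hq hf]
  exact TwoSidedIdeal.isPrimeIdeal_ker (pointHom hn hq (root_ne_zero hf)).toRingHom

theorem aeval_x_mem_ideal₂_h_iff (hn : 2 ≤ n) (hq : IsPrimitiveRoot q n) {f : K[X]}
    (hf : f ∈ irrM K) {g : K[X]} : aeval (x q) g ∈ ideal₂ (h q) (aeval (x q) f) ↔ f ∣ g := by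
  have : Fact (Irreducible f) := ⟨hf.2.1⟩
  rw [← ker_pointHom_root hn hq hf, TwoSidedIdeal.mem_ker, pointHom_aeval, AdjoinRoot.aeval_eq,
    AdjoinRoot.mk_eq_zero]

/-- The factor algebra by `h` is the algebra of Laurent polynomials in `x`. -/
theorem eq_ideal_of_h_mem (hn : 2 ≤ n) (hq : IsPrimitiveRoot q n)
    {P : TwoSidedIdeal (QuantumWeyl K q)} (hP : P.IsPrimeIdeal) (hh : h q ∈ P) :
    P = ideal₁ (h q) ∨ P ∈ setH q := by
  -- commutators vanish at the generic point of `h = 0`, so the factor algebra by `P` is commutative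
  have hcomm : ∀ a b, a * b - b * a ∈ P := by
    intro a b
    refine ideal₁_le_iff.2 hh ?_
    rw [← ker_pointHom_X hn hq, TwoSidedIdeal.mem_ker, map_sub, map_mul, map_mul, mul_comm,
      sub_self]
  let I : Ideal K[X] :=
    { carrier := {f | aeval (x q) f ∈ P}
      add_mem' := fun {f g} hf hg ↦ by
        change aeval (x q) (f + g) ∈ P
        rw [map_add]
        exact P.add_mem hf hg
      zero_mem' := by
        change aeval (x q) (0 : K[X]) ∈ P
        rw [map_zero]
        exact P.zero_mem
      smul_mem' := fun f g hg ↦ by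
        change aeval (x q) (f * g) ∈ P
        rw [map_mul]
        exact P.mul_mem_left _ _ hg }
  have hI : ∀ f, f ∈ I ↔ aeval (x q) f ∈ P := fun _ ↦ Iff.rfl
  have hIp : I.IsPrime := by
    refine ⟨fun h0 ↦ hP.one_notMem ?_, fun {f g} hfg ↦ hP.mem_or_mem fun c ↦ ?_⟩
    · have h1 : (1 : K[X]) ∈ I := by rw [h0]; trivial
      rwa [hI, map_one] at h1
    · rw [hI, map_mul] at hfg
      have h1 := P.add_mem (P.mul_mem_right _ (aeval (x q) g) (hcomm (aeval (x q) f) c))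
        (P.mul_mem_left c _ hfg)
      rwa [sub_mul, mul_assoc c, sub_add_cancel] at h1
  rcases Polynomial.eq_bot_or_eq_span_of_isPrime hIp with h0 | ⟨f, hf, hfi, hIf⟩
  · refine Or.inl (le_antisymm (fun a ha ↦ ?_) (ideal₁_le_iff.2 hh))
    obtain ⟨N, g, hg⟩ := exists_x_pow_mul_sub_mem hn hq a
    have h1 : g ∈ I := by
      have := P.sub_mem (P.mul_mem_left (x q ^ N) _ ha) (ideal₁_le_iff.2 hh hg)
      rwa [sub_sub_cancel] at this
    rw [h0, Ideal.mem_bot] at h1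
    rw [h1, map_zero, sub_zero] at hg
    exact mem_of_x_pow_mul_mem hn hq (mem_ideal₁_self _) hg
  · have hfX : f ≠ X := by
      rintro rfl
      have h1 : X ∈ I := by rw [hIf]; exact Ideal.mem_span_singleton_self _
      rw [hI, aeval_X] at h1
      refine hP.one_notMem (mem_of_x_pow_mul_mem hn hq hh (N := 1) ?_)
      simpa using h1
    have hfP : aeval (x q) f ∈ P := by
      rw [← hI, hIf]
      exact Ideal.mem_span_singleton_self f
    refine Or.inr ⟨f, ⟨hf, hfi, hfX⟩, le_antisymm (fun a ha ↦ ?_) (ideal₂_le_iff.2 ⟨hh, hfP⟩)⟩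
    obtain ⟨N, g, hg⟩ := exists_x_pow_mul_sub_mem hn hq a
    have h1 : g ∈ I := by
      have := P.sub_mem (P.mul_mem_left (x q ^ N) _ ha) (ideal₁_le_iff.2 hh hg)
      rwa [sub_sub_cancel] at this
    rw [hIf, Ideal.mem_span_singleton] at h1
    have h2 := TwoSidedIdeal.add_mem _ (ideal₁_le_iff.2 (left_mem_ideal₂ (h q) (aeval (x q) f)) hg)
      ((aeval_x_mem_ideal₂_h_iff hn hq ⟨hf, hfi, hfX⟩).2 h1)
    rw [sub_add_cancel] at h2
    exact mem_of_x_pow_mul_mem hn hq (left_mem_ideal₂ _ _) h2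

/-- A prime that contains the power `s` of the normal element `h` contains `h`. -/
theorem s_mem_iff_h_mem (hn : 2 ≤ n) (hq : IsPrimitiveRoot q n)
    {P : TwoSidedIdeal (QuantumWeyl K q)} (hP : P.IsPrimeIdeal) : s q n ∈ P ↔ h q ∈ P := by
  constructor
  · intro hs
    have hpow : ∀ k, h q ^ k ∈ P → h q ∈ P := by
      intro k
      induction k with
      | zero => exact fun h1 ↦ absurd (by simpa using h1) hP.one_notMem
      | succ k ih =>
        intro hk
        refine (hP.mem_or_mem (a := h q ^ k) (b := h q) fun c ↦ ?_).elim ih id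
        obtain ⟨b, hb, rfl⟩ := exists_sum_grade hn c
        rw [mul_assoc, Finset.sum_mul, Finset.mul_sum]
        refine P.finsetSum_mem _ _ fun i _ ↦ ?_
        have h1 : h q ^ k * (b i * h q) = (q ^ i)⁻¹ • (h q ^ (k + 1) * b i) := by
          have hq0 : q ^ i ≠ 0 := pow_ne_zero _ (hq.ne_zero (by omega))
          rw [pow_succ, mul_assoc, h_mul_of_mem_grade hn hq (hb i), mul_smul_comm, smul_smul,
            inv_mul_cancel₀ hq0, one_smul]
        rw [h1]
        exact P.algebraMap_smul_mem _ (P.mul_mem_right _ _ hk)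
    exact hpow n hs
  · intro hh
    obtain ⟨k, rfl⟩ : ∃ k, n = k + 1 := ⟨n - 1, by omega⟩
    rw [s, pow_succ]
    exact P.mul_mem_left _ _ hh

end QuantumWeyl

/-! ### Primes above `r` or `t` -/

namespace IsPolynomialPair

variable {K : Type*} [Field K] {Z : Type*} [CommRing Z] [Algebra K Z] {u v : Z}

theorem notMem_span_pair (h : IsPolynomialPair K u v) {f : K[X]}
    (hf : f ∈ QuantumWeyl.irrM K) : v ∉ Ideal.span {u, aeval v f} := by
  obtain ⟨hm, hi, hX⟩ := hf
  intro hv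
  have hcop : IsCoprime X f := irreducible_X.coprime_iff_not_dvd.2 fun hdvd ↦
    hX (eq_of_monic_of_associated hm monic_X (irreducible_X.associated_of_dvd hi hdvd).symm)
  obtain ⟨a, b, hab⟩ := hcop
  have h1 := congrArg (aeval v) hab
  rw [map_add, map_mul, map_mul, aeval_X, map_one] at h1
  refine (h.isMaximal_span_pair hi).ne_top ((Ideal.eq_top_iff_one _).2 ?_)
  rw [← h1]
  exact Ideal.add_mem _ (Ideal.mul_mem_left _ _ hv)
    (Ideal.mul_mem_left _ _ (Ideal.subset_span (by simp)))

end IsPolynomialPair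

namespace QuantumWeyl

variable {K : Type*} [Field K] {q : K} {n : ℕ}

theorem isPolynomialPair (hn : 2 ≤ n) (hq : IsPrimitiveRoot q n) :
    IsPolynomialPair K (rZ hn hq) (tZ hn hq) :=
  ⟨algebraicIndependent_rZ_tZ hn hq, adjoin_rZ_tZ hn hq⟩

theorem sZ_notMem_of_mul_mem (hn : 2 ≤ n) (hq : IsPrimitiveRoot q n)
    {p : Ideal (Subalgebra.center K (QuantumWeyl K q))} (hp : p.IsPrime)
    (h : rZ hn hq * tZ hn hq ∈ p) : sZ hn hq ∉ p := by
  intro hs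
  obtain ⟨ε, d, -, hd, hsd⟩ := exists_sZ_eq hn hq
  have h1 : algebraMap K (Subalgebra.center K (QuantumWeyl K q)) d ∈ p := by
    have h2 := p.sub_mem hs (p.smul_of_tower_mem ε h)
    rwa [hsd, add_sub_cancel_left] at h2
  refine hp.ne_top (p.eq_top_of_isUnit_mem h1 ((isUnit_iff_ne_zero.2 hd).map _))

theorem sZ_notMem_of_rZ_mem (hn : 2 ≤ n) (hq : IsPrimitiveRoot q n)
    {p : Ideal (Subalgebra.center K (QuantumWeyl K q))} (hp : p.IsPrime) (h : rZ hn hq ∈ p) :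
    sZ hn hq ∉ p := sZ_notMem_of_mul_mem hn hq hp (p.mul_mem_right _ h)

theorem sZ_notMem_of_tZ_mem (hn : 2 ≤ n) (hq : IsPrimitiveRoot q n)
    {p : Ideal (Subalgebra.center K (QuantumWeyl K q))} (hp : p.IsPrime) (h : tZ hn hq ∈ p) :
    sZ hn hq ∉ p := sZ_notMem_of_mul_mem hn hq hp (p.mul_mem_left _ h)

theorem sZ_ne_zero (hn : 2 ≤ n) (hq : IsPrimitiveRoot q n) : sZ hn hq ≠ 0 := fun h ↦
  sZ_notMem_of_rZ_mem hn hq (isPolynomialPair hn hq).isPrime_span_singleton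
    (Ideal.mem_span_singleton_self _) (h ▸ Ideal.zero_mem _)

theorem isPrime_span_sZ (hn : 2 ≤ n) (hq : IsPrimitiveRoot q n) :
    (Ideal.span {sZ hn hq}).IsPrime := by
  obtain ⟨ε, d, hε, hd, hs⟩ := exists_sZ_eq hn hq
  rw [hs]
  exact (isPolynomialPair hn hq).isPrime_span_mul_add hε hd

theorem coe_aeval (z : Subalgebra.center K (QuantumWeyl K q)) (f : K[X]) :
    ((aeval z f : Subalgebra.center K (QuantumWeyl K q)) : QuantumWeyl K q) =
      aeval (z : QuantumWeyl K q) f :=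
  (aeval_algHom_apply (Subalgebra.center K (QuantumWeyl K q)).val z f).symm

theorem extend_span_singleton (z : Subalgebra.center K (QuantumWeyl K q)) :
    extend (Ideal.span {z}) = ideal₁ (z : QuantumWeyl K q) := by
  rw [extend_span, Set.image_singleton, ideal₁]

theorem extend_span_pair (z w : Subalgebra.center K (QuantumWeyl K q)) :
    extend (Ideal.span {z, w}) = ideal₂ (z : QuantumWeyl K q) w := by
  rw [extend_span, Set.image_pair, ideal₂]

theorem ideal₁_r (hn : 2 ≤ n) (hq : IsPrimitiveRoot q n) :
    ideal₁ (r q n) = extend (Ideal.span {rZ hn hq}) := (extend_span_singleton (rZ hn hq)).symm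

theorem ideal₁_t (hn : 2 ≤ n) (hq : IsPrimitiveRoot q n) :
    ideal₁ (t q n) = extend (Ideal.span {tZ hn hq}) := (extend_span_singleton (tZ hn hq)).symm

theorem ideal₂_r (hn : 2 ≤ n) (hq : IsPrimitiveRoot q n) (f : K[X]) :
    ideal₂ (r q n) (aeval (t q n) f) = extend (Ideal.span {rZ hn hq, aeval (tZ hn hq) f}) := by
  rw [extend_span_pair, coe_aeval]
  rfl

theorem ideal₂_t (hn : 2 ≤ n) (hq : IsPrimitiveRoot q n) (f : K[X]) :
    ideal₂ (t q n) (aeval (r q n) f) = extend (Ideal.span {tZ hn hq, aeval (rZ hn hq) f}) := by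
  rw [extend_span_pair, coe_aeval]
  rfl

theorem h_notMem_of_r_mem (hn : 2 ≤ n) (hq : IsPrimitiveRoot q n)
    {P : TwoSidedIdeal (QuantumWeyl K q)} (hP : P.IsPrimeIdeal) (hr : r q n ∈ P) : h q ∉ P :=
  fun hh ↦ sZ_notMem_of_rZ_mem hn hq (isPrime_contract hP) hr ((s_mem_iff_h_mem hn hq hP).2 hh)

theorem h_notMem_of_t_mem (hn : 2 ≤ n) (hq : IsPrimitiveRoot q n)
    {P : TwoSidedIdeal (QuantumWeyl K q)} (hP : P.IsPrimeIdeal) (ht : t q n ∈ P) : h q ∉ P :=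
  fun hh ↦ sZ_notMem_of_tZ_mem hn hq (isPrime_contract hP) ht ((s_mem_iff_h_mem hn hq hP).2 hh)

theorem isPrimeIdeal_of_eq_extend (hn : 2 ≤ n) (hq : IsPrimitiveRoot q n)
    {P : TwoSidedIdeal (QuantumWeyl K q)} {p : Ideal (Subalgebra.center K (QuantumWeyl K q))}
    (hP : P = extend p) (hp : p.IsPrime) (hs : sZ hn hq ∉ p) :
    P.IsPrimeIdeal ∧ contract P = p := by
  subst hP
  exact ⟨isPrimeIdeal_extend hn hq hp hs, contract_extend hn hq p⟩

theorem eq_extend_of_h_notMem (hn : 2 ≤ n) (hq : IsPrimitiveRoot q n)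
    {P : TwoSidedIdeal (QuantumWeyl K q)} (hP : P.IsPrimeIdeal) (hh : h q ∉ P) :
    P = extend (contract P) :=
  eq_extend_contract hn hq hP fun hs ↦ hh ((s_mem_iff_h_mem hn hq hP).1 hs)

theorem ideal₁_r_spec (hn : 2 ≤ n) (hq : IsPrimitiveRoot q n) :
    (ideal₁ (r q n)).IsPrimeIdeal ∧ contract (ideal₁ (r q n)) = Ideal.span {rZ hn hq} :=
  have hp := (isPolynomialPair hn hq).isPrime_span_singleton
  isPrimeIdeal_of_eq_extend hn hq (ideal₁_r hn hq) hp
    (sZ_notMem_of_rZ_mem hn hq hp (Ideal.mem_span_singleton_self _))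

theorem ideal₁_t_spec (hn : 2 ≤ n) (hq : IsPrimitiveRoot q n) :
    (ideal₁ (t q n)).IsPrimeIdeal ∧ contract (ideal₁ (t q n)) = Ideal.span {tZ hn hq} :=
  have hp := (isPolynomialPair hn hq).symm.isPrime_span_singleton
  isPrimeIdeal_of_eq_extend hn hq (ideal₁_t hn hq) hp
    (sZ_notMem_of_tZ_mem hn hq hp (Ideal.mem_span_singleton_self _))

theorem ideal₂_r_spec (hn : 2 ≤ n) (hq : IsPrimitiveRoot q n) {f : K[X]} (hf : Irreducible f) :
    (ideal₂ (r q n) (aeval (t q n) f)).IsPrimeIdeal ∧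
      contract (ideal₂ (r q n) (aeval (t q n) f)) =
        Ideal.span {rZ hn hq, aeval (tZ hn hq) f} :=
  have hp := ((isPolynomialPair hn hq).isMaximal_span_pair hf).isPrime
  isPrimeIdeal_of_eq_extend hn hq (ideal₂_r hn hq f) hp
    (sZ_notMem_of_rZ_mem hn hq hp (Ideal.subset_span (by simp)))

theorem ideal₂_t_spec (hn : 2 ≤ n) (hq : IsPrimitiveRoot q n) {f : K[X]} (hf : Irreducible f) :
    (ideal₂ (t q n) (aeval (r q n) f)).IsPrimeIdeal ∧
      contract (ideal₂ (t q n) (aeval (r q n) f)) =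
        Ideal.span {tZ hn hq, aeval (rZ hn hq) f} :=
  have hp := ((isPolynomialPair hn hq).symm.isMaximal_span_pair hf).isPrime
  isPrimeIdeal_of_eq_extend hn hq (ideal₂_t hn hq f) hp
    (sZ_notMem_of_tZ_mem hn hq hp (Ideal.subset_span (by simp)))

theorem ideal₂_t_r_spec (hn : 2 ≤ n) (hq : IsPrimitiveRoot q n) :
    (ideal₂ (t q n) (r q n)).IsPrimeIdeal ∧ (contract (ideal₂ (t q n) (r q n))).IsMaximal := by
  have h1 := ideal₂_t_spec hn hq (irreducible_X (R := K))
  have h2 := (isPolynomialPair hn hq).symm.isMaximal_span_pair (irreducible_X (R := K))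
  rw [aeval_X] at h1
  exact ⟨h1.1, h1.2 ▸ h2⟩

theorem eq_of_r_mem (hn : 2 ≤ n) (hq : IsPrimitiveRoot q n) {P : TwoSidedIdeal (QuantumWeyl K q)}
    (hP : P.IsPrimeIdeal) (hr : r q n ∈ P) :
    P = ideal₁ (r q n) ∨ P ∈ setR q n ∨ P = ideal₂ (t q n) (r q n) := by
  have h1 := eq_extend_of_h_notMem hn hq hP (h_notMem_of_r_mem hn hq hP hr)
  rcases (isPolynomialPair hn hq).eq_span_of_mem (isPrime_contract hP) hr with
    h2 | ⟨f, hf, hfi, h2⟩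
  · exact Or.inl (by rw [h1, h2, ideal₁_r hn hq])
  · rw [h2, ← ideal₂_r hn hq f] at h1
    by_cases hX : f = X
    · rw [hX, aeval_X, ideal₂_comm] at h1
      exact Or.inr (Or.inr h1)
    · exact Or.inr (Or.inl ⟨f, ⟨hf, hfi, hX⟩, h1⟩)

theorem eq_of_t_mem (hn : 2 ≤ n) (hq : IsPrimitiveRoot q n) {P : TwoSidedIdeal (QuantumWeyl K q)}
    (hP : P.IsPrimeIdeal) (ht : t q n ∈ P) :
    P = ideal₁ (t q n) ∨ P ∈ setT q n ∨ P = ideal₂ (t q n) (r q n) := by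
  have h1 := eq_extend_of_h_notMem hn hq hP (h_notMem_of_t_mem hn hq hP ht)
  rcases (isPolynomialPair hn hq).symm.eq_span_of_mem (isPrime_contract hP) ht with
    h2 | ⟨f, hf, hfi, h2⟩
  · exact Or.inl (by rw [h1, h2, ideal₁_t hn hq])
  · rw [h2, ← ideal₂_t hn hq f] at h1
    by_cases hX : f = X
    · rw [hX, aeval_X] at h1
      exact Or.inr (Or.inr h1)
    · exact Or.inr (Or.inl ⟨f, ⟨hf, hfi, hX⟩, h1⟩)

theorem setR_spec (hn : 2 ≤ n) (hq : IsPrimitiveRoot q n) {P : TwoSidedIdeal (QuantumWeyl K q)}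
    (hP : P ∈ setR q n) :
    P.IsPrimeIdeal ∧ (contract P).IsMaximal ∧ r q n ∈ P ∧ t q n ∉ P := by
  obtain ⟨f, hf, rfl⟩ := hP
  obtain ⟨h1, h2⟩ := ideal₂_r_spec hn hq hf.2.1
  refine ⟨h1, h2 ▸ (isPolynomialPair hn hq).isMaximal_span_pair hf.2.1, left_mem_ideal₂ _ _, ?_⟩
  intro ht
  have h3 : tZ hn hq ∈ contract (ideal₂ (r q n) (aeval (t q n) f)) := ht
  rw [h2] at h3
  exact (isPolynomialPair hn hq).notMem_span_pair hf h3

theorem setT_spec (hn : 2 ≤ n) (hq : IsPrimitiveRoot q n) {P : TwoSidedIdeal (QuantumWeyl K q)}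
    (hP : P ∈ setT q n) :
    P.IsPrimeIdeal ∧ (contract P).IsMaximal ∧ t q n ∈ P ∧ r q n ∉ P := by
  obtain ⟨f, hf, rfl⟩ := hP
  obtain ⟨h1, h2⟩ := ideal₂_t_spec hn hq hf.2.1
  refine ⟨h1, h2 ▸ (isPolynomialPair hn hq).symm.isMaximal_span_pair hf.2.1,
    left_mem_ideal₂ _ _, ?_⟩
  intro ht
  have h3 : rZ hn hq ∈ contract (ideal₂ (t q n) (aeval (r q n) f)) := ht
  rw [h2] at h3
  exact (isPolynomialPair hn hq).symm.notMem_span_pair hf h3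

theorem isDomain_center (hn : 2 ≤ n) (hq : IsPrimitiveRoot q n) :
    IsDomain (Subalgebra.center K (QuantumWeyl K q)) := (isPolynomialPair hn hq).isDomain

theorem rZ_ne_zero (hn : 2 ≤ n) (hq : IsPrimitiveRoot q n) : rZ hn hq ≠ 0 := by
  have := isDomain_center hn hq
  simpa using (algebraicIndependent_rZ_tZ hn hq).ne_zero 0

theorem tZ_ne_zero (hn : 2 ≤ n) (hq : IsPrimitiveRoot q n) : tZ hn hq ≠ 0 := by
  have := isDomain_center hn hq
  simpa using (algebraicIndependent_rZ_tZ hn hq).ne_zero 1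

theorem tZ_notMem_span_rZ (hn : 2 ≤ n) (hq : IsPrimitiveRoot q n) :
    tZ hn hq ∉ Ideal.span {rZ hn hq} := fun h1 ↦
  (isPolynomialPair hn hq).notMem_span_pair (f := X - C 1)
    ⟨monic_X_sub_C 1, irreducible_X_sub_C 1, fun h2 ↦ by
      simpa using congrArg (eval 0) h2⟩ (Ideal.span_mono (by simp) h1)

theorem rZ_notMem_span_tZ (hn : 2 ≤ n) (hq : IsPrimitiveRoot q n) :
    rZ hn hq ∉ Ideal.span {tZ hn hq} := fun h1 ↦
  (isPolynomialPair hn hq).symm.notMem_span_pair (f := X - C 1)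
    ⟨monic_X_sub_C 1, irreducible_X_sub_C 1, fun h2 ↦ by
      simpa using congrArg (eval 0) h2⟩ (Ideal.span_mono (by simp) h1)

theorem t_notMem_ideal₁_r (hn : 2 ≤ n) (hq : IsPrimitiveRoot q n) :
    t q n ∉ ideal₁ (r q n) := fun h1 ↦ tZ_notMem_span_rZ hn hq (by
  rwa [← (ideal₁_r_spec hn hq).2])

theorem r_notMem_ideal₁_t (hn : 2 ≤ n) (hq : IsPrimitiveRoot q n) :
    r q n ∉ ideal₁ (t q n) := fun h1 ↦ rZ_notMem_span_tZ hn hq (by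
  rwa [← (ideal₁_t_spec hn hq).2])

/-! ### Contractions of the primes above `h` -/

theorem t_sub_one_notMem_ideal₁_h (hn : 2 ≤ n) (hq : IsPrimitiveRoot q n) :
    t q n - 1 ∉ ideal₁ (h q) := by
  intro h1
  have h2 : t q n - 1 = aeval (x q) (X ^ n - C 1 : K[X]) := by simp [t]
  rw [h2, aeval_x_mem_ideal₁_h_iff hn hq] at h1
  exact X_pow_sub_C_ne_zero (by omega) _ h1

theorem sZ_mem_contract (hn : 2 ≤ n) (hq : IsPrimitiveRoot q n)
    {P : TwoSidedIdeal (QuantumWeyl K q)} (hP : P.IsPrimeIdeal) (hh : h q ∈ P) :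
    sZ hn hq ∈ contract P := (s_mem_iff_h_mem hn hq hP).2 hh

theorem contract_ne_bot_of_h_mem (hn : 2 ≤ n) (hq : IsPrimitiveRoot q n)
    {P : TwoSidedIdeal (QuantumWeyl K q)} (hP : P.IsPrimeIdeal) (hh : h q ∈ P) :
    contract P ≠ ⊥ := fun h0 ↦ sZ_ne_zero hn hq (by
  have := sZ_mem_contract hn hq hP hh
  rwa [h0, Ideal.mem_bot] at this)

theorem height_contract_ideal₁_h (hn : 2 ≤ n) (hq : IsPrimitiveRoot q n) :
    (contract (ideal₁ (h q))).height = 1 := by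
  have hP := isPrimeIdeal_h hn hq
  rcases (isPolynomialPair hn hq).height_cases (isPrime_contract hP) with h0 | h0 | h0
  · exact absurd h0 (contract_ne_bot_of_h_mem hn hq hP (mem_ideal₁_self _))
  · exact h0
  · -- `t - 1` would be invertible modulo `h`, but it vanishes at the point `x = 1` of `h = 0`
    obtain ⟨w, z, hz, hwz⟩ := h0.exists_inv (x := tZ hn hq - 1)
      (t_sub_one_notMem_ideal₁_h hn hq)
    let φ := pointHom hn hq (one_ne_zero (α := K))
    have h1 : φ z = 0 := by
      have h2 : ideal₁ (h q) ≤ TwoSidedIdeal.ker φ :=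
        ideal₁_le_iff.2 ((TwoSidedIdeal.mem_ker _).2 (pointHom_h hn hq _))
      exact (TwoSidedIdeal.mem_ker _).1 (h2 hz)
    have h3 : φ (t q n - 1) = 0 := by
      rw [map_sub, t, map_pow, map_one, pointHom_x, one_pow, sub_self]
    have h4 : φ (w * (t q n - 1) + z) = 1 := by
      rw [← map_one φ]
      exact congrArg φ (congrArg Subtype.val hwz)
    rw [map_add, map_mul, h1, h3, mul_zero, add_zero] at h4
    exact absurd h4 zero_ne_one

theorem isMaximal_contract_of_mem_setH (hn : 2 ≤ n) (hq : IsPrimitiveRoot q n)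
    {P : TwoSidedIdeal (QuantumWeyl K q)} (hP : P ∈ setH q) : (contract P).IsMaximal := by
  have hPp := isPrimeIdeal_of_mem_setH hn hq hP
  obtain ⟨f, hf, rfl⟩ := hP
  have : Fact (Irreducible f) := ⟨hf.2.1⟩
  rcases (isPolynomialPair hn hq).height_cases (isPrime_contract hPp) with h0 | h0 | h0
  · exact absurd h0 (contract_ne_bot_of_h_mem hn hq hPp (left_mem_ideal₂ _ _))
  · -- the image of `t` is algebraic over the ground field modulo `h` and `f`, but not modulo `h`
    have h1 : contract (ideal₁ (h q)) = contract (ideal₂ (h q) (aeval (x q) f)) :=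
      (isPolynomialPair hn hq).eq_of_le_of_height_eq_one (isPrime_contract (isPrimeIdeal_h hn hq))
        (contract_ne_bot_of_h_mem hn hq (isPrimeIdeal_h hn hq) (mem_ideal₁_self _))
        (isPrime_contract hPp) h0 (contract_mono (ideal₁_le_iff.2 (left_mem_ideal₂ _ _)))
    have halg : IsAlgebraic K (AdjoinRoot.root f ^ n) :=
      (AdjoinRoot.isAlgebraic_root hf.2.1.ne_zero).pow n
    obtain ⟨g, hg0, hg⟩ := halg
    have h2 : ∀ P : TwoSidedIdeal (QuantumWeyl K q),
        aeval (tZ hn hq) g ∈ contract P ↔ aeval (x q) (expand K n g) ∈ P := fun P ↦ by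
      rw [mem_contract, coe_aeval, expand_aeval]
      rfl
    have h3 : aeval (tZ hn hq) g ∈ contract (ideal₂ (h q) (aeval (x q) f)) := by
      rw [h2, aeval_x_mem_ideal₂_h_iff hn hq hf, ← AdjoinRoot.mk_eq_zero, ← AdjoinRoot.aeval_eq,
        expand_aeval, hg]
    rw [← h1, h2, aeval_x_mem_ideal₁_h_iff hn hq, expand_eq_zero (by omega)] at h3
    exact absurd h3 hg0
  · exact h0

/-! ### The classification of the primes -/

theorem notMem_of_height_eq_one (hn : 2 ≤ n) (hq : IsPrimitiveRoot q n)
    {p : Ideal (Subalgebra.center K (QuantumWeyl K q))} (hp : p.IsPrime) (h1 : p.height = 1)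
    (ht : p ≠ Ideal.span {tZ hn hq}) (hr : p ≠ Ideal.span {rZ hn hq})
    (hs : p ≠ Ideal.span {sZ hn hq}) : tZ hn hq ∉ p ∧ rZ hn hq ∉ p ∧ sZ hn hq ∉ p := by
  have hpair := isPolynomialPair hn hq
  refine ⟨fun h ↦ ht (hpair.symm.eq_span_singleton_of_height_eq_one hp h1 h),
    fun h ↦ hr (hpair.eq_span_singleton_of_height_eq_one hp h1 h), fun h ↦ hs ?_⟩
  refine (hpair.eq_of_le_of_height_eq_one (isPrime_span_sZ hn hq) ?_ hp h1
    ((Ideal.span_singleton_le_iff_mem _).2 h)).symm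
  rw [Ne, Ideal.span_singleton_eq_bot]
  exact sZ_ne_zero hn hq

theorem setN_spec (hn : 2 ≤ n) (hq : IsPrimitiveRoot q n) {P : TwoSidedIdeal (QuantumWeyl K q)}
    (hP : P ∈ setN hn hq) : P.IsPrimeIdeal ∧ (contract P).height = 1 ∧
      t q n ∉ P ∧ r q n ∉ P ∧ s q n ∉ P := by
  obtain ⟨p, hp, h1, ht, hr, hs, rfl⟩ := hP
  obtain ⟨h2, h3, h4⟩ := notMem_of_height_eq_one hn hq hp h1 ht hr hs
  refine ⟨isPrimeIdeal_extend hn hq hp h4, by rwa [contract_extend hn hq],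
    fun h ↦ h2 ((coe_mem_extend hn hq).1 h), fun h ↦ h3 ((coe_mem_extend hn hq).1 h),
    fun h ↦ h4 ((coe_mem_extend hn hq).1 h)⟩

theorem setM_spec (hn : 2 ≤ n) (hq : IsPrimitiveRoot q n) {P : TwoSidedIdeal (QuantumWeyl K q)}
    (hP : P ∈ setM hn hq) : P.IsPrimeIdeal ∧ (contract P).IsMaximal ∧
      t q n ∉ P ∧ r q n ∉ P ∧ s q n ∉ P := by
  obtain ⟨p, hp, h2, h3, h4, rfl⟩ := hP
  refine ⟨isPrimeIdeal_extend hn hq hp.isPrime h4, by rwa [contract_extend hn hq],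
    fun h ↦ h2 ((coe_mem_extend hn hq).1 h), fun h ↦ h3 ((coe_mem_extend hn hq).1 h),
    fun h ↦ h4 ((coe_mem_extend hn hq).1 h)⟩

theorem isPrimeIdeal_bot (hn : 2 ≤ n) (hq : IsPrimitiveRoot q n) :
    (⊥ : TwoSidedIdeal (QuantumWeyl K q)).IsPrimeIdeal ∧
      contract (⊥ : TwoSidedIdeal (QuantumWeyl K q)) = ⊥ := by
  have := isDomain_center hn hq
  exact isPrimeIdeal_of_eq_extend hn hq extend_bot.symm Ideal.isPrime_bot (sZ_ne_zero hn hq)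

theorem eq_of_notMem (hn : 2 ≤ n) (hq : IsPrimitiveRoot q n) {P : TwoSidedIdeal (QuantumWeyl K q)}
    (hP : P.IsPrimeIdeal) (ht : t q n ∉ P) (hr : r q n ∉ P) (hs : s q n ∉ P) :
    P = ⊥ ∨ P ∈ setN hn hq ∨ P ∈ setM hn hq := by
  have h1 := eq_extend_contract hn hq hP hs
  have ht' : tZ hn hq ∉ contract P := ht
  have hr' : rZ hn hq ∉ contract P := hr
  have hs' : sZ hn hq ∉ contract P := hs
  have hne : ∀ z, z ∉ contract P → contract P ≠ Ideal.span {z} := fun z hz h2 ↦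
    hz (h2 ▸ Ideal.mem_span_singleton_self z)
  rcases (isPolynomialPair hn hq).height_cases (isPrime_contract hP) with h0 | h0 | h0
  · rw [h0, extend_bot] at h1
    exact Or.inl h1
  · exact Or.inr (Or.inl ⟨contract P, isPrime_contract hP, h0, hne _ ht', hne _ hr', hne _ hs', h1⟩)
  · exact Or.inr (Or.inr ⟨contract P, h0, ht', hr', hs', h1⟩)

/-- The lower ends of the lines to the primes of level two: the nonzero primes that are not maximal,
listed by type. Their contractions to the centre have height one. -/
def levelOne (hn : 2 ≤ n) (hq : IsPrimitiveRoot q n) : Set (TwoSidedIdeal (QuantumWeyl K q)) :=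
  {P | P = ideal₁ (t q n) ∨ P = ideal₁ (r q n) ∨ P = ideal₁ (h q) ∨ P ∈ setN hn hq}

/-- The maximal primes of the diagram, listed by type. Their contractions to the centre are
maximal. -/
def levelTwo (hn : 2 ≤ n) (hq : IsPrimitiveRoot q n) : Set (TwoSidedIdeal (QuantumWeyl K q)) :=
  {P | P ∈ setT q n ∨ P = ideal₂ (t q n) (r q n) ∨ P ∈ setR q n ∨ P ∈ setM hn hq ∨ P ∈ setH q}

theorem level_cases (hn : 2 ≤ n) (hq : IsPrimitiveRoot q n) {P : TwoSidedIdeal (QuantumWeyl K q)}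
    (hP : P.IsPrimeIdeal) : P = ⊥ ∨ P ∈ levelOne hn hq ∨ P ∈ levelTwo hn hq := by
  unfold levelOne levelTwo
  simp only [Set.mem_ofPred_eq]
  by_cases hr : r q n ∈ P
  · rcases eq_of_r_mem hn hq hP hr with h1 | h1 | h1 <;> simp only [h1, true_or, or_true]
  by_cases ht : t q n ∈ P
  · rcases eq_of_t_mem hn hq hP ht with h1 | h1 | h1 <;> simp only [h1, true_or, or_true]
  by_cases hh : h q ∈ P
  · rcases eq_ideal_of_h_mem hn hq hP hh with h1 | h1 <;> simp only [h1, true_or, or_true]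
  · rw [← s_mem_iff_h_mem hn hq hP] at hh
    rcases eq_of_notMem hn hq hP ht hr hh with h1 | h1 | h1 <;> simp only [h1, true_or, or_true]

theorem levelOne_spec (hn : 2 ≤ n) (hq : IsPrimitiveRoot q n)
    {P : TwoSidedIdeal (QuantumWeyl K q)} (hP : P ∈ levelOne hn hq) :
    P.IsPrimeIdeal ∧ (contract P).height = 1 := by
  have hpair := isPolynomialPair hn hq
  rcases hP with rfl | rfl | rfl | hP
  · obtain ⟨h1, h2⟩ := ideal₁_t_spec hn hq
    exact ⟨h1, by rw [h2, hpair.symm.height_span_singleton]⟩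
  · obtain ⟨h1, h2⟩ := ideal₁_r_spec hn hq
    exact ⟨h1, by rw [h2, hpair.height_span_singleton]⟩
  · exact ⟨isPrimeIdeal_h hn hq, height_contract_ideal₁_h hn hq⟩
  · exact ⟨(setN_spec hn hq hP).1, (setN_spec hn hq hP).2.1⟩

theorem levelTwo_spec (hn : 2 ≤ n) (hq : IsPrimitiveRoot q n)
    {P : TwoSidedIdeal (QuantumWeyl K q)} (hP : P ∈ levelTwo hn hq) :
    P.IsPrimeIdeal ∧ (contract P).IsMaximal := by
  rcases hP with hP | rfl | hP | hP | hP
  · exact ⟨(setT_spec hn hq hP).1, (setT_spec hn hq hP).2.1⟩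
  · exact ideal₂_t_r_spec hn hq
  · exact ⟨(setR_spec hn hq hP).1, (setR_spec hn hq hP).2.1⟩
  · exact ⟨(setM_spec hn hq hP).1, (setM_spec hn hq hP).2.1⟩
  · exact ⟨isPrimeIdeal_of_mem_setH hn hq hP, isMaximal_contract_of_mem_setH hn hq hP⟩

/-- The height of the contraction is strictly monotone on the prime spectrum. -/
theorem height_contract_lt (hn : 2 ≤ n) (hq : IsPrimitiveRoot q n)
    {P Q : TwoSidedIdeal (QuantumWeyl K q)} (hP : P.IsPrimeIdeal) (hQ : Q.IsPrimeIdeal)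
    (hPQ : P < Q) : (contract P).height < (contract Q).height := by
  have hpair := isPolynomialPair hn hq
  by_cases hhP : h q ∈ P
  · rcases eq_ideal_of_h_mem hn hq hP hhP with rfl | hPH
    · rcases eq_ideal_of_h_mem hn hq hQ (hPQ.le hhP) with rfl | hQH
      · exact absurd hPQ (lt_irrefl _)
      · rw [height_contract_ideal₁_h hn hq,
          hpair.height_eq_two (isMaximal_contract_of_mem_setH hn hq hQH)]
        decide
    · exfalso
      obtain ⟨f, hf, rfl⟩ := hPH
      have hfQ := hPQ.le (right_mem_ideal₂ (h q) (aeval (x q) f))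
      rcases eq_ideal_of_h_mem hn hq hQ (hPQ.le hhP) with rfl | ⟨g, hg, rfl⟩
      · rw [aeval_x_mem_ideal₁_h_iff hn hq] at hfQ
        exact hf.2.1.ne_zero hfQ
      · rw [aeval_x_mem_ideal₂_h_iff hn hq hg] at hfQ
        have hfg : g = f :=
          eq_of_monic_of_associated hg.1 hf.1 (hg.2.1.associated_of_dvd hf.2.1 hfQ)
        rw [hfg] at hPQ
        exact lt_irrefl _ hPQ
  · refine hpair.height_lt_height (isPrime_contract hP) (isPrime_contract hQ)
      (lt_of_le_of_ne (contract_mono hPQ.le) fun heq ↦ hPQ.not_ge ?_)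
    have hhQ : h q ∉ Q := fun hhQ ↦ hhP ((s_mem_iff_h_mem hn hq hP).1 (by
      have := sZ_mem_contract hn hq hQ hhQ
      rw [← heq] at this
      exact this))
    rw [eq_extend_of_h_notMem hn hq hQ hhQ, ← heq]
    exact extend_contract_le P

end QuantumWeyl

theorem isDisjUnion_two {α : Type*} {S A B : Set α} (hS : S = A ∪ B) (hAB : Disjoint A B) :
    IsDisjUnion S ![A, B] := by
  refine ⟨?_, fun i j hij ↦ ?_⟩
  · rw [hS]
    ext
    simp [Fin.exists_fin_two]
  · fin_cases i <;> fin_cases j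
    exacts [absurd rfl hij, hAB, hAB.symm, absurd rfl hij]

namespace QuantumWeyl

variable {K : Type*} [Field K] {q : K} {n : ℕ}

theorem lt_of_contract_lt (hn : 2 ≤ n) (hq : IsPrimitiveRoot q n)
    {Q : TwoSidedIdeal (QuantumWeyl K q)} {p : Ideal (Subalgebra.center K (QuantumWeyl K q))}
    (hp : p < contract Q) : extend p < Q := by
  refine lt_of_le_of_ne (((extend_le_extend_iff hn hq).2 hp.le).trans (extend_contract_le Q)) ?_
  rintro rfl
  rw [contract_extend hn hq] at hp
  exact lt_irrefl _ hp

/-! ### The dotted lines -/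

/-- Let the contraction of `Q` be maximal, and let `w ≠ 0` in it be divisible by none of the
elements `t`, `r`, `s` that lie in `Q`. Then a minimal prime over `w` extends to an element of `𝒩''`
below `Q`. -/
theorem exists_mem_setN_lt (hn : 2 ≤ n) (hq : IsPrimitiveRoot q n)
    {Q : TwoSidedIdeal (QuantumWeyl K q)} (hQ : (contract Q).IsMaximal)
    {w : Subalgebra.center K (QuantumWeyl K q)} (hw : w ∈ contract Q) (hw0 : w ≠ 0)
    (ht : tZ hn hq ∈ contract Q → w ∉ Ideal.span {tZ hn hq})
    (hr : rZ hn hq ∈ contract Q → w ∉ Ideal.span {rZ hn hq})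
    (hs : sZ hn hq ∈ contract Q → w ∉ Ideal.span {sZ hn hq}) :
    ∃ P ∈ setN hn hq, P < Q := by
  obtain ⟨p, hp, hp1, hwp, hpQ⟩ := (isPolynomialPair hn hq).exists_height_eq_one_mem hQ hw hw0
  have key : ∀ z, (z ∈ contract Q → w ∉ Ideal.span {z}) → p ≠ Ideal.span {z} := by
    rintro z hz rfl
    exact hz (hpQ.le (Ideal.mem_span_singleton_self z)) hwp
  exact ⟨extend p, ⟨p, hp, hp1, key _ ht, key _ hr, key _ hs, rfl⟩, lt_of_contract_lt hn hq hpQ⟩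

theorem exists_mem_setN_lt_of_mem_setM (hn : 2 ≤ n) (hq : IsPrimitiveRoot q n)
    {Q : TwoSidedIdeal (QuantumWeyl K q)} (hQ : Q ∈ setM hn hq) : ∃ P ∈ setN hn hq, P < Q := by
  obtain ⟨-, hmax, ht, hr, hs⟩ := setM_spec hn hq hQ
  have hne : contract Q ≠ ⊥ := fun h0 ↦ by
    have := isDomain_center hn hq
    have h1 := (isPolynomialPair hn hq).height_eq_two hmax
    rw [h0, Ideal.height_bot] at h1
    exact absurd h1 (by decide)
  obtain ⟨w, hw, hw0⟩ := Submodule.exists_mem_ne_zero_of_ne_bot hne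
  exact exists_mem_setN_lt hn hq hmax hw hw0 (fun h ↦ absurd h ht) (fun h ↦ absurd h hr)
    (fun h ↦ absurd h hs)

theorem X_sub_one_mem_irrM : (X - C 1 : K[X]) ∈ irrM K :=
  ⟨monic_X_sub_C 1, irreducible_X_sub_C 1, fun h ↦ by simpa using congrArg (eval 0) h⟩

/-- A common zero of `t` and `r` separates `t - 1` and `r - 1` from `(t)` and `(r)`. -/
theorem sub_one_notMem_span (hn : 2 ≤ n) (hq : IsPrimitiveRoot q n)
    {z w : Subalgebra.center K (QuantumWeyl K q)} (hz : z = rZ hn hq ∨ z = tZ hn hq)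
    (hw : w = rZ hn hq ∨ w = tZ hn hq) : z - 1 ∉ Ideal.span {w} := by
  obtain ⟨φ, hr, ht⟩ := (isPolynomialPair hn hq).exists_algHom (0 : K) 0
  have h1 : ∀ z, z = rZ hn hq ∨ z = tZ hn hq → φ z = 0 := by
    rintro z (rfl | rfl)
    exacts [hr, ht]
  intro h2
  obtain ⟨v, hv⟩ := Ideal.mem_span_singleton.1 h2
  have h3 := congrArg φ hv
  rw [map_sub, map_mul, h1 z hz, h1 w hw, map_one, zero_mul] at h3
  simp at h3

theorem setM_nonempty (hn : 2 ≤ n) (hq : IsPrimitiveRoot q n) : (setM hn hq).Nonempty := by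
  obtain ⟨ε, d, hε, hd, hs⟩ := exists_sZ_eq hn hq
  have hq1 : q - 1 ≠ 0 := sub_ne_zero.2 (hq.ne_one (by omega))
  -- on the line `t = 1` the element `s` vanishes at only one point
  obtain ⟨a, ha0, ha⟩ : ∃ a : K, a ≠ 0 ∧ ε * a + d ≠ 0 := by
    by_cases h1 : ε * 1 + d = 0
    · refine ⟨q, hq.ne_zero (by omega), fun h2 ↦ mul_ne_zero hε hq1 ?_⟩
      linear_combination h2 - h1
    · exact ⟨1, one_ne_zero, h1⟩
  obtain ⟨φ, hr, ht⟩ := (isPolynomialPair hn hq).exists_algHom a (1 : K)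
  have hmax : (RingHom.ker φ).IsMaximal :=
    RingHom.ker_isMaximal_of_surjective φ fun c ↦ ⟨algebraMap K _ c, by
      rw [AlgHom.commutes, Algebra.algebraMap_self_apply]⟩
  refine ⟨extend (RingHom.ker φ), RingHom.ker φ, hmax, ?_, ?_, ?_, rfl⟩
  · rw [RingHom.mem_ker, ht]
    exact one_ne_zero
  · rwa [RingHom.mem_ker, hr]
  · rw [RingHom.mem_ker, hs, map_add, map_smul, map_mul, hr, ht, mul_one, AlgHom.commutes]
    exact ha

theorem exists_dotted (hn : 2 ≤ n) (hq : IsPrimitiveRoot q n) (i : Fin 5) :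
    ∃ P ∈ setN hn hq, ∃ Q ∈ dottedTops hn hq i, P < Q := by
  have hpair := isPolynomialPair hn hq
  have hr1 : rZ hn hq - 1 ≠ 0 := fun h ↦
    sub_one_notMem_span hn hq (Or.inl rfl) (Or.inl rfl) (h ▸ Ideal.zero_mem _)
  have ht1 : tZ hn hq - 1 ≠ 0 := fun h ↦
    sub_one_notMem_span hn hq (Or.inr rfl) (Or.inl rfl) (h ▸ Ideal.zero_mem _)
  suffices ∃ Q ∈ dottedTops hn hq i, ∃ P ∈ setN hn hq, P < Q by
    obtain ⟨Q, hQ, P, hP, hPQ⟩ := this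
    exact ⟨P, hP, Q, hQ, hPQ⟩
  fin_cases i
  · have hQ : ideal₂ (t q n) (aeval (r q n) (X - C 1 : K[X])) ∈ setT q n :=
      ⟨_, X_sub_one_mem_irrM, rfl⟩
    obtain ⟨h1, h2, h3, h4⟩ := setT_spec hn hq hQ
    refine ⟨_, hQ, exists_mem_setN_lt hn hq h2 (w := rZ hn hq - 1) ?_ hr1
      (fun _ ↦ sub_one_notMem_span hn hq (Or.inl rfl) (Or.inr rfl)) (fun h ↦ absurd h h4)
      (fun h ↦ absurd h (sZ_notMem_of_tZ_mem hn hq h2.isPrime h3))⟩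
    have := right_mem_ideal₂ (t q n) (aeval (r q n) (X - C 1 : K[X]))
    simpa using! this
  · obtain ⟨h1, h2⟩ := ideal₂_t_r_spec hn hq
    have ht : tZ hn hq ∈ contract (ideal₂ (t q n) (r q n)) := left_mem_ideal₂ _ _
    have hr : rZ hn hq ∈ contract (ideal₂ (t q n) (r q n)) := right_mem_ideal₂ _ _
    have hrt : rZ hn hq + tZ hn hq ∉ Ideal.span {tZ hn hq} := fun h ↦
      rZ_notMem_span_tZ hn hq ((Ideal.add_mem_iff_left _ (Ideal.mem_span_singleton_self _)).1 h)
    exact ⟨_, rfl, exists_mem_setN_lt hn hq h2 (Ideal.add_mem _ hr ht)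
      (fun h ↦ hrt (h ▸ Ideal.zero_mem _)) (fun _ ↦ hrt)
      (fun _ h ↦ tZ_notMem_span_rZ hn hq
        ((Ideal.add_mem_iff_right _ (Ideal.mem_span_singleton_self _)).1 h))
      (fun h ↦ absurd h (sZ_notMem_of_tZ_mem hn hq h2.isPrime ht))⟩
  · have hQ : ideal₂ (r q n) (aeval (t q n) (X - C 1 : K[X])) ∈ setR q n :=
      ⟨_, X_sub_one_mem_irrM, rfl⟩
    obtain ⟨h1, h2, h3, h4⟩ := setR_spec hn hq hQ
    refine ⟨_, hQ, exists_mem_setN_lt hn hq h2 (w := tZ hn hq - 1) ?_ ht1 (fun h ↦ absurd h h4)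
      (fun _ ↦ sub_one_notMem_span hn hq (Or.inr rfl) (Or.inl rfl))
      (fun h ↦ absurd h (sZ_notMem_of_rZ_mem hn hq h2.isPrime h3))⟩
    have := right_mem_ideal₂ (r q n) (aeval (t q n) (X - C 1 : K[X]))
    simpa using! this
  · obtain ⟨Q, hQ⟩ := setM_nonempty hn hq
    exact ⟨Q, hQ, exists_mem_setN_lt_of_mem_setM hn hq hQ⟩
  · have hQ : ideal₂ (h q) (aeval (x q) (X - C 1 : K[X])) ∈ setH q :=
      ⟨_, X_sub_one_mem_irrM, rfl⟩
    have h1 := isPrimeIdeal_of_mem_setH hn hq hQ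
    have h2 := isMaximal_contract_of_mem_setH hn hq hQ
    have h3 := sZ_mem_contract hn hq h1 (left_mem_ideal₂ _ _)
    refine ⟨_, hQ, exists_mem_setN_lt hn hq h2 (w := tZ hn hq - 1) ?_ ht1
      (fun h ↦ absurd h3 (sZ_notMem_of_tZ_mem hn hq h2.isPrime h))
      (fun h ↦ absurd h3 (sZ_notMem_of_rZ_mem hn hq h2.isPrime h)) (fun _ h ↦ ?_)⟩
    · have h4 : aeval (x q) (X ^ n - 1 : K[X]) ∈ ideal₂ (h q) (aeval (x q) (X - C 1 : K[X])) := by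
        rw [aeval_x_mem_ideal₂_h_iff hn hq X_sub_one_mem_irrM, C_1]
        exact sub_one_dvd_pow_sub_one _ n
      simpa [t] using! h4
    · have h4 : Ideal.span {sZ hn hq} ≤ contract (ideal₁ (QuantumWeyl.h q)) :=
        (Ideal.span_singleton_le_iff_mem _).2
          (sZ_mem_contract hn hq (isPrimeIdeal_h hn hq) (mem_ideal₁_self _))
      exact t_sub_one_notMem_ideal₁_h hn hq (h4 h)

/-! ### The containments -/

theorem lt_of_solidLine (hn : 2 ≤ n) (hq : IsPrimitiveRoot q n)
    {P Q : TwoSidedIdeal (QuantumWeyl K q)} (hPQ : SolidLine hn hq P Q) : P < Q := by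
  have hpair := isPolynomialPair hn hq
  have := isDomain_center hn hq
  have h01 : ∀ Q ∈ levelOne hn hq, ⊥ < Q := fun Q hQ ↦ by
    refine bot_lt_iff_ne_bot.2 ?_
    rintro rfl
    have h1 := (levelOne_spec hn hq hQ).2
    rw [(isPrimeIdeal_bot hn hq).2, Ideal.height_bot] at h1
    exact absurd h1 (by decide)
  have h12 : ∀ P ∈ levelOne hn hq, ∀ Q ∈ levelTwo hn hq, P ≤ Q → P < Q := fun P hP Q hQ hle ↦ by
    refine lt_of_le_of_ne hle ?_
    rintro rfl
    have h1 := (levelOne_spec hn hq hP).2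
    rw [hpair.height_eq_two (levelTwo_spec hn hq hQ).2] at h1
    exact absurd h1 (by decide)
  induction hPQ with
  | zero_t => exact h01 _ (Or.inl rfl)
  | zero_r => exact h01 _ (Or.inr (Or.inl rfl))
  | zero_h => exact h01 _ (Or.inr (Or.inr (Or.inl rfl)))
  | zero_N P hP => exact h01 _ (Or.inr (Or.inr (Or.inr hP)))
  | t_T Q hQ =>
    exact h12 _ (Or.inl rfl) _ (Or.inl hQ) (ideal₁_le_iff.2 (setT_spec hn hq hQ).2.2.1)
  | t_tr =>
    exact h12 _ (Or.inl rfl) _ (Or.inr (Or.inl rfl)) (ideal₁_le_iff.2 (left_mem_ideal₂ _ _))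
  | r_tr =>
    exact h12 _ (Or.inr (Or.inl rfl)) _ (Or.inr (Or.inl rfl))
      (ideal₁_le_iff.2 (right_mem_ideal₂ _ _))
  | r_R Q hQ =>
    exact h12 _ (Or.inr (Or.inl rfl)) _ (Or.inr (Or.inr (Or.inl hQ)))
      (ideal₁_le_iff.2 (setR_spec hn hq hQ).2.2.1)
  | h_H Q hQ =>
    refine h12 _ (Or.inr (Or.inr (Or.inl rfl))) _ (Or.inr (Or.inr (Or.inr (Or.inr hQ)))) ?_
    obtain ⟨f, -, rfl⟩ := hQ
    exact ideal₁_le_iff.2 (left_mem_ideal₂ _ _)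

theorem mem_levelTwo_iff_exists_dottedTops (hn : 2 ≤ n) (hq : IsPrimitiveRoot q n)
    {Q : TwoSidedIdeal (QuantumWeyl K q)} :
    (∃ i, Q ∈ dottedTops hn hq i) ↔ Q ∈ levelTwo hn hq := by
  simp [dottedTops, levelTwo, Fin.exists_fin_succ]

theorem lt_of_link (hn : 2 ≤ n) (hq : IsPrimitiveRoot q n)
    {P Q : TwoSidedIdeal (QuantumWeyl K q)} (hPQ : Link hn hq P Q) : P < Q := by
  rcases hPQ with hPQ | ⟨hP, hQ, hle⟩
  · exact lt_of_solidLine hn hq hPQ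
  · refine lt_of_le_of_ne hle ?_
    rintro rfl
    have h1 := (setN_spec hn hq hP).2.1
    rw [(isPolynomialPair hn hq).height_eq_two (levelTwo_spec hn hq
      ((mem_levelTwo_iff_exists_dottedTops hn hq).1 hQ)).2] at h1
    exact absurd h1 (by decide)

/-- A strict containment between a prime of level one and a prime of level two is a single line of
the diagram. -/
theorem link_of_lt (hn : 2 ≤ n) (hq : IsPrimitiveRoot q n)
    {P Q : TwoSidedIdeal (QuantumWeyl K q)} (hP : P ∈ levelOne hn hq) (hQ : Q ∈ levelTwo hn hq)
    (hPQ : P < Q) : Link hn hq P Q := by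
  have hQp := (levelTwo_spec hn hq hQ).1
  rcases hP with rfl | rfl | rfl | hP
  · have ht : t q n ∈ Q := ideal₁_le_iff.1 hPQ.le
    rcases hQ with hQ | rfl | hQ | hQ | ⟨f, -, rfl⟩
    · exact Or.inl (.t_T _ hQ)
    · exact Or.inl .t_tr
    · exact absurd ht (setR_spec hn hq hQ).2.2.2
    · exact absurd ht (setM_spec hn hq hQ).2.2.1
    · exact absurd (left_mem_ideal₂ _ _) (h_notMem_of_t_mem hn hq hQp ht)
  · have hr : r q n ∈ Q := ideal₁_le_iff.1 hPQ.le
    rcases hQ with hQ | rfl | hQ | hQ | ⟨f, -, rfl⟩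
    · exact absurd hr (setT_spec hn hq hQ).2.2.2
    · exact Or.inl .r_tr
    · exact Or.inl (.r_R _ hQ)
    · exact absurd hr (setM_spec hn hq hQ).2.2.2.1
    · exact absurd (left_mem_ideal₂ _ _) (h_notMem_of_r_mem hn hq hQp hr)
  · have hh : h q ∈ Q := ideal₁_le_iff.1 hPQ.le
    rcases hQ with hQ | rfl | hQ | hQ | hQ
    · exact absurd hh (h_notMem_of_t_mem hn hq hQp (setT_spec hn hq hQ).2.2.1)
    · exact absurd hh (h_notMem_of_t_mem hn hq hQp (left_mem_ideal₂ _ _))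
    · exact absurd hh (h_notMem_of_r_mem hn hq hQp (setR_spec hn hq hQ).2.2.1)
    · exact absurd ((s_mem_iff_h_mem hn hq hQp).2 hh) (setM_spec hn hq hQ).2.2.2.2
    · exact Or.inl (.h_H _ hQ)
  · exact Or.inr ⟨hP, (mem_levelTwo_iff_exists_dottedTops hn hq).2 hQ, hPQ.le⟩

theorem link_bot_of_mem_levelOne (hn : 2 ≤ n) (hq : IsPrimitiveRoot q n)
    {P : TwoSidedIdeal (QuantumWeyl K q)} (hP : P ∈ levelOne hn hq) : Link hn hq ⊥ P := by
  rcases hP with rfl | rfl | rfl | hP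
  exacts [Or.inl .zero_t, Or.inl .zero_r, Or.inl .zero_h, Or.inl (.zero_N _ hP)]

theorem exists_mem_levelOne_lt (hn : 2 ≤ n) (hq : IsPrimitiveRoot q n)
    {Q : TwoSidedIdeal (QuantumWeyl K q)} (hQ : Q ∈ levelTwo hn hq) :
    ∃ P ∈ levelOne hn hq, P < Q := by
  rcases hQ with hQ | rfl | hQ | hQ | hQ
  · exact ⟨_, Or.inl rfl, lt_of_solidLine hn hq (.t_T _ hQ)⟩
  · exact ⟨_, Or.inl rfl, lt_of_solidLine hn hq .t_tr⟩
  · exact ⟨_, Or.inr (Or.inl rfl), lt_of_solidLine hn hq (.r_R _ hQ)⟩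
  · obtain ⟨P, hP, hPQ⟩ := exists_mem_setN_lt_of_mem_setM hn hq hQ
    exact ⟨P, Or.inr (Or.inr (Or.inr hP)), hPQ⟩
  · exact ⟨_, Or.inr (Or.inr (Or.inl rfl)), lt_of_solidLine hn hq (.h_H _ hQ)⟩

theorem lt_iff_transGen_link (hn : 2 ≤ n) (hq : IsPrimitiveRoot q n)
    {P Q : TwoSidedIdeal (QuantumWeyl K q)} (hP : P.IsPrimeIdeal) (hQ : Q.IsPrimeIdeal) :
    P < Q ↔ Relation.TransGen (Link hn hq) P Q := by
  have hpair := isPolynomialPair hn hq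
  have := isDomain_center hn hq
  constructor
  · intro hPQ
    have hlt := height_contract_lt hn hq hP hQ hPQ
    rcases level_cases hn hq hQ with rfl | hQ1 | hQ2
    · exact absurd hPQ not_lt_bot
    · rw [(levelOne_spec hn hq hQ1).2] at hlt
      rcases level_cases hn hq hP with rfl | hP1 | hP2
      · exact .single (link_bot_of_mem_levelOne hn hq hQ1)
      · rw [(levelOne_spec hn hq hP1).2] at hlt
        exact absurd hlt (lt_irrefl _)
      · rw [hpair.height_eq_two (levelTwo_spec hn hq hP2).2] at hlt
        exact absurd hlt (by decide)
    · rw [hpair.height_eq_two (levelTwo_spec hn hq hQ2).2] at hlt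
      rcases level_cases hn hq hP with rfl | hP1 | hP2
      · obtain ⟨P, hP1, hPQ'⟩ := exists_mem_levelOne_lt hn hq hQ2
        exact .tail (.single (link_bot_of_mem_levelOne hn hq hP1)) (link_of_lt hn hq hP1 hQ2 hPQ')
      · exact .single (link_of_lt hn hq hP1 hQ2 hPQ)
      · rw [hpair.height_eq_two (levelTwo_spec hn hq hP2).2] at hlt
        exact absurd hlt (lt_irrefl _)
  · intro hPQ
    clear hQ
    induction hPQ with
    | single h => exact lt_of_link hn hq h
    | tail _ h ih => exact ih.trans (lt_of_link hn hq h)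

/-! ### The pieces of the spectrum -/

theorem primeSpecAvoid_eq (hn : 2 ≤ n) (hq : IsPrimitiveRoot q n) :
    primeSpecAvoid {t q n, r q n, s q n} = primesTRS hn hq := by
  ext P
  constructor
  · rintro ⟨hP, hC⟩
    exact ⟨contract P, isPrime_contract hP, hC (t q n) (by simp), hC (r q n) (by simp),
      hC (s q n) (by simp), eq_extend_contract hn hq hP (hC (s q n) (by simp))⟩
  · rintro ⟨p, hp, ht, hr, hs, rfl⟩
    refine ⟨isPrimeIdeal_extend hn hq hp hs, ?_⟩
    rintro _ (rfl | rfl | rfl)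
    exacts [fun h ↦ ht ((coe_mem_extend hn hq).1 h), fun h ↦ hr ((coe_mem_extend hn hq).1 h),
      fun h ↦ hs ((coe_mem_extend hn hq).1 h)]

theorem mem_primesTRS_iff (hn : 2 ≤ n) (hq : IsPrimitiveRoot q n)
    {P : TwoSidedIdeal (QuantumWeyl K q)} : P ∈ primesTRS hn hq ↔
      P.IsPrimeIdeal ∧ t q n ∉ P ∧ r q n ∉ P ∧ s q n ∉ P := by
  rw [← primeSpecAvoid_eq hn hq]
  simp [primeSpecAvoid, primeSpec]

theorem isDisjUnion_primesTRS (hn : 2 ≤ n) (hq : IsPrimitiveRoot q n) :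
    IsDisjUnion (primesTRS hn hq) ![{⊥}, setN hn hq, setM hn hq] := by
  have hpair := isPolynomialPair hn hq
  have := isDomain_center hn hq
  have h0N : Disjoint {⊥} (setN hn hq) := by
    refine Set.disjoint_singleton_left.2 fun hP ↦ ?_
    have h1 := (setN_spec hn hq hP).2.1
    rw [(isPrimeIdeal_bot hn hq).2, Ideal.height_bot] at h1
    exact absurd h1 (by decide)
  have h0M : Disjoint {⊥} (setM hn hq) := by
    refine Set.disjoint_singleton_left.2 fun hP ↦ ?_
    have h1 := hpair.height_eq_two (setM_spec hn hq hP).2.1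
    rw [(isPrimeIdeal_bot hn hq).2, Ideal.height_bot] at h1
    exact absurd h1 (by decide)
  have hNM : Disjoint (setN hn hq) (setM hn hq) := by
    refine Set.disjoint_left.2 fun P hN hM ↦ ?_
    have h1 := hpair.height_eq_two (setM_spec hn hq hM).2.1
    rw [(setN_spec hn hq hN).2.1] at h1
    exact absurd h1 (by decide)
  refine ⟨?_, fun i j hij ↦ ?_⟩
  · ext P
    rw [mem_primesTRS_iff hn hq]
    rw [Set.mem_iUnion]
    constructor
    · rintro ⟨hP, ht, hr, hs⟩
      rcases eq_of_notMem hn hq hP ht hr hs with h1 | h1 | h1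
      exacts [⟨0, h1⟩, ⟨1, h1⟩, ⟨2, h1⟩]
    · rintro ⟨i, hi⟩
      fin_cases i
      · obtain rfl : P = ⊥ := hi
        have h1 : ∀ z : Subalgebra.center K (QuantumWeyl K q), z ≠ 0 →
            (z : QuantumWeyl K q) ∉ (⊥ : TwoSidedIdeal (QuantumWeyl K q)) :=
          fun z hz hz0 ↦ hz (Subtype.ext hz0)
        exact ⟨(isPrimeIdeal_bot hn hq).1, h1 _ (tZ_ne_zero hn hq), h1 _ (rZ_ne_zero hn hq),
          h1 _ (sZ_ne_zero hn hq)⟩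
      · have := setN_spec hn hq hi
        exact ⟨this.1, this.2.2⟩
      · have := setM_spec hn hq hi
        exact ⟨this.1, this.2.2⟩
  · fin_cases i <;> fin_cases j
    exacts [absurd rfl hij, h0N, h0M, h0N.symm, absurd rfl hij, hNM, h0M.symm, hNM.symm,
      absurd rfl hij]

theorem isDisjUnion_primeSpecQuot_r (hn : 2 ≤ n) (hq : IsPrimitiveRoot q n) :
    IsDisjUnion (primeSpecQuot (ideal₁ (r q n)) {t q n}) ![{ideal₁ (r q n)}, setR q n] := by
  refine isDisjUnion_two ?_ (Set.disjoint_singleton_left.2 fun hP ↦ ?_)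
  · ext P
    simp only [mem_primeSpecQuot_iff, ideal₁_le_iff, Set.mem_singleton_iff, forall_eq,
      Set.mem_union]
    constructor
    · rintro ⟨hP, hr, ht⟩
      rcases eq_of_r_mem hn hq hP hr with h1 | h1 | rfl
      exacts [Or.inl h1, Or.inr h1, absurd (left_mem_ideal₂ _ _) ht]
    · rintro (rfl | hP)
      · exact ⟨(ideal₁_r_spec hn hq).1, mem_ideal₁_self _, t_notMem_ideal₁_r hn hq⟩
      · obtain ⟨h1, -, h2⟩ := setR_spec hn hq hP
        exact ⟨h1, h2⟩
  · have h1 := (levelOne_spec hn hq (Or.inr (Or.inl rfl) : ideal₁ (r q n) ∈ levelOne hn hq)).2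
    rw [(isPolynomialPair hn hq).height_eq_two (setR_spec hn hq hP).2.1] at h1
    exact absurd h1 (by decide)

theorem isDisjUnion_primeSpecQuot_t (hn : 2 ≤ n) (hq : IsPrimitiveRoot q n) :
    IsDisjUnion (primeSpecQuot (ideal₁ (t q n)) {r q n}) ![{ideal₁ (t q n)}, setT q n] := by
  refine isDisjUnion_two ?_ (Set.disjoint_singleton_left.2 fun hP ↦ ?_)
  · ext P
    simp only [mem_primeSpecQuot_iff, ideal₁_le_iff, Set.mem_singleton_iff, forall_eq,
      Set.mem_union]
    constructor
    · rintro ⟨hP, ht, hr⟩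
      rcases eq_of_t_mem hn hq hP ht with h1 | h1 | rfl
      exacts [Or.inl h1, Or.inr h1, absurd (right_mem_ideal₂ _ _) hr]
    · rintro (rfl | hP)
      · exact ⟨(ideal₁_t_spec hn hq).1, mem_ideal₁_self _, r_notMem_ideal₁_t hn hq⟩
      · obtain ⟨h1, -, h2⟩ := setT_spec hn hq hP
        exact ⟨h1, h2⟩
  · have h1 := (levelOne_spec hn hq (Or.inl rfl : ideal₁ (t q n) ∈ levelOne hn hq)).2
    rw [(isPolynomialPair hn hq).height_eq_two (setT_spec hn hq hP).2.1] at h1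
    exact absurd h1 (by decide)

theorem primeSpecQuot_t_r (hn : 2 ≤ n) (hq : IsPrimitiveRoot q n) :
    primeSpecQuot (ideal₂ (t q n) (r q n)) ∅ = {ideal₂ (t q n) (r q n)} := by
  ext P
  simp only [mem_primeSpecQuot_iff, ideal₂_le_iff, Set.mem_singleton_iff, Set.mem_empty_iff_false,
    false_imp_iff, implies_true, and_true]
  constructor
  · rintro ⟨hP, ht, hr⟩
    rcases eq_of_r_mem hn hq hP hr with rfl | h1 | h1
    exacts [absurd ht (t_notMem_ideal₁_r hn hq), absurd ht (setR_spec hn hq h1).2.2.2, h1]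
  · rintro rfl
    exact ⟨(ideal₂_t_r_spec hn hq).1, left_mem_ideal₂ _ _, right_mem_ideal₂ _ _⟩

theorem isDisjUnion_primeSpecQuot_h (hn : 2 ≤ n) (hq : IsPrimitiveRoot q n) :
    IsDisjUnion (primeSpecQuot (ideal₁ (h q)) ∅) ![{ideal₁ (h q)}, setH q] := by
  refine isDisjUnion_two ?_ (Set.disjoint_singleton_left.2 fun hP ↦ ?_)
  · ext P
    simp only [mem_primeSpecQuot_iff, ideal₁_le_iff, Set.mem_singleton_iff,
      Set.mem_empty_iff_false, false_imp_iff, implies_true, and_true, Set.mem_union]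
    constructor
    · rintro ⟨hP, hh⟩
      exact eq_ideal_of_h_mem hn hq hP hh
    · rintro (rfl | hP)
      · exact ⟨isPrimeIdeal_h hn hq, mem_ideal₁_self _⟩
      · refine ⟨isPrimeIdeal_of_mem_setH hn hq hP, ?_⟩
        obtain ⟨f, -, rfl⟩ := hP
        exact left_mem_ideal₂ _ _
  · have h1 := height_contract_ideal₁_h hn hq
    rw [(isPolynomialPair hn hq).height_eq_two (isMaximal_contract_of_mem_setH hn hq hP)] at h1
    exact absurd h1 (by decide)

theorem isDisjUnion_primeSpec (hn : 2 ≤ n) (hq : IsPrimitiveRoot q n) :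
    IsDisjUnion (primeSpec (QuantumWeyl K q))
      ![primeSpecAvoid {t q n, r q n, s q n}, primeSpecQuot (ideal₁ (r q n)) {t q n},
        primeSpecQuot (ideal₁ (t q n)) {r q n}, primeSpecQuot (ideal₂ (t q n) (r q n)) ∅,
        primeSpecQuot (ideal₁ (h q)) ∅] := by
  rw [primeSpecAvoid_eq hn hq]
  have hpr : ∀ P : TwoSidedIdeal (QuantumWeyl K q), P ∈ primeSpec (QuantumWeyl K q) ↔
      P.IsPrimeIdeal := fun P ↦ Iff.rfl
  have hr := fun P : TwoSidedIdeal (QuantumWeyl K q) ↦ h_notMem_of_r_mem hn hq (P := P)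
  have ht := fun P : TwoSidedIdeal (QuantumWeyl K q) ↦ h_notMem_of_t_mem hn hq (P := P)
  have hs := fun P : TwoSidedIdeal (QuantumWeyl K q) ↦ s_mem_iff_h_mem hn hq (P := P)
  refine ⟨?_, fun i j hij ↦ Set.disjoint_left.2 fun P hi hj ↦ ?_⟩
  · ext P
    specialize ht P
    specialize hr P
    specialize hs P
    simp [Fin.exists_fin_succ, mem_primeSpecQuot_iff, ideal₁_le_iff, ideal₂_le_iff,
      mem_primesTRS_iff hn hq, hpr]
    tauto
  · specialize ht P
    specialize hr P
    specialize hs P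
    fin_cases i <;> fin_cases j <;>
      simp [mem_primeSpecQuot_iff, ideal₁_le_iff, ideal₂_le_iff,
        mem_primesTRS_iff hn hq, hpr] at hi hj hij <;> tauto

end QuantumWeyl

end

theorem mainTheorem1 {K : Type*} [Field K] {n : ℕ} (hn : 2 ≤ n) {q : K}
    (hq : IsPrimitiveRoot q n) :
    -- the centre is the polynomial algebra in `r` and `t`
    (AlgebraicIndependent K ![QuantumWeyl.rZ hn hq, QuantumWeyl.tZ hn hq] ∧
      Algebra.adjoin K {QuantumWeyl.rZ hn hq, QuantumWeyl.tZ hn hq} = ⊤) ∧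
    -- the five pieces of the spectrum
    IsDisjUnion (primeSpec (QuantumWeyl K q))
      ![primeSpecAvoid {QuantumWeyl.t q n, QuantumWeyl.r q n, QuantumWeyl.s q n},
        primeSpecQuot (QuantumWeyl.ideal₁ (QuantumWeyl.r q n)) {QuantumWeyl.t q n},
        primeSpecQuot (QuantumWeyl.ideal₁ (QuantumWeyl.t q n)) {QuantumWeyl.r q n},
        primeSpecQuot (QuantumWeyl.ideal₂ (QuantumWeyl.t q n) (QuantumWeyl.r q n)) ∅,
        primeSpecQuot (QuantumWeyl.ideal₁ (QuantumWeyl.h q)) ∅] ∧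
    -- their descriptions
    primeSpecAvoid {QuantumWeyl.t q n, QuantumWeyl.r q n, QuantumWeyl.s q n} =
      QuantumWeyl.primesTRS hn hq ∧
    IsDisjUnion (QuantumWeyl.primesTRS hn hq)
      ![{⊥}, QuantumWeyl.setN hn hq, QuantumWeyl.setM hn hq] ∧
    IsDisjUnion (primeSpecQuot (QuantumWeyl.ideal₁ (QuantumWeyl.r q n)) {QuantumWeyl.t q n})
      ![{QuantumWeyl.ideal₁ (QuantumWeyl.r q n)}, QuantumWeyl.setR q n] ∧
    IsDisjUnion (primeSpecQuot (QuantumWeyl.ideal₁ (QuantumWeyl.t q n)) {QuantumWeyl.r q n})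
      ![{QuantumWeyl.ideal₁ (QuantumWeyl.t q n)}, QuantumWeyl.setT q n] ∧
    primeSpecQuot (QuantumWeyl.ideal₂ (QuantumWeyl.t q n) (QuantumWeyl.r q n)) ∅ =
      {QuantumWeyl.ideal₂ (QuantumWeyl.t q n) (QuantumWeyl.r q n)} ∧
    IsDisjUnion (primeSpecQuot (QuantumWeyl.ideal₁ (QuantumWeyl.h q)) ∅)
      ![{QuantumWeyl.ideal₁ (QuantumWeyl.h q)}, QuantumWeyl.setH q] ∧
    -- the solid lines are strict containments
    (∀ P Q : TwoSidedIdeal (QuantumWeyl K q), QuantumWeyl.SolidLine hn hq P Q → P < Q) ∧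
    -- each dotted line is a containment for some pair of primes
    (∀ i, ∃ P ∈ QuantumWeyl.setN hn hq, ∃ Q ∈ QuantumWeyl.dottedTops hn hq i, P < Q) ∧
    -- all strict containments come from the diagram
    (∀ P ∈ primeSpec (QuantumWeyl K q), ∀ Q ∈ primeSpec (QuantumWeyl K q),
      P < Q ↔ Relation.TransGen (QuantumWeyl.Link hn hq) P Q) :=
  ⟨⟨QuantumWeyl.algebraicIndependent_rZ_tZ hn hq, QuantumWeyl.adjoin_rZ_tZ hn hq⟩,
    QuantumWeyl.isDisjUnion_primeSpec hn hq, QuantumWeyl.primeSpecAvoid_eq hn hq,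
    QuantumWeyl.isDisjUnion_primesTRS hn hq, QuantumWeyl.isDisjUnion_primeSpecQuot_r hn hq,
    QuantumWeyl.isDisjUnion_primeSpecQuot_t hn hq, QuantumWeyl.primeSpecQuot_t_r hn hq,
    QuantumWeyl.isDisjUnion_primeSpecQuot_h hn hq,
    fun _ _ ↦ QuantumWeyl.lt_of_solidLine hn hq, QuantumWeyl.exists_dotted hn hq,
    fun _ hP _ hQ ↦ QuantumWeyl.lt_iff_transGen_link hn hq hP hQ⟩
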